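/- Let $N,m,n\ge 1$ be integers and $K>0$ real, put $M=N+mn$, and let $$Y_I=Y_I(N,m,n;K)=\{(W,Z)\in\mathbb C^N\times\mathbb C^{m\times n}: I-Z\overline Z^t>0,\ |W|^{2K}<\det(I-Z\overline Z^t)\}.$$ Then $Y_I$ has a Bergman kernel (the reproducing kernel of the square-integrable holomorphic functions on $Y_I$), whose diagonal values have the form $$K^{-mn}\pi^{-(mn+N)}\,G(X)\,\det(I-Z\overline Z^t)^{-(m+n+N/K)},\qquad X=|W|^2\det(I-Z\overline Z^t)^{-1/K},$$ $$G(X)=\sum_{i=0}^{mn+1}b_i\,\Gamma(N+i)\,(1-X)^{-(N+i)}$$ with real constants $b_i$, and the following conditions are equivalent. 1. For some constant $c>0$ the function $\widetilde G=cG$ is twice continuously differentiable on $[0,1)$ and solves the reduced Monge–Ampère problem $$(M+1)^{-M}\Big[\tfrac{X}{K}\widetilde G'+\big(m+n+\tfrac NK\big)\widetilde G\Big]^{mn}\big[\widetilde G\widetilde G'+(\widetilde G\widetilde G''-(\widetilde G')^2)X\big]\frac{(\widetilde G')^{N-1}}{\widetilde G^{M+1}}=\widetilde G\quad(0\le X<1),$$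 $$\widetilde G(0)=K^{-mn},\qquad \lim_{X\to1^-}\widetilde G(X)=\infty.$$ 2. The Bergman metric of $Y_I$ is Kähler–Einstein (it is positive definite and its Ricci tensor is a constant multiple of it). 3. $K=1$, and $m=1$ or $n=1$. 4. $Y_I$ is the Euclidean unit ball of $\mathbb C^{N+mn}$. 5. $Y_I$ is homogeneous, i.e. its group of biholomorphic automorphisms acts transitively. -/

import Mathlib

open Set Filter Topology MeasureTheory
open scoped ComplexConjugate ComplexOrder Matrix

noncomputable section

namespace CartanHartogs

/-! ### Bergman kernel, Bergman metric and Kähler–Einstein condition in `ℂ^ι` -/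

section General

variable {ι : Type} [Fintype ι] [DecidableEq ι]

/-- The Bergman space of `Ω ⊆ ℂ^ι`: holomorphic functions on `Ω` that are square integrable
for Lebesgue measure. -/
def bergmanSpace (Ω : Set (ι → ℂ)) : Set ((ι → ℂ) → ℂ) :=
  {f | DifferentiableOn ℂ f Ω ∧ MemLp f 2 (volume.restrict Ω)}

/-- `k` is the Bergman (reproducing) kernel of `Ω`: each `k(·, w)`, `w ∈ Ω`, lies in the Bergman
space and `f w = ⟨f, k(·, w)⟩` for every `f` in the Bergman space. These conditions determine
`k` on `Ω × Ω`. -/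
def IsBergmanKernel (Ω : Set (ι → ℂ)) (k : (ι → ℂ) → (ι → ℂ) → ℂ) : Prop :=
  (∀ w ∈ Ω, (fun z => k z w) ∈ bergmanSpace Ω) ∧
  (∀ f ∈ bergmanSpace Ω, ∀ w ∈ Ω, f w = ∫ z in Ω, f z * conj (k z w))

/-- The Wirtinger derivative `∂f/∂z_i = (∂f/∂x_i - √-1 ∂f/∂y_i) / 2`. -/
def dz (i : ι) (f : (ι → ℂ) → ℂ) (p : ι → ℂ) : ℂ :=
  (fderiv ℝ f p (Pi.single i 1) - Complex.I * fderiv ℝ f p (Pi.single i Complex.I)) / 2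

/-- The Wirtinger derivative `∂f/∂z̄_i = (∂f/∂x_i + √-1 ∂f/∂y_i) / 2`. -/
def dzbar (i : ι) (f : (ι → ℂ) → ℂ) (p : ι → ℂ) : ℂ :=
  (fderiv ℝ f p (Pi.single i 1) + Complex.I * fderiv ℝ f p (Pi.single i Complex.I)) / 2

/-- The complex Hessian `(∂²u / ∂z_i ∂z̄_j)` of a real function `u`. -/
def complexHessian (u : (ι → ℂ) → ℝ) (p : ι → ℂ) : Matrix ι ι ℂ :=
  Matrix.of fun i j => dz i (dzbar j (fun q => (u q : ℂ))) p

/-- The Bergman metric tensor `g_{ij̄} = ∂² log k(z,z) / ∂z_i ∂z̄_j` of a domain with Bergman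
kernel `k` (the diagonal values of `k` are real and positive). -/
def bergmanMetric (k : (ι → ℂ) → (ι → ℂ) → ℂ) (p : ι → ℂ) : Matrix ι ι ℂ :=
  complexHessian (fun q => Real.log (k q q).re) p

/-- The Ricci tensor `R_{ij̄} = -∂² log det g / ∂z_i ∂z̄_j` of a Kähler metric `g`. -/
def ricci (g : (ι → ℂ) → Matrix ι ι ℂ) (p : ι → ℂ) : Matrix ι ι ℂ :=
  -complexHessian (fun q => Real.log (g q).det.re) p

/-- The tensor `g` is a (positive definite) Hermitian metric on `Ω` whose Ricci tensor is
a constant multiple of `g`. -/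
def IsEinsteinOn (Ω : Set (ι → ℂ)) (g : (ι → ℂ) → Matrix ι ι ℂ) : Prop :=
  (∀ p ∈ Ω, (g p).PosDef) ∧ ∃ c : ℝ, ∀ p ∈ Ω, ricci g p = (c : ℂ) • g p

/-- `Ω` is homogeneous: its biholomorphic self-maps act transitively. -/
def IsHomogeneousDomain (Ω : Set (ι → ℂ)) : Prop :=
  ∀ p ∈ Ω, ∀ q ∈ Ω, ∃ f g : (ι → ℂ) → (ι → ℂ),
    DifferentiableOn ℂ f Ω ∧ DifferentiableOn ℂ g Ω ∧ MapsTo f Ω Ω ∧ MapsTo g Ω Ω ∧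
    InvOn g f Ω Ω ∧ f p = q

/-- The Euclidean unit ball of `ℂ^ι`. -/
def unitBall (ι : Type) [Fintype ι] : Set (ι → ℂ) := {p | ∑ i, ‖p i‖ ^ 2 < 1}

end General

/-! ### The Cartan–Hartogs domain of the first type -/

/-- Index set of the coordinates `(W, Z)` of `ℂ^N × ℂ^{m×n}`. -/
abbrev Idx (N m n : ℕ) : Type := Fin N ⊕ (Fin m × Fin n)

/-- The Cartan domain `R_I(m,n)` of `m × n` matrices `Z` with `I - Z Z̄ᵗ > 0`. -/
def cartanI (m n : ℕ) : Set (Matrix (Fin m) (Fin n) ℂ) := {Z | (1 - Z * Zᴴ).PosDef}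

/-- The component `Z` of the point `(W, Z)`. -/
def matZ {N m n : ℕ} (p : Idx N m n → ℂ) : Matrix (Fin m) (Fin n) ℂ :=
  Matrix.of fun i j => p (Sum.inr (i, j))

/-- `|W|² = ∑ |W_j|²` at the point `(W, Z)`. -/
def normSqW {N m n : ℕ} (p : Idx N m n → ℂ) : ℝ := ∑ j, ‖p (Sum.inl j)‖ ^ 2

/-- The real number `det (I - Z Z̄ᵗ)` at the point `(W, Z)`. -/
def genNorm {N m n : ℕ} (p : Idx N m n → ℂ) : ℝ := (1 - matZ p * (matZ p)ᴴ).det.re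

/-- `Y_I(N,m,n;K) = {(W,Z) : Z ∈ R_I(m,n), |W|^{2K} < det (I - Z Z̄ᵗ)}`. -/
def domainY (N m n : ℕ) (K : ℝ) : Set (Idx N m n → ℂ) :=
  {p | matZ p ∈ cartanI m n ∧ normSqW p ^ K < genNorm p}

/-- `X(W,Z) = |W|² det (I - Z Z̄ᵗ)^{-1/K}`. -/
def varX {N m n : ℕ} (K : ℝ) (p : Idx N m n → ℂ) : ℝ := normSqW p * genNorm p ^ (-(1 / K))

/-- `G(X) = ∑_{i=0}^{mn+1} b_i Γ(N+i) (1-X)^{-(N+i)}`. -/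
def bergmanG (N m n : ℕ) (b : ℕ → ℝ) (X : ℝ) : ℝ :=
  ∑ i ∈ Finset.range (m * n + 2), b i * Real.Gamma ((N : ℝ) + i) * ((1 - X) ^ (N + i))⁻¹

/-- The boundary value problem on `[0,1)` to which the Dirichlet problem of the complex
Monge–Ampère equation on `Y_I(N,m,n;K)` reduces (with `M = N + mn`). Derivatives at the left
end point are one-sided. -/
def SolvesReducedMongeAmpere (N m n : ℕ) (K : ℝ) (G : ℝ → ℝ) : Prop :=
  let M : ℕ := N + m * n
  let G' : ℝ → ℝ := derivWithin G (Ico 0 1)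
  let G'' : ℝ → ℝ := derivWithin G' (Ico 0 1)
  ContDiffOn ℝ 2 G (Ico 0 1) ∧
  (∀ X ∈ Ico (0 : ℝ) 1,
    (((M : ℝ) + 1) ^ M)⁻¹ * (X / K * G' X + ((m : ℝ) + n + N / K) * G X) ^ (m * n) *
      (G X * G' X + (G X * G'' X - G' X ^ 2) * X) * (G' X ^ (N - 1) / G X ^ (M + 1)) = G X) ∧
  G 0 = (K ^ (m * n))⁻¹ ∧
  Tendsto G (𝓝[<] 1) atTop

end CartanHartogs

end

/-! The kernel. A function in the Bergman space is first studied on the disc of points `(w e₁, 0)`.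
Since `Y_I` is stable under multiplying all coordinates but `W₁` by a common phase, integrating it
against a function of `W₁` sees only its restriction to this disc; rotating `W₁` then isolates the
Taylor coefficients of the restriction. So the kernel with pole `(w e₁, 0)` is the power series
whose coefficients are the inverse squared norms of the monomials `W₁ᵏ`. These norms are Beta
integrals over `W` followed by Hua's integral over `Z` (`lintegral_domainY`), and up to the constant
`K^{-mn} π^{-(mn+N)}` the coefficient is the polynomial `∏_{l<N} (k+1+l) · ∏_{i,j} (k+N+K(i+j+1))`
in `k`, with `i`, `j` counted from 0. Expanding it in rising factorials sums the series to `G`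
(`isReproAt_single`).

Möbius transformations of the matrix ball lift to `Y_I`, with `W` multiplied by the power `-1/K` of
`det (CZ+D)`. They preserve `X`, and with unitary maps of `W` they move every point to `(√X e₁, 0)`
(`exists_isAdapted_single`). The transformation law of the kernel then gives its diagonal values
everywhere (`IsBergmanKernel.diag_eq`).

The rigidity. Write `G = q(t)/t^{M+1}` with `t = 1 - X` and `q` a polynomial. The reduced equation,
up to a constant factor, becomes `A^{mn} s r^{N-1} = C q^{M+2}`. At a root of `q` of multiplicity
`μ+1` other than 0 and 1, the left side vanishes to order exactly `μ(M+1)` and the right side at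
least to order `(μ+1)(M+2)`, which is impossible; as 0 and 1 are not roots, `q` is constant
(`natDegree_eq_zero_of_mongeAmpere`). Then `∏ (y+K(i+j+1))` equals `∏_{l<mn} (y+1+l)`, and comparing
zeros gives `K = 1` and `m = 1` or `n = 1` (`eq_one_of_prod_eq`).

The Einstein condition leads to the same equation. The quotient of `det g` by the diagonal kernel is
invariant under automorphisms, hence a function of `X`; let `η(X)` be its logarithm. The condition
says that the complex Hessian of `η(X)` is `-(1+c) g`. At the origin, in a `Z` direction, this
forces `c = -1`; in the `W₁` direction it then reads `η' + X η'' = 0`, so `η` is constant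
(`detQuot_const_of_isEinsteinOn`), which is the reduced equation up to a constant.

Conversely, for `K = 1` and a single row or column the domain is the ball and `G` is a constant
times `(1-X)^{-(M+1)}`; the ball is homogeneous; and on a homogeneous domain the invariant quotient
is constant, so that the Ricci tensor is `-g` (`isEinsteinOn_of_isHomogeneousDomain`). -/

noncomputable section
namespace CartanHartogs

/-! ### Holomorphic functions of several variables -/

section SeveralVariables

variable {E F : Type*} [NormedAddCommGroup E] [NormedSpace ℂ E]
  [NormedAddCommGroup F] [NormedSpace ℂ F]

theorem hasDerivAt_slice {f : E → F} {x v : E} {z : ℂ} (h : DifferentiableAt ℂ f (x + z • v)) :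
    HasDerivAt (fun z : ℂ => f (x + z • v)) (fderiv ℂ f (x + z • v) v) z := by
  have h1 : HasDerivAt (fun z : ℂ => x + z • v) v z := by
    simpa using ((hasDerivAt_id z).smul_const v).const_add x
  exact h.hasFDerivAt.comp_hasDerivAt z h1

/-- Cauchy's estimate in one variable, applied in each direction `w` to the disc of radius `δ /
‖w‖`. -/
theorem norm_fderiv_le_of_closedBall {f : E → F} {y : E} {δ C : ℝ} (hδ : 0 < δ) (hC : 0 ≤ C)
    (hd : ∀ z ∈ Metric.closedBall y δ, DifferentiableAt ℂ f z)
    (hb : ∀ z ∈ Metric.closedBall y δ, ‖f z‖ ≤ C) : ‖fderiv ℂ f y‖ ≤ C / δ := by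
  refine ContinuousLinearMap.opNorm_le_bound _ (by positivity) fun w => ?_
  rcases eq_or_ne w 0 with rfl | hw
  · simp
  have hw' : 0 < ‖w‖ := norm_pos_iff.2 hw
  have hmem : ∀ z ∈ Metric.closedBall (0 : ℂ) (δ / ‖w‖), y + z • w ∈ Metric.closedBall y δ := by
    intro z hz
    rw [mem_closedBall_zero_iff] at hz
    rw [mem_closedBall_iff_norm, add_sub_cancel_left, norm_smul]
    exact (le_div_iff₀ hw').1 hz
  have hdiff : DifferentiableOn ℂ (fun z : ℂ => f (y + z • w))
      (Metric.closedBall (0 : ℂ) (δ / ‖w‖)) := fun z hz =>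
    (hasDerivAt_slice (hd _ (hmem z hz))).differentiableAt.differentiableWithinAt
  have hdc : DiffContOnCl ℂ (fun z : ℂ => f (y + z • w)) (Metric.ball (0 : ℂ) (δ / ‖w‖)) :=
    (hdiff.mono Metric.closure_ball_subset_closedBall).diffContOnCl
  have := Complex.norm_deriv_le_of_forall_mem_sphere_norm_le (div_pos hδ hw') hdc
    (fun z hz => hb _ (hmem z (Metric.sphere_subset_closedBall hz)))
  have h0 : DifferentiableAt ℂ f (y + (0 : ℂ) • w) := by
    simpa using hd y (Metric.mem_closedBall_self hδ.le)
  rw [(hasDerivAt_slice h0).deriv] at this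
  simp only [zero_smul, add_zero] at this
  calc _ ≤ _ := this
    _ = _ := by field_simp

variable [FiniteDimensional ℂ E] [FiniteDimensional ℂ F]

/-- Cauchy's formula on the complex line through `x` in direction `v` writes the directional
derivative as a circle integral of values of `f`; differentiating under the integral sign shows that
it is holomorphic again. -/
theorem differentiableAt_fderiv_apply {f : E → F} {U : Set E} (hU : IsOpen U)
    (hf : DifferentiableOn ℂ f U) {x₀ : E} (hx₀ : x₀ ∈ U) (v : E) :
    DifferentiableAt ℂ (fun x => fderiv ℂ f x v) x₀ := by
  have : CompleteSpace F := FiniteDimensional.complete ℂ F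
  have : ProperSpace E := FiniteDimensional.proper ℂ E
  obtain ⟨R, hR, hRU⟩ := Metric.nhds_basis_closedBall.mem_iff.1 (hU.mem_nhds hx₀)
  have hdU : ∀ z ∈ U, DifferentiableAt ℂ f z := fun z hz => hf.differentiableAt (hU.mem_nhds hz)
  obtain ⟨C, hC⟩ := (isCompact_closedBall x₀ R).exists_bound_of_continuousOn
    (hf.continuousOn.mono hRU)
  have hC0 : 0 ≤ C := (norm_nonneg _).trans (hC x₀ (Metric.mem_closedBall_self hR.le))
  -- The circles stay within `2R/3` of `x₀` for `x` in the ball of radius `R/3`, which leaves room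
  -- `R/3` for Cauchy's estimate on the derivative.
  set ρ : ℝ := R / (3 * (‖v‖ + 1)) with hρ
  have hv1 : 0 < ‖v‖ + 1 := by positivity
  have hρ0 : 0 < ρ := by positivity
  have hρv : ρ * ‖v‖ ≤ R / 3 := by
    rw [hρ, div_mul_eq_mul_div, div_le_div_iff₀ (by positivity) (by positivity)]
    nlinarith
  have hmem : ∀ x ∈ Metric.ball x₀ (R / 3), ∀ z ∈ Metric.closedBall (0 : ℂ) ρ,
      x + z • v ∈ Metric.closedBall x₀ (2 * R / 3) := by
    intro x hx z hz
    rw [mem_closedBall_zero_iff] at hz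
    rw [mem_ball_iff_norm] at hx
    rw [mem_closedBall_iff_norm]
    calc ‖x + z • v - x₀‖ = ‖(x - x₀) + z • v‖ := by congr 1; abel
      _ ≤ ‖x - x₀‖ + ‖z‖ * ‖v‖ := (norm_add_le _ _).trans (by rw [norm_smul])
      _ ≤ R / 3 + ρ * ‖v‖ := by gcongr
      _ ≤ 2 * R / 3 := by linarith
  have hsubU : Metric.closedBall x₀ (2 * R / 3) ⊆ U :=
    (Metric.closedBall_subset_closedBall (by linarith)).trans hRU
  have hbd : ∀ y ∈ Metric.closedBall x₀ (2 * R / 3), ‖fderiv ℂ f y‖ ≤ C / (R / 3) := by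
    intro y hy
    have hs : Metric.closedBall y (R / 3) ⊆ Metric.closedBall x₀ R := by
      refine Metric.closedBall_subset_closedBall' ?_
      rw [Metric.mem_closedBall] at hy
      linarith
    exact norm_fderiv_le_of_closedBall (by positivity) hC0 (fun z hz => hdU z (hRU (hs hz)))
      fun z hz => hC z (hs hz)
  have hrep : ∀ x ∈ Metric.ball x₀ (R / 3), fderiv ℂ f x v =
      (2 * Real.pi * Complex.I : ℂ)⁻¹ • ∫ θ in (0 : ℝ)..2 * Real.pi,
        (deriv (circleMap 0 ρ) θ * (1 / (circleMap 0 ρ θ) ^ 2)) • f (x + circleMap 0 ρ θ • v) := by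
    intro x hx
    have hdiff : DifferentiableOn ℂ (fun z : ℂ => f (x + z • v)) (Metric.closedBall (0 : ℂ) ρ) :=
      fun z hz => (hasDerivAt_slice
        (hdU _ (hsubU (hmem x hx z hz)))).differentiableAt.differentiableWithinAt
    have h := hdiff.deriv_eq_smul_circleIntegral hρ0
    have h0 : DifferentiableAt ℂ f (x + (0 : ℂ) • v) :=
      hdU _ (hsubU (hmem x hx 0 (Metric.mem_closedBall_self hρ0.le)))
    rw [(hasDerivAt_slice h0).deriv] at h
    simp only [zero_smul, add_zero, circleIntegral, sub_zero, smul_smul] at h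
    rw [h, smul_smul, inv_mul_cancel₀ Complex.two_pi_I_ne_zero, one_smul]
  set w : ℝ → ℂ := fun θ => deriv (circleMap 0 ρ) θ * (1 / (circleMap 0 ρ θ) ^ 2) with hw
  have hwc : Continuous w := by
    have h1 : Continuous (deriv (circleMap 0 ρ)) := by
      rw [funext (deriv_circleMap 0 ρ)]; fun_prop
    refine h1.mul (Continuous.div continuous_const (by fun_prop) fun θ => ?_)
    exact pow_ne_zero _ (circleMap_ne_center hρ0.ne')
  have hcm : ∀ θ, circleMap 0 ρ θ ∈ Metric.closedBall (0 : ℂ) ρ := fun θ =>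
    circleMap_mem_closedBall 0 hρ0.le θ
  have hcont : ∀ x ∈ Metric.ball x₀ (R / 3),
      Continuous fun θ => w θ • f (x + circleMap 0 ρ θ • v) := by
    intro x hx
    refine hwc.smul ?_
    refine hf.continuousOn.comp_continuous (by fun_prop) fun θ => hsubU (hmem x hx _ (hcm θ))
  have hball : Metric.ball x₀ (R / 3) ∈ 𝓝 x₀ := Metric.ball_mem_nhds _ (by positivity)
  have hmain := intervalIntegral.hasFDerivAt_integral_of_dominated_of_fderiv_le (𝕜 := ℂ)
    (μ := volume) (a := 0) (b := 2 * Real.pi)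
    (F := fun x θ => w θ • f (x + circleMap 0 ρ θ • v))
    (F' := fun x θ => w θ • fderiv ℂ f (x + circleMap 0 ρ θ • v)) (x₀ := x₀)
    (bound := fun θ => ‖w θ‖ * (C / (R / 3))) hball
    (by filter_upwards [hball] with x hx using (hcont x hx).aestronglyMeasurable)
    ((hcont x₀ (Metric.mem_ball_self (by positivity))).intervalIntegrable _ _)
    (by
      borelize E
      have : SecondCountableTopology (E →L[ℂ] F) := by
        have : ProperSpace (E →L[ℂ] F) := FiniteDimensional.proper ℂ _
        infer_instance
      borelize (E →L[ℂ] F)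
      have : Measurable fun θ => fderiv ℂ f (x₀ + circleMap 0 ρ θ • v) :=
        (measurable_fderiv ℂ f).comp (by
          have : Continuous fun θ => x₀ + circleMap 0 ρ θ • v := by fun_prop
          exact this.measurable)
      exact (hwc.aestronglyMeasurable).smul this.stronglyMeasurable.aestronglyMeasurable)
    (by
      refine Eventually.of_forall fun θ _ x hx => ?_
      rw [norm_smul]
      gcongr
      exact hbd _ (hmem x hx _ (hcm θ)))
    ((hwc.norm.mul continuous_const).intervalIntegrable _ _)
    (by
      refine Eventually.of_forall fun θ _ x hx => ?_
      have h := (hdU _ (hsubU (hmem x hx _ (hcm θ)))).hasFDerivAt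
      have h2 : HasFDerivAt (fun x => x + circleMap 0 ρ θ • v) (ContinuousLinearMap.id ℂ E) x :=
        (hasFDerivAt_id x).add_const _
      have h3 := h.comp x h2
      rw [ContinuousLinearMap.comp_id] at h3
      exact h3.const_smul (w θ))
  refine (hmain.differentiableAt.const_smul ((2 * Real.pi * Complex.I : ℂ)⁻¹)).congr_of_eventuallyEq ?_
  filter_upwards [hball] with x hx using hrep x hx

theorem contDiffOn_of_differentiableOn {f : E → F} {U : Set E} (hU : IsOpen U)
    (hf : DifferentiableOn ℂ f U) (n : ℕ) : ContDiffOn ℂ n f U := by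
  induction n generalizing f with
  | zero => exact contDiffOn_zero.2 hf.continuousOn
  | succ n ih =>
    push_cast
    refine contDiffOn_succ_of_fderiv_apply hf (by simp) fun v => ?_
    refine (ih (f := fun x => fderiv ℂ f x v) fun x hx =>
      (differentiableAt_fderiv_apply hU hf hx v).differentiableWithinAt).congr fun x hx => ?_
    rw [fderivWithin_of_isOpen hU hx]

end SeveralVariables

/-! ### The algebraic form of the Monge–Ampère equation -/

section Algebraic

open Polynomial

/-- A polynomial `q` that does not vanish at `0` and `1` and satisfies the polynomial form of the
reduced Monge–Ampère equation is constant. -/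
theorem natDegree_eq_zero_of_mongeAmpere {N d : ℕ} {κ lam C : ℂ} (hκ : κ ≠ 0)
    {q : ℂ[X]} (h0 : q.eval 0 ≠ 0) (h1 : q.eval 1 ≠ 0) {r A s : ℂ[X]}
    (hr : r = (((N + 1 + d : ℕ) : ℂ[X]) + 1) * q - X * derivative q)
    (hA : A = (1 - X) * r * Polynomial.C κ + Polynomial.C lam * X * q)
    (hs : s = (((N + 1 + d : ℕ) : ℂ[X]) + 1) * q ^ 2 + X ^ 2 * (1 - X) *
      (q * derivative (derivative q) - derivative q ^ 2) - X ^ 2 * q * derivative q)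
    (hode : A ^ d * s * r ^ N = Polynomial.C C * q ^ (N + 1 + d + 2)) : q.natDegree = 0 := by
  by_contra hdeg
  obtain ⟨t, ht⟩ := IsAlgClosed.exists_root q (fun h => hdeg (natDegree_eq_of_degree_eq_some h))
  have hq0 : q ≠ 0 := by rintro rfl; simp at h0
  have ht0 : t ≠ 0 := by rintro rfl; exact h0 ht
  have ht1 : t ≠ 1 := by rintro rfl; exact h1 ht
  obtain ⟨h, hqh, hnd⟩ := exists_eq_pow_rootMultiplicity_mul_and_not_dvd q hq0 t
  have hht : h.eval t ≠ 0 := fun hz => hnd (dvd_iff_isRoot.2 hz)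
  have hpos : 0 < q.rootMultiplicity t := (rootMultiplicity_pos hq0).2 ht
  obtain ⟨μ, hμ⟩ : ∃ μ, q.rootMultiplicity t = μ + 1 := Nat.exists_eq_succ_of_ne_zero hpos.ne'
  rw [hμ] at hqh
  set T : ℂ[X] := X - Polynomial.C t with hT
  have hTX : X = T + Polynomial.C t := by rw [hT]; ring
  have hdT : derivative T = 1 := by simp [hT]
  have hTe : T.eval t = 0 := by simp [hT]
  have hT0 : T ≠ 0 := X_sub_C_ne_zero t
  -- With `q = T^(μ+1) h`, this `g` is the cofactor of `T^μ` in `q'`; it does not vanish at `t`.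
  set g : ℂ[X] := (μ + 1) * h + T * derivative h with hg
  have hq' : derivative q = T ^ μ * g := by
    rw [hqh, derivative_mul, derivative_pow_succ, hdT, hg]
    simp only [map_natCast, map_add, map_one]
    ring
  have hdg : derivative g = (μ + 1) * derivative h + derivative h + T * derivative (derivative h) := by
    rw [hg]
    simp only [derivative_add, derivative_mul, hdT, derivative_natCast, derivative_one]
    ring
  -- This is `q²` times the derivative of `q'/q`, whose double pole at `t` has coefficient `-(μ+1)`;
  -- so the order of vanishing is exactly `2μ`.
  have hqq : q * derivative (derivative q) - derivative q ^ 2 =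
      T ^ (2 * μ) * (-((μ : ℂ[X]) + 1) * h ^ 2 + T ^ 2 * (h * derivative (derivative h) - derivative h ^ 2)) := by
    rw [hq', derivative_mul, hdg, hqh, hg]
    rcases μ with _ | k
    · simp; ring
    · rw [derivative_pow_succ, hdT]
      simp only [map_natCast, map_add, map_one]
      push_cast
      ring
  have hr' : r = T ^ μ * ((((N + 1 + d : ℕ) : ℂ[X]) + 1) * T * h - X * g) := by
    rw [hr, hq', hqh]; ring
  set r' : ℂ[X] := (((N + 1 + d : ℕ) : ℂ[X]) + 1) * T * h - X * g with hr'd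
  have hA' : A = T ^ μ * ((1 - X) * r' * Polynomial.C κ + Polynomial.C lam * X * (T * h)) := by
    rw [hA, hr', hqh]; ring
  have hs' : s = T ^ (2 * μ) * ((((N + 1 + d : ℕ) : ℂ[X]) + 1) * (T * h) ^ 2 + X ^ 2 * (1 - X) *
      (-((μ : ℂ[X]) + 1) * h ^ 2 + T ^ 2 * (h * derivative (derivative h) - derivative h ^ 2))
      - X ^ 2 * (T * h) * g) := by
    rw [hs, hqq, hq', hqh]; ring
  rw [hA', hs', hr', hqh] at hode
  set A' := (1 - X) * r' * Polynomial.C κ + Polynomial.C lam * X * (T * h) with hA'd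
  set s' := (((N + 1 + d : ℕ) : ℂ[X]) + 1) * (T * h) ^ 2 + X ^ 2 * (1 - X) *
      (-((μ : ℂ[X]) + 1) * h ^ 2 + T ^ 2 * (h * derivative (derivative h) - derivative h ^ 2))
      - X ^ 2 * (T * h) * g with hs'd
  -- Orders at `t`: the left side contributes `μd + 2μ + μN`, the right side at least
  -- `(μ+1)(N+d+3)`, which is larger. After cancellation a factor `T` is left on the right only.
  have key : T ^ (μ * (N + d + 2)) * (A' ^ d * s' * r' ^ N) = T ^ (μ * (N + d + 2)) *
      (T * (Polynomial.C C * T ^ (μ + N + d + 2) * h ^ (N + 1 + d + 2))) := by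
    calc _ = (T ^ μ * A') ^ d * (T ^ (2 * μ) * s') * (T ^ μ * r') ^ N := by ring_nf
      _ = _ := hode
      _ = _ := by ring_nf
  have key2 := mul_left_cancel₀ (pow_ne_zero _ hT0) key
  have hge : g.eval t = (μ + 1) * h.eval t := by simp [hg, hTe]
  have hre : r'.eval t ≠ 0 := by
    have : r'.eval t = -(t * ((μ + 1) * h.eval t)) := by simp [hr'd, hTe, hge]
    rw [this]
    have : (μ + 1 : ℂ) ≠ 0 := Nat.cast_add_one_ne_zero μ
    exact neg_ne_zero.2 (mul_ne_zero ht0 (mul_ne_zero this hht))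
  have h1t : 1 - t ≠ 0 := sub_ne_zero.2 ht1.symm
  have hAe : A'.eval t ≠ 0 := by
    have : A'.eval t = (1 - t) * r'.eval t * κ := by simp [hA'd, hTe]
    rw [this]
    exact mul_ne_zero (mul_ne_zero h1t hre) hκ
  have hse : s'.eval t ≠ 0 := by
    have : s'.eval t = t ^ 2 * (1 - t) * (-(μ + 1) * h.eval t ^ 2) := by
      simp [hs'd, hTe]
    rw [this]
    have : -(μ + 1 : ℂ) ≠ 0 := neg_ne_zero.2 (Nat.cast_add_one_ne_zero μ)
    exact mul_ne_zero (mul_ne_zero (pow_ne_zero _ ht0) h1t) (mul_ne_zero this (pow_ne_zero _ hht))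
  have := congrArg (Polynomial.eval t) key2
  simp only [eval_mul, eval_pow, hTe, zero_mul] at this
  exact mul_ne_zero (mul_ne_zero (pow_ne_zero _ hAe) hse) (pow_ne_zero _ hre) this

/-- Comparison of `∏ (y + K (i + j - 1))` and `∏ (y + l)`. -/
theorem eq_one_of_prod_eq {m n : ℕ} (hm : 1 ≤ m) (hn : 1 ≤ n) {K : ℝ}
    (h : ∀ y : ℝ, ∏ i : Fin m, ∏ j : Fin n, (y + K * (i + j + 1)) =
      ∏ l ∈ Finset.range (m * n), (y + 1 + l)) : K = 1 ∧ (m = 1 ∨ n = 1) := by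
  have hmn : 0 < m * n := Nat.mul_pos hm hn
  -- The zero `-1` of the right side gives `K (i+j+1) = 1`, so `K ≤ 1`; the zero `-K` of the left
  -- side gives `K = 1 + l ≥ 1`.
  have h1 := h (-1)
  rw [Finset.prod_eq_zero (Finset.mem_range.2 hmn) (by simp)] at h1
  have h2 := h (-K)
  rw [Finset.prod_eq_zero (Finset.mem_univ ⟨0, hm⟩)
    (Finset.prod_eq_zero (Finset.mem_univ ⟨0, hn⟩) (by simp))] at h2
  obtain ⟨i, -, hi⟩ := Finset.prod_eq_zero_iff.1 h1
  obtain ⟨j, -, hj⟩ := Finset.prod_eq_zero_iff.1 hi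
  obtain ⟨l, -, hl⟩ := Finset.prod_eq_zero_iff.1 h2.symm
  have hK1 : (1 : ℝ) ≤ K := by
    have : (0 : ℝ) ≤ l := Nat.cast_nonneg l
    linarith
  have hK : K = 1 := by
    have hi0 : (0 : ℝ) ≤ (i : ℕ) := Nat.cast_nonneg _
    have hj0 : (0 : ℝ) ≤ (j : ℕ) := Nat.cast_nonneg _
    nlinarith
  refine ⟨hK, ?_⟩
  subst hK
  -- The last zero of the right side forces `i + j + 1 = mn` with `i < m` and `j < n`, so `mn ≤ m +
  -- n - 1`, that is `(m-1)(n-1) ≤ 0`.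
  have h3 := h (-(m * n : ℕ))
  rw [Finset.prod_eq_zero (Finset.mem_range.2 (Nat.sub_one_lt hmn.ne'))
    (by rw [Nat.cast_sub hmn]; push_cast; ring)] at h3
  obtain ⟨i, -, hi⟩ := Finset.prod_eq_zero_iff.1 h3
  obtain ⟨j, -, hj⟩ := Finset.prod_eq_zero_iff.1 hi
  have hij : (i : ℕ) + j + 1 = m * n := by
    have : ((i : ℕ) : ℝ) + (j : ℕ) + 1 = ((m * n : ℕ) : ℝ) := by linarith
    exact_mod_cast this
  by_contra hcon
  push Not at hcon
  obtain ⟨hm1, hn1⟩ := hcon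
  have hm2 : 2 ≤ m := by omega
  have hn2 : 2 ≤ n := by omega
  have := i.2
  have := j.2
  nlinarith

/-- Expansion of a product of linear factors in shifted rising factorials. -/
theorem exists_risingFactorial_expansion {ι : Type*} (s : Finset ι) (c : ι → ℝ) (a : ℝ) :
    ∃ β : ℕ → ℝ, β s.card = 1 ∧ ∀ x : ℝ, ∏ i ∈ s, (x + c i) =
      ∑ k ∈ Finset.range (s.card + 1), β k * ∏ l ∈ Finset.range k, (x + a + l) := by
  classical
  induction s using Finset.induction_on with
  | empty => exact ⟨fun _ => 1, rfl, fun x => by simp⟩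
  | insert i s hi ih =>
    obtain ⟨β, hβ, h⟩ := ih
    -- From `x + c = (x + a + k) + (c - a - k)`: the first summand raises the degree of the `k`-th
    -- rising factorial, the second keeps it. The case `k = s.card + 1` is excluded because `β` is
    -- unconstrained there.
    refine ⟨fun k => (if k = 0 then 0 else β (k - 1)) +
      (if k = s.card + 1 then 0 else β k * (c i - a - k)), ?_, fun x => ?_⟩
    · simp [hi, hβ]
    rw [Finset.prod_insert hi, h, Finset.card_insert_of_notMem hi]
    simp only [add_mul, Finset.sum_add_distrib]
    rw [Finset.sum_range_succ' (fun k => (if k = 0 then 0 else β (k - 1)) *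
      ∏ l ∈ Finset.range k, (x + a + l)),
      Finset.sum_range_succ (fun k => (if k = s.card + 1 then 0 else β k * (c i - a - k)) *
      ∏ l ∈ Finset.range k, (x + a + l))]
    simp only [if_true, zero_mul, add_zero, Nat.add_eq_zero_iff, one_ne_zero, and_false, if_false,
      Nat.add_sub_cancel]
    rw [← Finset.sum_add_distrib, ← add_mul, Finset.mul_sum]
    refine Finset.sum_congr rfl fun k hk => ?_
    rw [if_neg (Finset.mem_range.1 hk).ne, Finset.prod_range_succ]
    ring

end Algebraic

/-! ### The function `G` -/

section KernelFunction

/-- The product `∏ (x + N + K (i + j - 1))` over the entries of an `m × n` matrix. -/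
def huaProd (N m n : ℕ) (K : ℝ) (x : ℝ) : ℝ :=
  ∏ p : Fin m × Fin n, (x + (N + K * ((p.1 : ℕ) + (p.2 : ℕ) + 1)))

theorem exists_huaCoeff (N m n : ℕ) (K : ℝ) : ∃ β : ℕ → ℝ, β (m * n) = 1 ∧
    ∀ x : ℝ, huaProd N m n K x =
      ∑ k ∈ Finset.range (m * n + 1), β k * ∏ l ∈ Finset.range k, (x + (N + 1) + l) := by
  obtain ⟨β, h1, h2⟩ := exists_risingFactorial_expansion (Finset.univ : Finset (Fin m × Fin n))
    (fun p => (N + K * ((p.1 : ℕ) + (p.2 : ℕ) + 1))) ((N : ℝ) + 1)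
  simp only [Finset.card_univ, Fintype.card_prod, Fintype.card_fin] at h1 h2
  exact ⟨β, h1, h2⟩

/-- Coefficients of `huaProd` in shifted rising factorials. -/
def huaCoeff (N m n : ℕ) (K : ℝ) : ℕ → ℝ := (exists_huaCoeff N m n K).choose

theorem huaCoeff_last (N m n : ℕ) (K : ℝ) : huaCoeff N m n K (m * n) = 1 :=
  (exists_huaCoeff N m n K).choose_spec.1

theorem huaProd_eq_sum (N m n : ℕ) (K : ℝ) (x : ℝ) : huaProd N m n K x =
    ∑ k ∈ Finset.range (m * n + 1), huaCoeff N m n K k *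
      ∏ l ∈ Finset.range k, (x + (N + 1) + l) :=
  (exists_huaCoeff N m n K).choose_spec.2 x

/-- The constants `b_i`. -/
def bCoeff (N m n : ℕ) (K : ℝ) (i : ℕ) : ℝ := if i = 0 then 0 else huaCoeff N m n K (i - 1)

/-- The Taylor coefficients of `G`. -/
def taylorCoeff (N m n : ℕ) (K : ℝ) (k : ℕ) : ℝ :=
  (∏ l ∈ Finset.range N, ((k : ℝ) + 1 + l)) * huaProd N m n K k

theorem huaProd_pos (N m n : ℕ) {K : ℝ} (hK : 0 < K) (k : ℕ) : 0 < huaProd N m n K k :=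
  Finset.prod_pos fun p _ => by positivity

theorem taylorCoeff_pos (N m n : ℕ) {K : ℝ} (hK : 0 < K) (k : ℕ) : 0 < taylorCoeff N m n K k :=
  mul_pos (Finset.prod_pos fun l _ => by positivity) (huaProd_pos N m n hK k)

/-- The expansion of `huaProd` uses rising factorials starting at `k + N + 1`, so that the factors
`k+1, …, k+N` complete them to rising factorials starting at `k + 1`. -/
theorem taylorCoeff_eq (N m n : ℕ) (K : ℝ) (k : ℕ) : taylorCoeff N m n K k =
    ∑ i ∈ Finset.range (m * n + 1), huaCoeff N m n K i *
      ∏ l ∈ Finset.range (N + i), ((k : ℝ) + 1 + l) := by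
  rw [taylorCoeff, huaProd_eq_sum, Finset.mul_sum]
  refine Finset.sum_congr rfl fun i _ => ?_
  rw [Finset.prod_range_add, mul_left_comm]
  congr 2
  refine Finset.prod_congr rfl fun l _ => ?_
  push_cast
  ring

/-- The function `G` of a complex variable. -/
def complexG (N m n : ℕ) (K : ℝ) (z : ℂ) : ℂ :=
  ∑ i ∈ Finset.range (m * n + 1), (huaCoeff N m n K i : ℂ) * ((N + i).factorial : ℂ) *
    ((1 - z) ^ (N + i + 1))⁻¹

/-- The term with index 0 is absent because every rising factorial in the Taylor coefficient has
length at least `N`, which sums to a pole of order at least `N + 1`. -/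
theorem bergmanG_eq (N m n : ℕ) (K : ℝ) (X : ℝ) : bergmanG N m n (bCoeff N m n K) X =
    ∑ i ∈ Finset.range (m * n + 1), huaCoeff N m n K i * ((N + i).factorial : ℝ) *
      ((1 - X) ^ (N + i + 1))⁻¹ := by
  rw [bergmanG, Finset.sum_range_succ']
  simp only [bCoeff, if_true, zero_mul, add_zero, Nat.add_eq_zero_iff, one_ne_zero, and_false,
    if_false, Nat.add_sub_cancel]
  refine Finset.sum_congr rfl fun i _ => ?_
  rw [← Real.Gamma_nat_eq_factorial]
  push_cast
  congr 3
  ring_nf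

theorem ofReal_bergmanG (N m n : ℕ) (K : ℝ) (X : ℝ) :
    ((bergmanG N m n (bCoeff N m n K) X : ℝ) : ℂ) = complexG N m n K X := by
  rw [bergmanG_eq, complexG]
  push_cast
  rfl

theorem prod_range_add_one_eq (k p : ℕ) :
    ∏ l ∈ Finset.range p, ((k : ℝ) + 1 + l) = p.factorial * (k + p).choose p := by
  have h1 : (∏ l ∈ Finset.range p, ((k : ℝ) + 1 + l)) = ((k + 1).ascFactorial p : ℕ) := by
    rw [Nat.ascFactorial_eq_prod_range]
    push_cast
    rfl
  rw [h1, ← Nat.cast_mul, Nat.ascFactorial_eq_factorial_mul_choose]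

/-- The negative binomial series, multiplied by `p!`. -/
theorem hasSum_risingFactorial (p : ℕ) {z : ℂ} (hz : ‖z‖ < 1) :
    HasSum (fun k : ℕ => ((∏ l ∈ Finset.range p, ((k : ℝ) + 1 + l) : ℝ) : ℂ) * z ^ k)
      ((p.factorial : ℂ) * ((1 - z) ^ (p + 1))⁻¹) := by
  have h := (hasSum_choose_mul_geometric_of_norm_lt_one p hz).mul_left (p.factorial : ℂ)
  rw [one_div] at h
  convert! h using 2 with k
  rw [prod_range_add_one_eq]
  push_cast
  ring

theorem hasSum_complexG (N m n : ℕ) (K : ℝ) {z : ℂ} (hz : ‖z‖ < 1) :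
    HasSum (fun k : ℕ => (taylorCoeff N m n K k : ℂ) * z ^ k) (complexG N m n K z) := by
  have h := hasSum_sum (s := Finset.range (m * n + 1)) fun i _ =>
    (hasSum_risingFactorial (N + i) hz).mul_left (huaCoeff N m n K i : ℂ)
  convert! h using 2 with k
  · rw [taylorCoeff_eq, Complex.ofReal_sum, Finset.sum_mul]
    refine Finset.sum_congr rfl fun i _ => ?_
    push_cast
    ring
  · exact Finset.sum_congr rfl fun i _ => by ring

theorem hasSum_bergmanG (N m n : ℕ) (K : ℝ) {X : ℝ} (h0 : 0 ≤ X) (h1 : X < 1) :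
    HasSum (fun k : ℕ => taylorCoeff N m n K k * X ^ k) (bergmanG N m n (bCoeff N m n K) X) := by
  have h := hasSum_complexG N m n K (z := (X : ℂ)) (by
    rw [Complex.norm_real, Real.norm_of_nonneg h0]; exact h1)
  rw [← ofReal_bergmanG] at h
  exact_mod_cast h

theorem bergmanG_pos (N m n : ℕ) {K : ℝ} (hK : 0 < K) {X : ℝ} (h0 : 0 ≤ X) (h1 : X < 1) :
    0 < bergmanG N m n (bCoeff N m n K) X := by
  have h := hasSum_bergmanG N m n K h0 h1
  have := le_hasSum h 0 fun k _ => mul_nonneg (taylorCoeff_pos N m n hK k).le (pow_nonneg h0 k)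
  refine lt_of_lt_of_le (taylorCoeff_pos N m n hK 0) ?_
  simpa using this

open Polynomial

/-- The numerator of `G` as a polynomial in `t = 1 - X`. -/
def numG (N m n : ℕ) (K : ℝ) : ℝ[X] :=
  ∑ i ∈ Finset.range (m * n + 1), Polynomial.C (huaCoeff N m n K i * ((N + i).factorial : ℝ)) *
    X ^ (m * n - i)

theorem bergmanG_eq_numG (N m n : ℕ) (K : ℝ) {x : ℝ} (hx : x ≠ 1) :
    bergmanG N m n (bCoeff N m n K) x =
      (numG N m n K).eval (1 - x) / (1 - x) ^ (N + m * n + 1) := by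
  have ht : 1 - x ≠ 0 := sub_ne_zero.2 hx.symm
  rw [bergmanG_eq, numG, eval_finsetSum, Finset.sum_div]
  refine Finset.sum_congr rfl fun i hi => ?_
  have hi' : i ≤ m * n := Nat.lt_succ_iff.1 (Finset.mem_range.1 hi)
  simp only [eval_mul, eval_C, eval_pow, eval_X]
  rw [mul_div_assoc, inv_eq_one_div]
  congr 1
  rw [div_eq_div_iff (pow_ne_zero _ ht) (pow_ne_zero _ ht), one_mul, ← pow_add]
  congr 1
  omega

/-- The coefficient of top index is 1, so 0 is not a root of the numerator; the other excluded point
`t = 1` is handled by `G(0) > 0`. -/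
theorem numG_eval_zero (N m n : ℕ) (K : ℝ) :
    (numG N m n K).eval 0 = ((N + m * n).factorial : ℝ) := by
  rw [numG, eval_finsetSum, Finset.sum_eq_single (m * n)]
  · simp [huaCoeff_last]
  · intro i hi hne
    have : m * n - i ≠ 0 := by
      have := Finset.mem_range.1 hi
      omega
    simp [this]
  · simp

/-- Once the numerator is known to be constant, this kills every `huaCoeff` but the last. -/
theorem numG_coeff (N m n : ℕ) (K : ℝ) {i : ℕ} (hi : i ≤ m * n) :
    (numG N m n K).coeff (m * n - i) = huaCoeff N m n K i * ((N + i).factorial : ℝ) := by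
  rw [numG, finsetSum_coeff, Finset.sum_eq_single i]
  · rw [coeff_C_mul, coeff_X_pow, if_pos rfl, mul_one]
  · intro j hj hne
    have hj' := Finset.mem_range.1 hj
    rw [coeff_C_mul, coeff_X_pow, if_neg (by omega), mul_zero]
  · intro h
    exact absurd (Finset.mem_range.2 (by omega)) h

theorem hasDerivAt_eval_one_sub_div (p : ℝ[X]) (k : ℕ) {x : ℝ} (hx : x ≠ 1) :
    HasDerivAt (fun x : ℝ => p.eval (1 - x) / (1 - x) ^ k)
      (((k : ℝ[X]) * p - X * derivative p).eval (1 - x) / (1 - x) ^ (k + 1)) x := by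
  have ht : 1 - x ≠ 0 := sub_ne_zero.2 hx.symm
  have h1 : HasDerivAt (fun x : ℝ => 1 - x) (-1) x := by
    simpa using (hasDerivAt_id x).const_sub 1
  have h2 := ((p.hasDerivAt (1 - x)).comp x h1).div (h1.pow k) (pow_ne_zero k ht)
  convert! h2 using 1
  simp only [eval_sub, eval_mul, eval_natCast, eval_X, Function.comp_apply, Pi.pow_apply]
  rcases k with _ | k
  · simp
    field_simp
  · rw [Nat.add_sub_cancel]
    field_simp
    ring

/-- The numerator of `G'`. -/
def numG' (N m n : ℕ) (K : ℝ) : ℝ[X] :=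
  ((N + m * n + 1 : ℕ) : ℝ[X]) * numG N m n K - X * derivative (numG N m n K)

/-- The numerator of `G''`. -/
def numG'' (N m n : ℕ) (K : ℝ) : ℝ[X] :=
  ((N + m * n + 2 : ℕ) : ℝ[X]) * numG' N m n K - X * derivative (numG' N m n K)

theorem hasDerivAt_bergmanG (N m n : ℕ) (K : ℝ) {x : ℝ} (hx : x ≠ 1) :
    HasDerivAt (bergmanG N m n (bCoeff N m n K))
      ((numG' N m n K).eval (1 - x) / (1 - x) ^ (N + m * n + 2)) x := by
  refine (hasDerivAt_eval_one_sub_div (numG N m n K) (N + m * n + 1) hx).congr_of_eventuallyEq ?_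
  filter_upwards [isOpen_ne.mem_nhds hx] with y hy using bergmanG_eq_numG N m n K hy

theorem hasDerivAt_deriv_bergmanG (N m n : ℕ) (K : ℝ) {x : ℝ} (hx : x ≠ 1) :
    HasDerivAt (deriv (bergmanG N m n (bCoeff N m n K)))
      ((numG'' N m n K).eval (1 - x) / (1 - x) ^ (N + m * n + 3)) x := by
  refine (hasDerivAt_eval_one_sub_div (numG' N m n K) (N + m * n + 2) hx).congr_of_eventuallyEq ?_
  filter_upwards [isOpen_ne.mem_nhds hx] with y hy using (hasDerivAt_bergmanG N m n K hy).deriv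

theorem contDiffOn_bergmanG (N m n : ℕ) (b : ℕ → ℝ) (k : WithTop ℕ∞) :
    ContDiffOn ℝ k (bergmanG N m n b) (Iio 1) := by
  unfold bergmanG
  refine ContDiffOn.sum fun i _ => ContDiffOn.mul contDiffOn_const (ContDiffOn.inv ?_ ?_)
  · exact ((contDiff_const.sub contDiff_id).pow _).contDiffOn
  · exact fun x hx => pow_ne_zero _ (sub_pos.2 hx).ne'

/-- The derivative at 0 is the Taylor coefficient of index 1. -/
theorem deriv_bergmanG_zero_pos (N m n : ℕ) {K : ℝ} (hK : 0 < K) :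
    0 < deriv (bergmanG N m n (bCoeff N m n K)) 0 := by
  have h1 : HasDerivAt (bergmanG N m n (bCoeff N m n K))
      (∑ i ∈ Finset.range (m * n + 1), huaCoeff N m n K i * ((N + i).factorial : ℝ) *
        ((N + i + 1 : ℕ) : ℝ)) 0 := by
    have : bergmanG N m n (bCoeff N m n K) = fun x => ∑ i ∈ Finset.range (m * n + 1),
      huaCoeff N m n K i * ((N + i).factorial : ℝ) * ((1 - x) ^ (N + i + 1))⁻¹ :=
      funext (bergmanG_eq N m n K)
    rw [this]
    refine HasDerivAt.fun_sum fun i _ => HasDerivAt.const_mul _ ?_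
    have h := hasDerivAt_eval_one_sub_div (1 : ℝ[X]) (N + i + 1) (x := 0) (by norm_num)
    simpa using h
  rw [h1.deriv]
  have h2 := taylorCoeff_eq N m n K 1
  have h3 := taylorCoeff_pos N m n hK 1
  rw [h2] at h3
  refine h3.trans_eq (Finset.sum_congr rfl fun i _ => ?_)
  rw [prod_range_add_one_eq, mul_assoc]
  congr 2
  rw [add_comm 1, Nat.choose_symm_add, Nat.choose_one_right]

/-- The numerator of `G G' + (G G'' - G'²) X`. -/
theorem numG_combination (N m n : ℕ) (K : ℝ) {x : ℝ} (hx : x ≠ 1) :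
    let G := bergmanG N m n (bCoeff N m n K)
    let q := numG N m n K
    G x * deriv G x + (G x * deriv (deriv G) x - deriv G x ^ 2) * x =
      ((((N + m * n : ℕ) : ℝ[X]) + 1) * q ^ 2 + X ^ 2 * (1 - X) *
        (q * derivative (derivative q) - derivative q ^ 2) - X ^ 2 * q * derivative q).eval (1 - x) /
      (1 - x) ^ (2 * (N + m * n) + 4) := by
  intro G q
  have ht : 1 - x ≠ 0 := sub_ne_zero.2 hx.symm
  rw [(hasDerivAt_bergmanG N m n K hx).deriv, (hasDerivAt_deriv_bergmanG N m n K hx).deriv,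
    show G x = _ from bergmanG_eq_numG N m n K hx]
  set t := 1 - x with htd
  have hxt : x = 1 - t := by rw [htd]; ring
  rw [hxt, numG'', numG']
  simp only [derivative_sub, derivative_mul, derivative_natCast, derivative_X, eval_sub, eval_mul,
    eval_natCast, eval_X, eval_add, eval_pow, eval_one, zero_mul, one_mul, eval_zero]
  push_cast
  rw [eq_div_iff (pow_ne_zero _ ht)]
  simp only [pow_add, pow_mul, mul_comm 2 (N + m * n)]
  have hp : t ^ (m * n) ≠ 0 := pow_ne_zero _ ht
  have hp' : t ^ N ≠ 0 := pow_ne_zero _ ht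
  rw [show (t ^ m) ^ n = t ^ (m * n) from (pow_mul _ _ _).symm]
  field_simp
  ring

end KernelFunction

/-! ### The reduced Monge–Ampère equation -/

section ReducedEquation

open Polynomial

/-- If `G` satisfies the reduced Monge–Ampère equation up to a constant then `K = 1` and one of
`m`, `n` is `1`. -/
theorem eq_one_of_reducedMongeAmpere {N m n : ℕ} (hN : 1 ≤ N) (hm : 1 ≤ m) (hn : 1 ≤ n) {K : ℝ}
    (hK : 0 < K) {C : ℝ} (h : ∀ x ∈ Ioo (0 : ℝ) 1,
      let G := bergmanG N m n (bCoeff N m n K)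
      (x / K * deriv G x + (m + n + N / K) * G x) ^ (m * n) *
        (G x * deriv G x + (G x * deriv (deriv G) x - deriv G x ^ 2) * x) * deriv G x ^ (N - 1) =
      C * G x ^ (N + m * n + 2)) : K = 1 ∧ (m = 1 ∨ n = 1) := by
  obtain ⟨N, rfl⟩ : ∃ k, N = k + 1 := ⟨N - 1, by omega⟩
  rw [Nat.add_sub_cancel] at h
  set d := m * n with hd
  set q := numG (N + 1) m n K with hq
  set r : ℝ[X] := (((N + 1 + d : ℕ) : ℝ[X]) + 1) * q - X * derivative q with hr
  have hr' : numG' (N + 1) m n K = r := by rw [numG', hr, ← hd, ← hq]; push_cast; ring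
  set lam : ℝ := m + n + ((N + 1 : ℕ) : ℝ) / K with hlam
  set A : ℝ[X] := (1 - X) * r * Polynomial.C K⁻¹ + Polynomial.C lam * X * q with hA
  set s : ℝ[X] := (((N + 1 + d : ℕ) : ℝ[X]) + 1) * q ^ 2 + X ^ 2 * (1 - X) *
        (q * derivative (derivative q) - derivative q ^ 2) - X ^ 2 * q * derivative q with hs
  -- The differential equation gives this identity at all `t = 1 - x` in `(0, 1)`, which is enough
  -- points for polynomials.
  have hpoly : A ^ d * s * r ^ N = Polynomial.C C * q ^ (N + 1 + d + 2) := by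
    refine Polynomial.eq_of_infinite_eval_eq _ _ ((Ioo_infinite zero_lt_one).mono fun t ht => ?_)
    have ht0 : t ≠ 0 := ht.1.ne'
    have hx1 : 1 - t ≠ 1 := fun h => ht0 (by linarith)
    have hode := h (1 - t) ⟨by linarith [ht.2], by linarith [ht.1]⟩
    simp only at hode
    rw [numG_combination _ _ _ _ hx1, (hasDerivAt_bergmanG _ _ _ _ hx1).deriv,
      bergmanG_eq_numG _ _ _ _ hx1, hr', ← hd, ← hq, ← hs, sub_sub_cancel] at hode
    have hAe : (1 - t) / K * (r.eval t / t ^ (N + 1 + d + 2)) +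
        lam * (q.eval t / t ^ (N + 1 + d + 1)) = A.eval t / t ^ (N + 1 + d + 2) := by
      rw [hA]
      simp only [eval_add, eval_mul, eval_sub, eval_one, eval_X, eval_C]
      field_simp
      ring
    rw [hAe] at hode
    -- With `M = N + 1 + d` this exponent is `(M+1)(M+2)`, the order of the pole of `G^(M+2)`; both
    -- sides have the same denominator, and no power of `t` survives.
    have hp : t ^ ((N + 1 + d + 2) * d + (2 * (N + 1 + d) + 4) + (N + 1 + d + 2) * N) ≠ 0 :=
      pow_ne_zero _ ht0
    show (A ^ d * s * r ^ N).eval t = (Polynomial.C C * q ^ (N + 1 + d + 2)).eval t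
    simp only [eval_mul, eval_pow, eval_C]
    have h2 := congrArg
      (· * t ^ ((N + 1 + d + 2) * d + (2 * (N + 1 + d) + 4) + (N + 1 + d + 2) * N)) hode
    simp only [div_pow, ← pow_mul] at h2
    rw [show C * (eval t q ^ (N + 1 + d + 2) / t ^ ((N + 1 + d + 1) * (N + 1 + d + 2))) *
        t ^ ((N + 1 + d + 2) * d + (2 * (N + 1 + d) + 4) + (N + 1 + d + 2) * N) =
        C * eval t q ^ (N + 1 + d + 2) by
      rw [show (N + 1 + d + 2) * d + (2 * (N + 1 + d) + 4) + (N + 1 + d + 2) * N =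
        (N + 1 + d + 1) * (N + 1 + d + 2) by ring, mul_assoc,
        div_mul_cancel₀ _ (pow_ne_zero _ ht0)]] at h2
    rw [← h2, pow_add _ _ ((N + 1 + d + 2) * N), pow_add _ ((N + 1 + d + 2) * d)]
    field_simp
  -- The argument needs a root of the numerator, so the identity is moved to `ℂ`.
  have hmap := congrArg (Polynomial.map Complex.ofRealHom) hpoly
  simp only [Polynomial.map_mul, Polynomial.map_pow, map_C] at hmap
  have hev : ∀ x : ℝ, (q.map Complex.ofRealHom).eval (x : ℂ) = ((q.eval x : ℝ) : ℂ) := fun x =>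
    Polynomial.eval_map_apply Complex.ofRealHom x
  have hq0 : q.eval 0 ≠ 0 := by
    rw [hq, numG_eval_zero]; positivity
  have hq1 : q.eval 1 ≠ 0 := by
    have := bergmanG_eq_numG (N + 1) m n K (x := 0) (by norm_num)
    rw [sub_zero, one_pow, div_one] at this
    rw [hq, ← this]
    exact (bergmanG_pos _ _ _ hK le_rfl zero_lt_one).ne'
  have hdeg := natDegree_eq_zero_of_mongeAmpere (N := N) (d := d) (κ := ((K⁻¹ : ℝ) : ℂ))
    (lam := (lam : ℂ)) (C := (C : ℂ)) (q := q.map Complex.ofRealHom)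
    (r := r.map Complex.ofRealHom) (A := A.map Complex.ofRealHom) (s := s.map Complex.ofRealHom)
    (by exact_mod_cast inv_ne_zero hK.ne')
    (by rw [← Complex.ofReal_zero, hev]; exact_mod_cast hq0)
    (by rw [← Complex.ofReal_one, hev]; exact_mod_cast hq1)
    (by rw [hr]; simp [derivative_map]) (by rw [hA]; simp)
    (by rw [hs]; simp [derivative_map]) hmap
  rw [natDegree_map] at hdeg
  have hβ : ∀ i < d, huaCoeff (N + 1) m n K i = 0 := by
    intro i hi
    have h1 := numG_coeff (N + 1) m n K hi.le
    rw [← hq, coeff_eq_zero_of_natDegree_lt (by omega)] at h1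
    have h2 : (((N + 1 + i).factorial : ℕ) : ℝ) ≠ 0 := by positivity
    exact (mul_eq_zero.1 h1.symm).resolve_right h2
  refine eq_one_of_prod_eq hm hn fun y => ?_
  -- The shift by `N + 1` removes the dependence on `N` from both products.
  have h1 := huaProd_eq_sum (N + 1) m n K (y - ((N + 1 : ℕ) : ℝ))
  rw [Finset.sum_range_succ, Finset.sum_eq_zero fun i hi => by
    rw [hβ i (Finset.mem_range.1 hi), zero_mul], zero_add, huaCoeff_last, one_mul, huaProd,
    Fintype.prod_prod_type] at h1
  refine Eq.trans ?_ (h1.trans ?_)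
  · exact Finset.prod_congr rfl fun i _ => Finset.prod_congr rfl fun j _ => by ring
  · exact Finset.prod_congr rfl fun i _ => by ring

theorem huaProd_of_ball {N m n : ℕ} (h : m = 1 ∨ n = 1) (x : ℝ) :
    huaProd N m n 1 x = ∏ l ∈ Finset.range (m * n), (x + N + 1 + l) := by
  rw [huaProd, Fintype.prod_prod_type]
  rcases h with rfl | rfl
  · rw [one_mul, Finset.prod_range]
    simp only [Finset.univ_unique, Finset.prod_singleton]
    refine Finset.prod_congr rfl fun j _ => ?_
    simp
    ring
  · rw [mul_one, Finset.prod_range]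
    refine Finset.prod_congr rfl fun j _ => ?_
    simp
    ring

/-- For a single row or column and `K = 1` the two factors of the Taylor coefficient join into one
rising factorial of length `N + mn`, and the sum of the power series is unique. -/
theorem bergmanG_of_ball {N m n : ℕ} (h : m = 1 ∨ n = 1) {x : ℝ} (h0 : 0 ≤ x) (h1 : x < 1) :
    bergmanG N m n (bCoeff N m n 1) x =
      ((N + m * n).factorial : ℝ) * ((1 - x) ^ (N + m * n + 1))⁻¹ := by
  have hx : ‖(x : ℂ)‖ < 1 := by rwa [Complex.norm_real, Real.norm_of_nonneg h0]
  have hs := hasSum_risingFactorial (N + m * n) hx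
  have hs' := hasSum_complexG N m n 1 hx
  rw [← ofReal_bergmanG] at hs'
  have : (fun k : ℕ => (taylorCoeff N m n 1 k : ℂ) * (x : ℂ) ^ k) = fun k : ℕ =>
      ((∏ l ∈ Finset.range (N + m * n), ((k : ℝ) + 1 + l) : ℝ) : ℂ) * (x : ℂ) ^ k := by
    funext k
    rw [taylorCoeff, huaProd_of_ball h, Finset.prod_range_add]
    congr 3
    refine Finset.prod_congr rfl fun l _ => ?_
    push_cast
    ring
  rw [this] at hs'
  exact_mod_cast hs'.unique hs

theorem derivWithin_Ico_eq {f : ℝ → ℝ} {f' x : ℝ} (hx : x ∈ Ico (0 : ℝ) 1)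
    (h : HasDerivAt f f' x) : derivWithin f (Ico 0 1) x = f' :=
  h.hasDerivWithinAt.derivWithin (uniqueDiffOn_Ico 0 1 x hx)

/-- The normalized solution is `(1-X)^{-(M+1)}`; each bracket of the equation becomes `M + 1` times
a power of `1 - X`. -/
theorem solvesReducedMongeAmpere_of_ball {N m n : ℕ} (hN : 1 ≤ N) (h : m = 1 ∨ n = 1) :
    ∃ c : ℝ, 0 < c ∧ SolvesReducedMongeAmpere N m n 1
      (fun X => c * bergmanG N m n (bCoeff N m n 1) X) := by
  set M := N + m * n with hM
  have hfac : (0 : ℝ) < (M.factorial : ℝ) := by positivity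
  -- This makes `m + n + N/K` equal to `M + 1`, so that the first bracket collapses to a monomial.
  have hmn : m + n = m * n + 1 := by rcases h with rfl | rfl <;> ring
  refine ⟨(M.factorial : ℝ)⁻¹, by positivity, ?_⟩
  have hG : ∀ x ∈ Ico (0 : ℝ) 1, (M.factorial : ℝ)⁻¹ * bergmanG N m n (bCoeff N m n 1) x =
      ((1 - x) ^ (M + 1))⁻¹ := fun x hx => by
    rw [bergmanG_of_ball h hx.1 hx.2, ← hM, inv_mul_cancel_left₀ hfac.ne']
  have hD : ∀ (k : ℕ) (x : ℝ), x ∈ Ico (0 : ℝ) 1 →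
      HasDerivAt (fun x : ℝ => ((1 - x) ^ k)⁻¹) (k * ((1 - x) ^ (k + 1))⁻¹) x := fun k x hx => by
    have := hasDerivAt_eval_one_sub_div (1 : ℝ[X]) k (x := x) hx.2.ne
    simpa [div_eq_mul_inv] using this
  have hD1 : ∀ x ∈ Ico (0 : ℝ) 1, derivWithin (fun X => (M.factorial : ℝ)⁻¹ *
      bergmanG N m n (bCoeff N m n 1) X) (Ico 0 1) x =
      (M + 1 : ℕ) * ((1 - x) ^ (M + 2))⁻¹ := fun x hx => by
    rw [derivWithin_congr hG (hG x hx), derivWithin_Ico_eq hx (hD (M + 1) x hx)]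
  refine ⟨?_, fun x hx => ?_, ?_, ?_⟩
  · exact contDiffOn_const.mul ((contDiffOn_bergmanG N m n _ 2).mono fun x hx => hx.2)
  · simp only
    have hD2 := derivWithin_congr hD1 (hD1 x hx)
    rw [derivWithin_Ico_eq hx ((hD (M + 2) x hx).const_mul ((M + 1 : ℕ) : ℝ))] at hD2
    rw [hD2, hD1 x hx, hG x hx, ← hM]
    have ht : 1 - x ≠ 0 := (sub_pos.2 hx.2).ne'
    set t := 1 - x with htd
    have hxt : x = 1 - t := by rw [htd]; ring
    have e1 : x / 1 * (((M + 1 : ℕ) : ℝ) * (t ^ (M + 2))⁻¹) + (m + n + N / 1) * (t ^ (M + 1))⁻¹ =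
        ((M : ℝ) + 1) * (t ^ (M + 2))⁻¹ := by
      have : (m : ℝ) + n + N / 1 = M + 1 := by
        have h3 : (m : ℝ) + n = m * n + 1 := by exact_mod_cast hmn
        rw [hM]; push_cast; linarith
      rw [this, hxt, pow_succ t (M + 1)]
      push_cast
      field_simp
      ring
    have e2 : (t ^ (M + 1))⁻¹ * (((M + 1 : ℕ) : ℝ) * (t ^ (M + 2))⁻¹) +
        ((t ^ (M + 1))⁻¹ * (((M + 1 : ℕ) : ℝ) * (((M + 2 : ℕ) : ℝ) * (t ^ (M + 2 + 1))⁻¹)) -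
          (((M + 1 : ℕ) : ℝ) * (t ^ (M + 2))⁻¹) ^ 2) * x =
        ((M : ℝ) + 1) * (t ^ (M + 2))⁻¹ ^ 2 := by
      rw [hxt]
      simp only [pow_succ t]
      push_cast
      field_simp
      ring
    rw [e1, e2]
    obtain ⟨N', hN'⟩ : ∃ k, N = k + 1 := ⟨N - 1, by omega⟩
    have hM' : M = N' + 1 + m * n := by rw [hM, hN']
    rw [hN', Nat.add_sub_cancel]
    have hM1 : (M : ℝ) + 1 ≠ 0 := by positivity
    push_cast
    have e3 : (((M : ℝ) + 1) * (t ^ (M + 2))⁻¹) ^ (m * n) * (((M : ℝ) + 1) * (t ^ (M + 2))⁻¹ ^ 2) *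
        (((M : ℝ) + 1) * (t ^ (M + 2))⁻¹) ^ N' =
        ((M : ℝ) + 1) ^ M * ((t ^ (M + 2)) ^ (M + 1))⁻¹ := by
      rw [show M + 1 = m * n + 2 + N' by omega, show ((M : ℝ) + 1) ^ M =
        ((M : ℝ) + 1) ^ (m * n + 1 + N') by rw [show m * n + 1 + N' = M by omega]]
      simp only [mul_pow, pow_add, mul_inv, inv_pow]
      ring
    calc _ = (((M : ℝ) + 1) ^ M)⁻¹ * ((((M : ℝ) + 1) * (t ^ (M + 2))⁻¹) ^ (m * n) *
          (((M : ℝ) + 1) * (t ^ (M + 2))⁻¹ ^ 2) * (((M : ℝ) + 1) * (t ^ (M + 2))⁻¹) ^ N') /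
          (t ^ (M + 1))⁻¹ ^ (M + 1) := by ring
      _ = _ := by
        rw [e3, inv_mul_cancel_left₀ (pow_ne_zero _ hM1), inv_pow, div_inv_eq_mul, ← pow_mul,
          ← pow_mul, show (M + 2) * (M + 1) = (M + 1) * (M + 1) + (M + 1) by ring,
          pow_add t ((M + 1) * (M + 1)), mul_inv]
        field_simp
  · exact (hG 0 (by simp)).trans (by simp)
  · refine Tendsto.congr' (f₁ := fun x : ℝ => ((1 - x) ^ (M + 1))⁻¹) ?_ ?_
    · filter_upwards [Ioo_mem_nhdsLT (zero_lt_one' ℝ)] with x hx using (hG x ⟨hx.1.le, hx.2⟩).symm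
    · refine Tendsto.comp tendsto_inv_nhdsGT_zero ?_
      refine tendsto_nhdsWithin_iff.2 ⟨?_, ?_⟩
      · have : Tendsto (fun x : ℝ => (1 - x) ^ (M + 1)) (𝓝 1) (𝓝 ((1 - 1) ^ (M + 1))) :=
          Continuous.tendsto (by fun_prop) 1
        simp only [sub_self, ne_eq, Nat.add_eq_zero_iff, one_ne_zero, and_false,
          not_false_eq_true, zero_pow] at this
        exact this.mono_left nhdsWithin_le_nhds
      · filter_upwards [self_mem_nhdsWithin] with x hx
        exact pow_pos (sub_pos.2 (mem_Iio.1 hx)) _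

/-- Once the denominator is cleared, the equation is homogeneous up to one factor: `c` comes out to
the power `M + 1` on the left and `M + 2` on the right, so a factor `c` joins the constant
`(M+1)^M`. -/
theorem eq_one_of_solvesReducedMongeAmpere {N m n : ℕ} (hN : 1 ≤ N) (hm : 1 ≤ m) (hn : 1 ≤ n)
    {K : ℝ} (hK : 0 < K) {c : ℝ} (hc : 0 < c) (h : SolvesReducedMongeAmpere N m n K
      (fun X => c * bergmanG N m n (bCoeff N m n K) X)) : K = 1 ∧ (m = 1 ∨ n = 1) := by
  refine eq_one_of_reducedMongeAmpere hN hm hn hK (C := ((N + m * n : ℕ) + 1 : ℝ) ^ (N + m * n) * c)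
    fun x hx => ?_
  have hx' : x ∈ Ico (0 : ℝ) 1 := ⟨hx.1.le, hx.2⟩
  obtain ⟨-, h2, -, -⟩ := h
  have h3 := h2 x hx'
  simp only at h3
  set G := bergmanG N m n (bCoeff N m n K) with hG
  have hGp : 0 < G x := bergmanG_pos N m n hK hx.1.le hx.2
  have hD1 : ∀ y ∈ Ico (0 : ℝ) 1, derivWithin (fun X => c * G X) (Ico 0 1) y = c * deriv G y :=
    fun y hy => by
      have := hasDerivAt_bergmanG N m n K hy.2.ne
      rw [derivWithin_Ico_eq hy (this.const_mul c), this.deriv]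
  have hD2 := derivWithin_congr hD1 (hD1 x hx')
  have hd2 := hasDerivAt_deriv_bergmanG N m n K hx.2.ne
  rw [derivWithin_Ico_eq hx' (hd2.const_mul c), ← hd2.deriv] at hD2
  rw [hD2, hD1 x hx'] at h3
  set g1 := deriv G x
  set g2 := deriv (deriv G) x
  simp only
  obtain ⟨N', rfl⟩ : ∃ k, N = k + 1 := ⟨N - 1, by omega⟩
  rw [Nat.add_sub_cancel] at h3 ⊢
  have hM1 : (((N' + 1 + m * n : ℕ) : ℝ) + 1) ^ (N' + 1 + m * n) ≠ 0 := by positivity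
  have e1 : x / K * (c * g1) + ((m : ℝ) + n + ((N' + 1 : ℕ) : ℝ) / K) * (c * G x) =
      c * (x / K * g1 + ((m : ℝ) + n + ((N' + 1 : ℕ) : ℝ) / K) * G x) := by ring
  have e2 : c * G x * (c * g1) + (c * G x * (c * g2) - (c * g1) ^ 2) * x =
      c ^ 2 * (G x * g1 + (G x * g2 - g1 ^ 2) * x) := by ring
  rw [e1, e2] at h3
  set a := x / K * g1 + ((m : ℝ) + n + ((N' + 1 : ℕ) : ℝ) / K) * G x
  set s := G x * g1 + (G x * g2 - g1 ^ 2) * x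
  set B := (((N' + 1 + m * n : ℕ) : ℝ) + 1) ^ (N' + 1 + m * n)
  have hcG : (c * G x) ^ (N' + 1 + m * n + 1) ≠ 0 := by positivity
  rw [inv_mul_eq_div, ← mul_div_assoc, div_mul_eq_mul_div, div_mul_eq_mul_div, div_eq_iff hcG,
    div_eq_iff hM1] at h3
  have hcp : c ^ (m * n + 2 + N') ≠ 0 := by positivity
  refine mul_left_cancel₀ hcp ?_
  calc c ^ (m * n + 2 + N') * (a ^ (m * n) * s * g1 ^ N') =
      (c * a) ^ (m * n) * (c ^ 2 * s) * (c * g1) ^ N' := by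
        rw [mul_pow, mul_pow, pow_add, pow_add]; ring
    _ = c * G x * B * (c * G x) ^ (N' + 1 + m * n + 1) := by rw [h3]; ring
    _ = _ := by
      rw [mul_pow, show N' + 1 + m * n + 1 = m * n + 2 + N' by ring,
        show N' + 1 + m * n + 2 = m * n + 2 + N' + 1 by ring, pow_succ (G x)]
      ring

end ReducedEquation

/-! ### The Levi form -/

section Levi

variable {E F : Type*} [NormedAddCommGroup E] [NormedSpace ℂ E] [NormedSpace ℝ E]
  [IsScalarTower ℝ ℂ E] [NormedAddCommGroup F] [NormedSpace ℂ F] [NormedSpace ℝ F]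
  [IsScalarTower ℝ ℂ F]

/-- The Levi form `∑ ∂²u/∂z_i∂z̄_j ξ_i η̄_j` of a real function `u`. -/
def leviForm (u : E → ℝ) (p ξ η : E) : ℂ :=
  ((fderiv ℝ (fderiv ℝ u) p ξ η : ℝ) + (fderiv ℝ (fderiv ℝ u) p (Complex.I • ξ) (Complex.I • η) : ℝ)
    + Complex.I * ((fderiv ℝ (fderiv ℝ u) p ξ (Complex.I • η) : ℝ)
      - (fderiv ℝ (fderiv ℝ u) p (Complex.I • ξ) η : ℝ))) / 4

theorem leviForm_congr {u v : E → ℝ} {p : E} (h : u =ᶠ[𝓝 p] v) (ξ η : E) :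
    leviForm u p ξ η = leviForm v p ξ η := by
  rw [leviForm, leviForm, (h.fderiv).fderiv_eq]

theorem leviForm_add_left (u : E → ℝ) (p ξ ξ' η : E) :
    leviForm u p (ξ + ξ') η = leviForm u p ξ η + leviForm u p ξ' η := by
  simp only [leviForm, smul_add, map_add, add_apply]
  push_cast
  ring

theorem leviForm_add_right (u : E → ℝ) (p ξ η η' : E) :
    leviForm u p ξ (η + η') = leviForm u p ξ η + leviForm u p ξ η' := by
  simp only [leviForm, smul_add, map_add]
  push_cast
  ring

theorem leviForm_smul_left (u : E → ℝ) (p : E) (c : ℂ) (ξ η : E) :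
    leviForm u p (c • ξ) η = c * leviForm u p ξ η := by
  have e : ∀ x : E, c • x = c.re • x + c.im • (Complex.I • x) := fun x => by
    conv_lhs => rw [← Complex.re_add_im c, add_smul, mul_smul]
    rw [← algebraMap_smul ℂ c.re x, ← algebraMap_smul ℂ c.im (Complex.I • x)]
    rfl
  have eI : ∀ x : E, Complex.I • (c • x) = c.re • (Complex.I • x) + c.im • (-x) := fun x => by
    rw [smul_comm, e (Complex.I • x), smul_smul Complex.I Complex.I, Complex.I_mul_I, neg_smul,
      one_smul]
  simp only [leviForm, eI]
  simp only [e, map_add, map_smul, map_neg, add_apply,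
    smul_apply, neg_apply, smul_eq_mul]
  conv_rhs => rw [← Complex.re_add_im c]
  push_cast
  linear_combination (-(c.im : ℂ) / 4 * ((fderiv ℝ (fderiv ℝ u) p ξ (Complex.I • η) : ℝ)
      - (fderiv ℝ (fderiv ℝ u) p (Complex.I • ξ) η : ℝ))) * Complex.I_mul_I

theorem leviForm_smul_right (u : E → ℝ) (p : E) (c : ℂ) (ξ η : E) :
    leviForm u p ξ (c • η) = conj c * leviForm u p ξ η := by
  have e : ∀ x : E, c • x = c.re • x + c.im • (Complex.I • x) := fun x => by
    conv_lhs => rw [← Complex.re_add_im c, add_smul, mul_smul]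
    rw [← algebraMap_smul ℂ c.re x, ← algebraMap_smul ℂ c.im (Complex.I • x)]
    rfl
  have eI : ∀ x : E, Complex.I • (c • x) = c.re • (Complex.I • x) + c.im • (-x) := fun x => by
    rw [smul_comm, e (Complex.I • x), smul_smul Complex.I Complex.I, Complex.I_mul_I, neg_smul,
      one_smul]
  have hc : conj c = (c.re : ℂ) - c.im * Complex.I := by
    apply Complex.ext <;> simp
  simp only [leviForm, eI]
  simp only [e, map_add, map_smul, map_neg, smul_eq_mul]
  rw [hc]
  push_cast
  linear_combination ((c.im : ℂ) / 4 * ((fderiv ℝ (fderiv ℝ u) p ξ (Complex.I • η) : ℝ)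
      - (fderiv ℝ (fderiv ℝ u) p (Complex.I • ξ) η : ℝ))) * Complex.I_mul_I

theorem contDiffAt_two_fderiv {E F : Type*} [NormedAddCommGroup E] [NormedSpace ℝ E]
    [NormedAddCommGroup F] [NormedSpace ℝ F] {u : E → F} {p : E} (hu : ContDiffAt ℝ 2 u p) :
    DifferentiableAt ℝ (fderiv ℝ u) p :=
  (hu.fderiv_right (m := 1) (by norm_num)).differentiableAt (by simp)

theorem fderiv_fderiv_apply {E F : Type*} [NormedAddCommGroup E] [NormedSpace ℝ E]
    [NormedAddCommGroup F] [NormedSpace ℝ F] {u : E → F} {p : E} (hu : ContDiffAt ℝ 2 u p) (v w : E) :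
    fderiv ℝ (fderiv ℝ u) p v w = fderiv ℝ (fun q => fderiv ℝ u q w) p v := by
  rw [fderiv_clm_apply (contDiffAt_two_fderiv hu) (differentiableAt_const w)]
  simp

theorem fderiv_fderiv_self {u : E → ℝ} {p : E} (hu : ContDiffAt ℝ 2 u p) (v : E) :
    fderiv ℝ (fderiv ℝ u) p v v = deriv (deriv fun t : ℝ => u (p + t • v)) 0 := by
  have hline : ∀ t : ℝ, HasDerivAt (fun t : ℝ => p + t • v) v t := fun t => by
    simpa using ((hasDerivAt_id t).smul_const v).const_add p
  have hcont : Tendsto (fun t : ℝ => p + t • v) (𝓝 0) (𝓝 p) := by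
    have := (hline 0).continuousAt.tendsto
    simpa using this
  have h1 : ∀ᶠ q in 𝓝 p, DifferentiableAt ℝ u q := by
    filter_upwards [hu.eventually (by simp)] with q hq using hq.differentiableAt (by simp)
  have h2 : deriv (fun t : ℝ => u (p + t • v)) =ᶠ[𝓝 0] fun t => fderiv ℝ u (p + t • v) v := by
    filter_upwards [hcont.eventually h1] with t ht
    exact (ht.hasFDerivAt.comp_hasDerivAt t (hline t)).deriv
  rw [h2.deriv_eq, fderiv_fderiv_apply hu]
  have hd : DifferentiableAt ℝ (fun q => fderiv ℝ u q v) (p + (0 : ℝ) • v) := by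
    rw [zero_smul, add_zero]
    exact (contDiffAt_two_fderiv hu).clm_apply (differentiableAt_const v)
  have := (hd.hasFDerivAt.comp_hasDerivAt (0 : ℝ) (hline 0)).deriv
  rw [zero_smul, add_zero] at this
  exact this.symm

/-- The mixed terms cancel by symmetry of the second derivative. All Hessians below are reduced in
this way to second derivatives along the real lines in directions `ξ` and `iξ`. -/
theorem leviForm_self {u : E → ℝ} {p : E} (hu : ContDiffAt ℝ 2 u p) (ξ : E) :
    leviForm u p ξ ξ = ((deriv (deriv fun t : ℝ => u (p + t • ξ)) 0 +
      deriv (deriv fun t : ℝ => u (p + t • (Complex.I • ξ))) 0 : ℝ) : ℂ) / 4 := by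
  have hsymm : IsSymmSndFDerivAt ℝ u p := hu.isSymmSndFDerivAt (by simp)
  rw [leviForm, ← fderiv_fderiv_self hu, ← fderiv_fderiv_self hu,
    hsymm.eq (Complex.I • ξ) ξ]
  push_cast
  ring

theorem leviForm_add {u v : E → ℝ} {p : E} (hu : ContDiffAt ℝ 2 u p) (hv : ContDiffAt ℝ 2 v p)
    (ξ η : E) : leviForm (fun q => u q + v q) p ξ η = leviForm u p ξ η + leviForm v p ξ η := by
  have h : fderiv ℝ (fun q => u q + v q) =ᶠ[𝓝 p] fun q => fderiv ℝ u q + fderiv ℝ v q := by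
    filter_upwards [hu.eventually (by simp), hv.eventually (by simp)] with q h1 h2
    exact fderiv_fun_add (h1.differentiableAt (by simp)) (h2.differentiableAt (by simp))
  rw [leviForm, h.fderiv_eq, fderiv_fun_add (contDiffAt_two_fderiv hu) (contDiffAt_two_fderiv hv)]
  simp only [leviForm, add_apply]
  push_cast
  ring

theorem leviForm_add_const (u : E → ℝ) (p : E) (c : ℝ) (ξ η : E) :
    leviForm (fun q => u q + c) p ξ η = leviForm u p ξ η := by
  have h : fderiv ℝ (fun q => u q + c) = fderiv ℝ u := funext fun q => fderiv_add_const c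
  rw [leviForm, h, leviForm]

theorem fderiv_fderiv_comp {u : F → ℝ} {f : E → F} {p : E} (hu : ContDiffAt ℝ 2 u (f p))
    (hf : ContDiffAt ℂ 2 f p) (v w : E) :
    fderiv ℝ (fderiv ℝ fun q => u (f q)) p v w =
      fderiv ℝ (fderiv ℝ u) (f p) (fderiv ℂ f p v) (fderiv ℂ f p w) +
        fderiv ℝ u (f p) (fderiv ℂ (fderiv ℂ f) p v w) := by
  have hfR : ContDiffAt ℝ 2 f p := hf.restrict_scalars ℝ
  have hcomp : ContDiffAt ℝ 2 (fun q => u (f q)) p := hu.comp p hfR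
  rw [fderiv_fderiv_apply hcomp]
  have hf1 : ∀ᶠ q in 𝓝 p, DifferentiableAt ℂ f q := by
    filter_upwards [hf.eventually (by simp)] with q hq using hq.differentiableAt (by simp)
  have hu1 : ∀ᶠ q in 𝓝 p, DifferentiableAt ℝ u (f q) := by
    filter_upwards [hfR.continuousAt.eventually (hu.eventually (by simp))] with q hq
    exact hq.differentiableAt (by simp)
  have h1 : (fun q => fderiv ℝ (fun q => u (f q)) q w) =ᶠ[𝓝 p]
      fun q => fderiv ℝ u (f q) (fderiv ℂ f q w) := by
    filter_upwards [hf1, hu1] with q hq1 hq2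
    have := (hq2.hasFDerivAt.comp q (hq1.hasFDerivAt.restrictScalars ℝ)).fderiv
    rw [show (fun q => u (f q)) = u ∘ f from rfl, this]
    rfl
  rw [h1.fderiv_eq]
  have hfp : HasFDerivAt f ((fderiv ℂ f p).restrictScalars ℝ) p :=
    (hf.differentiableAt (by simp)).hasFDerivAt.restrictScalars ℝ
  have h2 : HasFDerivAt (fun q => fderiv ℝ u (f q))
      ((fderiv ℝ (fderiv ℝ u) (f p)).comp ((fderiv ℂ f p).restrictScalars ℝ)) p :=
    (contDiffAt_two_fderiv hu).hasFDerivAt.comp p hfp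
  have hdd : DifferentiableAt ℂ (fderiv ℂ f) p :=
    (hf.fderiv_right (m := 1) (by norm_num)).differentiableAt (by simp)
  have h3 : HasFDerivAt (fun q => fderiv ℂ f q w)
      (((fderiv ℂ (fderiv ℂ f) p).flip w).restrictScalars ℝ) p := by
    have := (hdd.hasFDerivAt.clm_apply (hasFDerivAt_const w p))
    simp only [ContinuousLinearMap.comp_zero, zero_add] at this
    exact this.restrictScalars ℝ
  rw [(h2.clm_apply h3).fderiv]
  simp [add_comm]

/-- The term of the chain rule with the second derivative of `f` drops out, because that derivative
is complex bilinear and the Levi form contains `(ξ, η)` and `(iξ, iη)` with equal signs, `(ξ, iη)`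
and `(iξ, η)` with opposite signs. -/
theorem leviForm_comp {u : F → ℝ} {f : E → F} {p : E} (hu : ContDiffAt ℝ 2 u (f p))
    (hf : ContDiffAt ℂ 2 f p) (ξ η : E) :
    leviForm (fun q => u (f q)) p ξ η = leviForm u (f p) (fderiv ℂ f p ξ) (fderiv ℂ f p η) := by
  simp only [leviForm, fderiv_fderiv_comp hu hf, map_smul, smul_apply,
    smul_smul, Complex.I_mul_I, neg_smul, one_smul, map_neg]
  push_cast
  ring

theorem leviForm_re {f : E → ℂ} {p : E} (hf : ContDiffAt ℂ 2 f p) (ξ η : E) :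
    leviForm (fun q => (f q).re) p ξ η = 0 := by
  have hre : ContDiffAt ℝ 2 Complex.re (f p) := Complex.reCLM.contDiff.contDiffAt
  rw [leviForm_comp (u := Complex.re) hre hf]
  have h : fderiv ℝ Complex.re = fun _ => Complex.reCLM := funext fun z => Complex.reCLM.fderiv
  simp [leviForm, h]

/-- Locally `log |h|²` is the real part of a holomorphic function; dividing by `h p` keeps the
argument of the principal logarithm near 1. -/
theorem leviForm_log_normSq {h : E → ℂ} {p : E} (hh : ContDiffAt ℂ 2 h p) (h0 : h p ≠ 0)
    (ξ η : E) : leviForm (fun q => Real.log (‖h q‖ ^ 2)) p ξ η = 0 := by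
  set f : E → ℂ := fun q => 2 * Complex.log (h q / h p) + (Real.log (‖h p‖ ^ 2) : ℂ) with hf
  have hdiv : ContDiffAt ℂ 2 (fun q => h q / h p) p := hh.div_const _
  have hslit : h p / h p ∈ Complex.slitPlane := by rw [div_self h0]; exact Complex.one_mem_slitPlane
  have hfc : ContDiffAt ℂ 2 f p :=
    (contDiffAt_const.mul ((Complex.contDiffAt_log hslit).comp p hdiv)).add contDiffAt_const
  rw [leviForm_congr (v := fun q => (f q).re) ?_, leviForm_re hfc]
  filter_upwards [hh.continuousAt.eventually_ne h0] with q hq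
  simp only [hf, Complex.add_re, Complex.ofReal_re]
  rw [show (2 : ℂ) = ((2 : ℝ) : ℂ) by norm_num, Complex.re_ofReal_mul, Complex.log_re, norm_div,
    Real.log_div (norm_ne_zero_iff.2 hq) (norm_ne_zero_iff.2 h0), Real.log_pow, Real.log_pow]
  push_cast
  ring

end Levi

/-! ### Complex Hessians as Levi forms, and their chain rule -/

section Hessian

variable {ι : Type} [Fintype ι] [DecidableEq ι]

theorem complexHessian_apply {u : (ι → ℂ) → ℝ} {p : ι → ℂ} (hu : ContDiffAt ℝ 2 u p) (i j : ι) :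
    complexHessian u p i j = leviForm u p (Pi.single i 1) (Pi.single j 1) := by
  have hI : ∀ k : ι, (Pi.single k Complex.I : ι → ℂ) = Complex.I • Pi.single k 1 := fun k => by
    rw [← Pi.single_smul]; simp
  have h1 : ∀ᶠ q in 𝓝 p, DifferentiableAt ℝ u q := by
    filter_upwards [hu.eventually (by simp)] with q hq using hq.differentiableAt (by simp)
  have hcast : ∀ q, DifferentiableAt ℝ u q → ∀ v,
      fderiv ℝ (fun q => (u q : ℂ)) q v = (fderiv ℝ u q v : ℂ) := fun q hq v => by
    have : HasFDerivAt (fun q => (u q : ℂ)) (Complex.ofRealCLM.comp (fderiv ℝ u q)) q :=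
      Complex.ofRealCLM.hasFDerivAt.comp q hq.hasFDerivAt
    rw [this.fderiv]; rfl
  have h2 : dzbar j (fun q => (u q : ℂ)) =ᶠ[𝓝 p] fun q =>
      ((fderiv ℝ u q (Pi.single j 1) : ℂ) +
        Complex.I * (fderiv ℝ u q (Complex.I • Pi.single j 1) : ℂ)) / 2 := by
    filter_upwards [h1] with q hq
    rw [dzbar, hcast q hq, hcast q hq, hI]
  have hd : ∀ w, HasFDerivAt (fun q => (fderiv ℝ u q w : ℂ))
      (Complex.ofRealCLM.comp ((fderiv ℝ (fderiv ℝ u) p).flip w)) p := fun w => by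
    have h3 := (contDiffAt_two_fderiv hu).hasFDerivAt.clm_apply (hasFDerivAt_const w p)
    simp only [ContinuousLinearMap.comp_zero, zero_add] at h3
    exact Complex.ofRealCLM.hasFDerivAt.comp p h3
  have h4 := (((hd (Pi.single j 1)).add ((hd (Complex.I • Pi.single j 1)).const_mul
    Complex.I)).mul_const (2 : ℂ)⁻¹)
  show dz i (dzbar j fun q => (u q : ℂ)) p = _
  rw [dz, h2.fderiv_eq]
  have h5 := h4.congr_of_eventuallyEq (f₁ := fun q => ((fderiv ℝ u q (Pi.single j 1) : ℂ) +
    Complex.I * (fderiv ℝ u q (Complex.I • Pi.single j 1) : ℂ)) / 2)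
    (Eventually.of_forall fun q => by simp [div_eq_mul_inv])
  rw [h5.fderiv, hI, leviForm]
  simp
  linear_combination ((fderiv ℝ (fderiv ℝ u) p (Complex.I • Pi.single i 1)
    (Complex.I • Pi.single j 1) : ℝ) : ℂ) / 4 * (-1 - Complex.I_mul_I)

theorem leviForm_eq_sum (u : (ι → ℂ) → ℝ) (p ξ η : ι → ℂ) : leviForm u p ξ η =
    ∑ i, ∑ j, ξ i * conj (η j) * leviForm u p (Pi.single i 1) (Pi.single j 1) := by
  have hl : ∀ η, leviForm u p ξ η = ∑ i, ξ i * leviForm u p (Pi.single i 1) η := fun η => by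
    let L : (ι → ℂ) →ₗ[ℂ] ℂ :=
      { toFun := fun ξ => leviForm u p ξ η
        map_add' := fun a b => leviForm_add_left u p a b η
        map_smul' := fun c a => leviForm_smul_left u p c a η }
    have : L ξ = ∑ i, ξ i * L (Pi.single i 1) := by
      conv_lhs => rw [pi_eq_sum_univ' ξ, map_sum]
      refine Finset.sum_congr rfl fun i _ => ?_
      rw [map_smul, smul_eq_mul]
    exact this
  have hr : ∀ ξ, leviForm u p ξ η = ∑ j, conj (η j) * leviForm u p ξ (Pi.single j 1) := fun ξ => by
    let L : (ι → ℂ) →ₛₗ[starRingEnd ℂ] ℂ :=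
      { toFun := fun η => leviForm u p ξ η
        map_add' := fun a b => leviForm_add_right u p ξ a b
        map_smul' := fun c a => leviForm_smul_right u p c ξ a }
    have : L η = ∑ j, conj (η j) * L (Pi.single j 1) := by
      conv_lhs => rw [pi_eq_sum_univ' η, map_sum]
      refine Finset.sum_congr rfl fun i _ => ?_
      rw [map_smulₛₗ, smul_eq_mul]
    exact this
  rw [hl]
  refine Finset.sum_congr rfl fun i _ => ?_
  rw [hr, Finset.mul_sum]
  refine Finset.sum_congr rfl fun j _ => by ring

/-- The Jacobian matrix of a holomorphic map. -/
def jacobian (f : (ι → ℂ) → (ι → ℂ)) (p : ι → ℂ) : Matrix ι ι ℂ :=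
  LinearMap.toMatrix' (fderiv ℂ f p : (ι → ℂ) →ₗ[ℂ] (ι → ℂ))

theorem complexHessian_comp {u : (ι → ℂ) → ℝ} {f : (ι → ℂ) → (ι → ℂ)} {p : ι → ℂ}
    (hu : ContDiffAt ℝ 2 u (f p)) (hf : ContDiffAt ℂ 2 f p) :
    complexHessian (fun q => u (f q)) p =
      (jacobian f p)ᵀ * complexHessian u (f p) * (jacobian f p).map conj := by
  ext i j
  rw [complexHessian_apply (show ContDiffAt ℝ 2 (fun q => u (f q)) p from hu.comp p (hf.restrict_scalars ℝ)), leviForm_comp hu hf,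
    leviForm_eq_sum, Matrix.mul_assoc, Matrix.mul_apply]
  refine Finset.sum_congr rfl fun k _ => ?_
  rw [Matrix.mul_apply, Finset.mul_sum]
  refine Finset.sum_congr rfl fun l _ => ?_
  rw [complexHessian_apply hu]
  simp only [jacobian, Matrix.transpose_apply, Matrix.map_apply, LinearMap.toMatrix'_apply]
  simp only [ContinuousLinearMap.coe_coe, ← Pi.single_apply]
  ring_nf

end Hessian

/-! ### Biholomorphic maps and reproducing functions -/

section Biholomorphic

variable {ι : Type} [Fintype ι] [DecidableEq ι]

/-- The complex Jacobian determinant. -/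
def jac (f : (ι → ℂ) → (ι → ℂ)) (p : ι → ℂ) : ℂ := (jacobian f p).det

/-- `f` is a biholomorphic self-map of `Ω` with inverse `g`. -/
structure IsBiholo (Ω : Set (ι → ℂ)) (f g : (ι → ℂ) → (ι → ℂ)) : Prop where
  diff : DifferentiableOn ℂ f Ω
  diff' : DifferentiableOn ℂ g Ω
  maps : MapsTo f Ω Ω
  maps' : MapsTo g Ω Ω
  inv : InvOn g f Ω Ω

/-- `h` is the Bergman kernel function with pole `w`. -/
def IsReproAt (Ω : Set (ι → ℂ)) (w : ι → ℂ) (h : (ι → ℂ) → ℂ) : Prop :=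
  h ∈ bergmanSpace Ω ∧ ∀ f ∈ bergmanSpace Ω, f w = ∫ z in Ω, f z * conj (h z)

theorem IsBiholo.symm {Ω : Set (ι → ℂ)} {f g : (ι → ℂ) → (ι → ℂ)} (h : IsBiholo Ω f g) :
    IsBiholo Ω g f := ⟨h.diff', h.diff, h.maps', h.maps, h.inv.symm⟩

theorem jac_eq_det (f : (ι → ℂ) → (ι → ℂ)) (p : ι → ℂ) :
    jac f p = LinearMap.det (fderiv ℂ f p : (ι → ℂ) →ₗ[ℂ] (ι → ℂ)) := by
  rw [jac, jacobian, LinearMap.det_toMatrix']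

theorem jacobian_comp {f g : (ι → ℂ) → (ι → ℂ)} {p : ι → ℂ} (hg : DifferentiableAt ℂ g (f p))
    (hf : DifferentiableAt ℂ f p) : jacobian (fun q => g (f q)) p = jacobian g (f p) * jacobian f p := by
  rw [jacobian, show (fun q => g (f q)) = g ∘ f from rfl, fderiv_comp p hg hf, jacobian, jacobian,
    ← LinearMap.toMatrix'_comp]
  rfl

theorem jac_comp {f g : (ι → ℂ) → (ι → ℂ)} {p : ι → ℂ} (hg : DifferentiableAt ℂ g (f p))
    (hf : DifferentiableAt ℂ f p) : jac (fun q => g (f q)) p = jac g (f p) * jac f p := by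
  rw [jac, jacobian_comp hg hf, Matrix.det_mul, jac, jac]

theorem IsBiholo.comp {Ω : Set (ι → ℂ)} {f g f' g' : (ι → ℂ) → (ι → ℂ)}
    (h : IsBiholo Ω f g) (h' : IsBiholo Ω f' g') :
    IsBiholo Ω (fun q => f' (f q)) (fun q => g (g' q)) :=
  ⟨h'.diff.comp h.diff h.maps, h.diff'.comp h'.diff' h'.maps', h'.maps.comp h.maps,
    h.maps'.comp h'.maps',
    ⟨fun p hp => by simp only [h'.inv.1 (h.maps hp), h.inv.1 hp],
      fun p hp => by simp only [h.inv.2 (h'.maps' hp), h'.inv.2 hp]⟩⟩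

theorem contDiff_det {κ : Type*} [Fintype κ] [DecidableEq κ] {k : WithTop ℕ∞} :
    ContDiff ℂ k fun M : κ → κ → ℂ => (Matrix.of M).det := by
  simp only [Matrix.det_apply, Matrix.of_apply]
  refine ContDiff.sum fun σ _ => ContDiff.const_smul _ (contDiff_prod fun i _ => ?_)
  exact contDiff_apply_apply ℂ ℂ _ _

theorem jac_differentiableOn {Ω : Set (ι → ℂ)} (hΩ : IsOpen Ω) {f : (ι → ℂ) → (ι → ℂ)}
    (hf : DifferentiableOn ℂ f Ω) : DifferentiableOn ℂ (jac f) Ω := by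
  have h1 : ∀ i j, DifferentiableOn ℂ (fun p => jacobian f p i j) Ω := by
    intro i j
    have h2 : DifferentiableOn ℂ (fun p => fderiv ℂ f p (Pi.single j 1)) Ω := fun p hp =>
      (differentiableAt_fderiv_apply hΩ hf hp _).differentiableWithinAt
    have h3 := (differentiableOn_pi.1 h2) i
    refine h3.congr fun p _ => ?_
    simp only [jacobian, LinearMap.toMatrix'_apply, ContinuousLinearMap.coe_coe]
  exact ((contDiff_det (k := 1)).differentiable (by simp)).comp_differentiableOn
    (differentiableOn_pi.2 fun i => differentiableOn_pi.2 fun j => h1 i j)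

theorem IsBiholo.jac_mul {Ω : Set (ι → ℂ)} (hΩ : IsOpen Ω) {f g : (ι → ℂ) → (ι → ℂ)}
    (h : IsBiholo Ω f g) {p : ι → ℂ} (hp : p ∈ Ω) : jac g (f p) * jac f p = 1 := by
  rw [← jac_comp (h.diff'.differentiableAt (hΩ.mem_nhds (h.maps hp)))
    (h.diff.differentiableAt (hΩ.mem_nhds hp)), jac_eq_det]
  have : (fun q => g (f q)) =ᶠ[𝓝 p] id := by
    filter_upwards [hΩ.mem_nhds hp] with q hq using h.inv.1 hq
  rw [this.fderiv_eq, fderiv_id]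
  exact LinearMap.det_id

/-- The determinant of a complex linear map, seen over `ℝ`, is the norm from `ℂ` to `ℝ` of its
complex determinant. -/
theorem abs_det_restrictScalars (f : (ι → ℂ) → (ι → ℂ)) (p : ι → ℂ) :
    |((fderiv ℂ f p).restrictScalars ℝ).det| = ‖jac f p‖ ^ 2 := by
  have : ((fderiv ℂ f p).restrictScalars ℝ).det =
      LinearMap.det ((fderiv ℂ f p : (ι → ℂ) →ₗ[ℂ] (ι → ℂ)).restrictScalars ℝ) := rfl
  rw [this, LinearMap.det_restrictScalars, Algebra.norm_complex_apply, jac_eq_det,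
    Complex.normSq_eq_norm_sq, abs_of_nonneg (by positivity)]

theorem IsBiholo.image_eq {Ω : Set (ι → ℂ)} {f g : (ι → ℂ) → (ι → ℂ)} (h : IsBiholo Ω f g) :
    f '' Ω = Ω := (h.inv.bijOn h.maps h.maps').image_eq

theorem IsBiholo.integral_comp {Ω : Set (ι → ℂ)} (hΩ : IsOpen Ω) {f g : (ι → ℂ) → (ι → ℂ)}
    (h : IsBiholo Ω f g) (φ : (ι → ℂ) → ℂ) :
    ∫ u in Ω, φ u = ∫ z in Ω, (‖jac f z‖ ^ 2 : ℝ) • φ (f z) := by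
  have h1 := integral_image_eq_integral_abs_det_fderiv_smul (s := Ω) (f := f)
    (f' := fun x => (fderiv ℂ f x).restrictScalars ℝ) volume hΩ.measurableSet
    (fun x hx => ((h.diff.differentiableAt (hΩ.mem_nhds hx)).hasFDerivAt.restrictScalars
      ℝ).hasFDerivWithinAt) h.inv.1.injOn φ
  simpa only [h.image_eq, abs_det_restrictScalars] using h1

theorem bergmanSpace_iff {Ω : Set (ι → ℂ)} (hΩ : IsOpen Ω) {f : (ι → ℂ) → ℂ} :
    f ∈ bergmanSpace Ω ↔ DifferentiableOn ℂ f Ω ∧ IntegrableOn (fun z => ‖f z‖ ^ 2) Ω := by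
  refine and_congr_right fun hf => ?_
  exact memLp_two_iff_integrable_sq_norm (hf.continuousOn.aestronglyMeasurable hΩ.measurableSet)

theorem IsBiholo.comp_mem_bergmanSpace {Ω : Set (ι → ℂ)} (hΩ : IsOpen Ω)
    {f g : (ι → ℂ) → (ι → ℂ)} (h : IsBiholo Ω f g) {φ : (ι → ℂ) → ℂ} (hφ : φ ∈ bergmanSpace Ω) :
    (fun z => jac f z * φ (f z)) ∈ bergmanSpace Ω := by
  rw [bergmanSpace_iff hΩ] at hφ ⊢
  refine ⟨(jac_differentiableOn hΩ h.diff).mul (hφ.1.comp h.diff h.maps), ?_⟩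
  have h1 := integrableOn_image_iff_integrableOn_abs_det_fderiv_smul (s := Ω) (f := f)
    (f' := fun x => (fderiv ℂ f x).restrictScalars ℝ) volume hΩ.measurableSet
    (fun x hx => ((h.diff.differentiableAt (hΩ.mem_nhds hx)).hasFDerivAt.restrictScalars
      ℝ).hasFDerivWithinAt) h.inv.1.injOn (fun z => ‖φ z‖ ^ 2)
  rw [h.image_eq] at h1
  refine (h1.1 hφ.2).congr_fun (fun z _ => ?_) hΩ.measurableSet
  simp only [abs_det_restrictScalars, norm_mul, mul_pow, smul_eq_mul]

theorem const_mul_mem_bergmanSpace {Ω : Set (ι → ℂ)} {φ : (ι → ℂ) → ℂ} (c : ℂ)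
    (hφ : φ ∈ bergmanSpace Ω) : (fun z => φ z * c) ∈ bergmanSpace Ω :=
  ⟨hφ.1.mul_const c, by simpa [mul_comm] using hφ.2.const_mul c⟩

/-- Transformation of kernel functions under biholomorphic maps. -/
theorem IsBiholo.isReproAt {Ω : Set (ι → ℂ)} (hΩ : IsOpen Ω) {f g : (ι → ℂ) → (ι → ℂ)}
    (h : IsBiholo Ω f g) {w : ι → ℂ} (hw : w ∈ Ω) {k : (ι → ℂ) → ℂ} (hk : IsReproAt Ω (f w) k) :
    IsReproAt Ω w fun z => jac f z * k (f z) * conj (jac f w) := by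
  refine ⟨const_mul_mem_bergmanSpace _ (h.comp_mem_bergmanSpace hΩ hk.1), fun φ hφ => ?_⟩
  -- The reproducing property at `f w` is used for the pullback of `φ` under the inverse map; the
  -- substitution `u = f z` then brings the integral back to `φ`.
  have h1 := hk.2 _ (h.symm.comp_mem_bergmanSpace hΩ hφ)
  rw [h.integral_comp hΩ, h.inv.1 hw] at h1
  have h2 : φ w = jac f w * (jac g (f w) * φ w) := by
    rw [← mul_assoc, mul_comm (jac f w), h.jac_mul hΩ hw, one_mul]
  rw [h2, h1, ← integral_const_mul]
  refine setIntegral_congr_fun hΩ.measurableSet fun z hz => ?_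
  have h3 := h.jac_mul hΩ hz
  have h4 : ((‖jac f z‖ ^ 2 : ℝ) : ℂ) = jac f z * conj (jac f z) := by
    rw [Complex.mul_conj, Complex.normSq_eq_norm_sq]
  simp only [Complex.real_smul, h4, h.inv.1 hz, map_mul, Complex.conj_conj]
  linear_combination (jac f w * conj (jac f z) * φ z * conj (k (f z))) * h3

theorem IsBergmanKernel.isReproAt {Ω : Set (ι → ℂ)} {k : (ι → ℂ) → (ι → ℂ) → ℂ}
    (hk : IsBergmanKernel Ω k) {w : ι → ℂ} (hw : w ∈ Ω) : IsReproAt Ω w fun z => k z w :=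
  ⟨hk.1 w hw, fun f hf => hk.2 f hf w hw⟩

theorem IsReproAt.eq_conj {Ω : Set (ι → ℂ)} {w z : ι → ℂ} {h k : (ι → ℂ) → ℂ}
    (hh : IsReproAt Ω w h) (hk : IsReproAt Ω z k) : h z = conj (k w) := by
  rw [hk.2 h hh.1, hh.2 k hk.1, ← integral_conj]
  simp [mul_comm]

/-- Conjugate symmetry gives `h w = conj (k w)` as well as `k w = conj (k w)`. Only the value at the
pole is needed for diagonal values. -/
theorem IsReproAt.unique {Ω : Set (ι → ℂ)} {w : ι → ℂ} (hw : w ∈ Ω) {h k : (ι → ℂ) → ℂ}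
    (hh : IsReproAt Ω w h) (hk : IsReproAt Ω w k) : h w = k w := by
  have h1 := hh.eq_conj hk
  have h2 := hk.eq_conj hk
  rw [h1, ← h2]

theorem IsBergmanKernel.transform {Ω : Set (ι → ℂ)} (hΩ : IsOpen Ω)
    {k : (ι → ℂ) → (ι → ℂ) → ℂ} (hk : IsBergmanKernel Ω k) {f g : (ι → ℂ) → (ι → ℂ)}
    (h : IsBiholo Ω f g) {w : ι → ℂ} (hw : w ∈ Ω) :
    k w w = (‖jac f w‖ ^ 2 : ℝ) * k (f w) (f w) := by
  rw [(hk.isReproAt hw).unique hw (h.isReproAt hΩ hw (hk.isReproAt (h.maps hw)))]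
  rw [Complex.ofReal_pow, ← Complex.mul_conj']
  ring

theorem exists_isBergmanKernel {Ω : Set (ι → ℂ)} (h : ∀ w ∈ Ω, ∃ k, IsReproAt Ω w k) :
    ∃ k, IsBergmanKernel Ω k := by
  choose! k hk using h
  exact ⟨fun z w => k w z, fun w hw => (hk w hw).1, fun f hf w hw => (hk w hw).2 f hf⟩

end Biholomorphic

/-! ### Averages over circle actions -/

section Rotation

variable {ι : Type} [Fintype ι] [DecidableEq ι]

/-- Multiplication of the coordinates in `S` by `ζ`. -/
def rot (S : ι → Prop) [DecidablePred S] (ζ : ℂ) (p : ι → ℂ) : ι → ℂ :=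
  fun i => if S i then ζ * p i else p i

theorem rot_measurePreserving (S : ι → Prop) [DecidablePred S] {ζ : ℂ} (hζ : ‖ζ‖ = 1) :
    MeasurePreserving (rot S ζ) (volume : Measure (ι → ℂ)) volume := by
  have h : ∀ i, MeasurePreserving (fun z : ℂ => if S i then ζ * z else z) := by
    intro i
    by_cases hi : S i
    · simp only [hi, if_true]
      exact (rotation (⟨ζ, mem_sphere_zero_iff_norm.2 hζ⟩ : Circle)).measurePreserving
    · simp only [hi, if_false]
      exact MeasurePreserving.id _
  exact volume_preserving_pi h

theorem rot_rot (S : ι → Prop) [DecidablePred S] (ζ ξ : ℂ) (p : ι → ℂ) :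
    rot S ζ (rot S ξ p) = rot S (ζ * ξ) p := by
  funext i
  by_cases hi : S i <;> simp [rot, hi, mul_assoc]

theorem rot_one (S : ι → Prop) [DecidablePred S] (p : ι → ℂ) : rot S 1 p = p := by
  funext i
  simp [rot]

theorem continuous_rot (S : ι → Prop) [DecidablePred S] :
    Continuous fun x : ℂ × (ι → ℂ) => rot S x.1 x.2 := by
  refine continuous_pi fun i => ?_
  by_cases hi : S i <;> simp only [rot, hi, if_true, if_false] <;> fun_prop

theorem rot_measurableEmbedding (S : ι → Prop) [DecidablePred S] {ζ : ℂ} (hζ : ‖ζ‖ = 1) :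
    MeasurableEmbedding (rot (ι := ι) S ζ) := by
  have hc : ∀ ξ : ℂ, Continuous (rot (ι := ι) S ξ) := fun ξ =>
    (continuous_rot S).comp (by fun_prop : Continuous fun p : ι → ℂ => (ξ, p))
  have hz : ζ ≠ 0 := norm_ne_zero_iff.1 (by rw [hζ]; norm_num)
  let e : (ι → ℂ) ≃ₜ (ι → ℂ) :=
    { toFun := rot S ζ
      invFun := rot S ζ⁻¹
      left_inv := fun p => by rw [rot_rot, inv_mul_cancel₀ hz, rot_one]
      right_inv := fun p => by rw [rot_rot, mul_inv_cancel₀ hz, rot_one]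
      continuous_toFun := hc _
      continuous_invFun := hc _ }
  exact e.measurableEmbedding

theorem rot_preimage {S : ι → Prop} [DecidablePred S] {Ω : Set (ι → ℂ)}
    (hS : ∀ ζ : ℂ, ‖ζ‖ = 1 → ∀ p ∈ Ω, rot S ζ p ∈ Ω) {ζ : ℂ} (hζ : ‖ζ‖ = 1) :
    rot S ζ ⁻¹' Ω = Ω := by
  ext p
  refine ⟨fun hp => ?_, hS ζ hζ p⟩
  have hz : ζ ≠ 0 := norm_ne_zero_iff.1 (by rw [hζ]; norm_num)
  have := hS ζ⁻¹ (by rw [norm_inv, hζ, inv_one]) _ hp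
  rwa [rot_rot, inv_mul_cancel₀ hz, rot_one] at this

theorem integral_rot {S : ι → Prop} [DecidablePred S] {Ω : Set (ι → ℂ)}
    (hS : ∀ ζ : ℂ, ‖ζ‖ = 1 → ∀ p ∈ Ω, rot S ζ p ∈ Ω) {ζ : ℂ} (hζ : ‖ζ‖ = 1)
    {F : Type*} [NormedAddCommGroup F] [NormedSpace ℝ F] (φ : (ι → ℂ) → F) :
    ∫ p in Ω, φ (rot S ζ p) = ∫ p in Ω, φ p := by
  have := (rot_measurePreserving S hζ).setIntegral_preimage_emb (rot_measurableEmbedding S hζ) φ Ω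
  rwa [rot_preimage hS hζ] at this

theorem integrableOn_rot {S : ι → Prop} [DecidablePred S] {Ω : Set (ι → ℂ)}
    (hS : ∀ ζ : ℂ, ‖ζ‖ = 1 → ∀ p ∈ Ω, rot S ζ p ∈ Ω) {ζ : ℂ} (hζ : ‖ζ‖ = 1)
    {φ : (ι → ℂ) → ℂ} (hφ : IntegrableOn φ Ω) : IntegrableOn (fun p => φ (rot S ζ p)) Ω := by
  have := (rot_measurePreserving S hζ).integrableOn_comp_preimage (rot_measurableEmbedding S hζ)
    (f := φ) (s := Ω)
  rw [rot_preimage hS hζ] at this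
  exact this.2 hφ

/-- Averaging over rotations does not change the integral. -/
theorem integral_circleAverage_rot {S : ι → Prop} [DecidablePred S] {Ω : Set (ι → ℂ)}
    (hΩ : IsOpen Ω) (hS : ∀ ζ : ℂ, ‖ζ‖ = 1 → ∀ p ∈ Ω, rot S ζ p ∈ Ω) {φ : (ι → ℂ) → ℂ}
    (hc : ContinuousOn φ Ω) (hφ : IntegrableOn φ Ω) :
    IntegrableOn (fun p => Real.circleAverage (fun ζ => φ (rot S ζ p)) 0 1) Ω ∧
    ∫ p in Ω, Real.circleAverage (fun ζ => φ (rot S ζ p)) 0 1 = ∫ p in Ω, φ p := by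
  have hn : ∀ θ, ‖circleMap 0 1 θ‖ = 1 := fun θ => by simp
  have hmeas : AEStronglyMeasurable (fun x : (ι → ℂ) × ℝ => φ (rot S (circleMap 0 1 x.2) x.1))
      ((volume.restrict Ω).prod (volume.restrict (Ioc 0 (2 * Real.pi)))) := by
    rw [Measure.prod_restrict]
    refine ContinuousOn.aestronglyMeasurable ?_ (hΩ.measurableSet.prod measurableSet_Ioc)
    refine hc.comp (Continuous.continuousOn ?_) fun x hx => hS _ (hn _) _ hx.1
    exact (continuous_rot S).comp (by fun_prop :
      Continuous fun x : (ι → ℂ) × ℝ => (circleMap 0 1 x.2, x.1))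
  have hint : Integrable (fun x : (ι → ℂ) × ℝ => φ (rot S (circleMap 0 1 x.2) x.1))
      ((volume.restrict Ω).prod (volume.restrict (Ioc 0 (2 * Real.pi)))) := by
    rw [integrable_prod_iff' hmeas]
    refine ⟨Eventually.of_forall fun θ => integrableOn_rot hS (hn θ) hφ, ?_⟩
    have : (fun θ => ∫ p in Ω, ‖φ (rot S (circleMap 0 1 θ) p)‖) = fun _ => ∫ p in Ω, ‖φ p‖ :=
      funext fun θ => integral_rot hS (hn θ) fun p => ‖φ p‖
    simp only [this]
    exact integrable_const _
  have hdef : (fun p => Real.circleAverage (fun ζ => φ (rot S ζ p)) 0 1) = fun p =>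
      (2 * Real.pi)⁻¹ • ∫ θ in Ioc 0 (2 * Real.pi), φ (rot S (circleMap 0 1 θ) p) := by
    funext p
    rw [Real.circleAverage, intervalIntegral.integral_of_le Real.two_pi_pos.le]
  rw [hdef]
  refine ⟨hint.integral_prod_left.smul ((2 * Real.pi)⁻¹), ?_⟩
  rw [integral_smul, integral_integral_swap hint]
  simp only [integral_rot hS (hn _)]
  rw [setIntegral_const, smul_smul, measureReal_def, Real.volume_Ioc, sub_zero,
    ENNReal.toReal_ofReal Real.two_pi_pos.le, inv_mul_cancel₀ Real.two_pi_pos.ne', one_smul]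

end Rotation

/-! ### Geometry of the matrix ball and of the Cartan–Hartogs domain -/

section MatrixBall

variable {α β : Type} [Fintype α] [Fintype β] [DecidableEq α] [DecidableEq β]

theorem isHermitian_one_sub (Z : Matrix α β ℂ) : (1 - Z * Zᴴ).IsHermitian :=
  Matrix.isHermitian_one.sub (Matrix.isHermitian_mul_conjTranspose_self Z)

/-- The two matrices are the Schur complements of the two diagonal blocks in `(1, Z; Zᴴ, 1)`. -/
theorem posSemidef_one_sub_comm (Z : Matrix α β ℂ) :
    (1 - Z * Zᴴ).PosSemidef ↔ (1 - Zᴴ * Z).PosSemidef := by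
  let : Invertible (1 : Matrix α α ℂ) := invertibleOne
  let : Invertible (1 : Matrix β β ℂ) := invertibleOne
  have h1 := Matrix.PosDef.fromBlocks₁₁ Z (1 : Matrix β β ℂ) (Matrix.PosDef.one (n := α) (R := ℂ))
  have h2 := Matrix.PosDef.fromBlocks₂₂ (1 : Matrix α α ℂ) Z (Matrix.PosDef.one (n := β) (R := ℂ))
  rw [h1] at h2
  simpa using h2.symm

theorem det_one_sub_comm (Z : Matrix α β ℂ) : (1 - Z * Zᴴ).det = (1 - Zᴴ * Z).det :=
  Matrix.det_one_sub_mul_comm _ _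

theorem posDef_one_sub_comm (Z : Matrix α β ℂ) :
    (1 - Z * Zᴴ).PosDef ↔ (1 - Zᴴ * Z).PosDef := by
  constructor <;> intro h
  · rw [((posSemidef_one_sub_comm Z).1 h.posSemidef).posDef_iff_det_ne_zero, ← det_one_sub_comm]
    exact h.det_pos.ne'
  · rw [((posSemidef_one_sub_comm Z).2 h.posSemidef).posDef_iff_det_ne_zero, det_one_sub_comm]
    exact h.det_pos.ne'

/-- The complement is the projection of a closed set along the compact unit sphere, hence closed. -/
theorem isOpen_posDef {T : Type*} [TopologicalSpace T] {A : T → Matrix α α ℂ}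
    (hA : Continuous A) (hh : ∀ t, (A t).IsHermitian) : IsOpen {t | (A t).PosDef} := by
  have key : {t | (A t).PosDef}ᶜ = Prod.fst '' {x : T × Metric.sphere (0 : α → ℂ) 1 |
      (star (x.2 : α → ℂ) ⬝ᵥ (A x.1 *ᵥ (x.2 : α → ℂ))).re ≤ 0} := by
    ext t
    simp only [mem_compl_iff, mem_ofPred_eq, mem_image, Prod.exists, exists_and_right,
      exists_eq_right]
    constructor
    · intro h
      by_contra hcon
      push Not at hcon
      refine h (Matrix.PosDef.of_dotProduct_mulVec_pos (hh t) fun x hx => ?_)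
      have hn : ‖x‖ ≠ 0 := norm_ne_zero_iff.2 hx
      have hn0 : 0 < ‖x‖ := norm_pos_iff.2 hx
      have hmem : ((‖x‖⁻¹ : ℝ) : ℂ) • x ∈ Metric.sphere (0 : α → ℂ) 1 := by
        rw [mem_sphere_zero_iff_norm, norm_smul, Complex.norm_real, norm_inv, norm_norm,
          inv_mul_cancel₀ hn]
      have h1 := hcon ⟨_, hmem⟩
      simp only [Matrix.mulVec_smul, star_smul, smul_dotProduct, dotProduct_smul, smul_eq_mul,
        Complex.star_def, Complex.conj_ofReal] at h1
      rw [Complex.re_ofReal_mul, Complex.re_ofReal_mul, ← mul_assoc] at h1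
      refine Complex.pos_iff.2 ⟨pos_of_mul_pos_right h1 (by positivity), ?_⟩
      exact ((hh t).im_star_dotProduct_mulVec_self x).symm
    · rintro ⟨x, hx⟩ h
      have hx0 : (x : α → ℂ) ≠ 0 := ne_zero_of_mem_unit_sphere x
      exact absurd (Complex.pos_iff.1 (h.dotProduct_mulVec_pos hx0)).1 (not_lt.2 hx)
  rw [← isClosed_compl_iff, key]
  refine isClosedMap_fst_of_compactSpace _ (isClosed_le ?_ continuous_const)
  have h1 : Continuous fun x : T × Metric.sphere (0 : α → ℂ) 1 => A x.1 *ᵥ (x.2 : α → ℂ) :=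
    (hA.comp continuous_fst).matrix_mulVec (continuous_subtype_val.comp continuous_snd)
  have h2 : Continuous fun x : T × Metric.sphere (0 : α → ℂ) 1 => star (x.2 : α → ℂ) :=
    (continuous_subtype_val.comp continuous_snd).star
  exact Complex.continuous_re.comp (h2.dotProduct h1)

theorem det_smul_one_add_smul {A : Matrix α α ℂ} (hA : A.IsHermitian) (a b : ℝ) :
    ((a : ℂ) • (1 : Matrix α α ℂ) + (b : ℂ) • A).det = ((∏ i, (a + b * hA.eigenvalues i) : ℝ) : ℂ) := by
  set U : Matrix α α ℂ := (hA.eigenvectorUnitary).1 with hU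
  have hUU : U * star U = 1 := Matrix.mem_unitaryGroup_iff.1 hA.eigenvectorUnitary.2
  have h1 : A = U * Matrix.diagonal (RCLike.ofReal ∘ hA.eigenvalues) * star U := by
    conv_lhs => rw [hA.spectral_theorem]
    rw [Unitary.conjStarAlgAut_apply]
  have h2 : (a : ℂ) • (1 : Matrix α α ℂ) + (b : ℂ) • A =
      U * Matrix.diagonal (fun i => ((a + b * hA.eigenvalues i : ℝ) : ℂ)) * star U := by
    have : Matrix.diagonal (fun i => ((a + b * hA.eigenvalues i : ℝ) : ℂ)) =
        (a : ℂ) • (1 : Matrix α α ℂ) +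
          (b : ℂ) • Matrix.diagonal (RCLike.ofReal ∘ hA.eigenvalues) := by
      ext i j
      by_cases hij : i = j
      · subst hij; simp
      · simp [hij]
    rw [this, Matrix.mul_add, Matrix.add_mul, Matrix.mul_smul, Matrix.smul_mul, Matrix.mul_one, hUU,
      Matrix.mul_smul, Matrix.smul_mul, ← h1]
  rw [h2, Matrix.det_mul, Matrix.det_mul, mul_right_comm, ← Matrix.det_mul, hUU, Matrix.det_one,
    one_mul, Matrix.det_diagonal]
  push_cast
  rfl

theorem eigenvalues_le_one {Z : Matrix α β ℂ} (i : α) :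
    (isHermitian_one_sub Z).eigenvalues i ≤ 1 := by
  have h := (isHermitian_one_sub Z).eigenvalues_eq i
  set v : α → ℂ := ⇑((isHermitian_one_sub Z).eigenvectorBasis i) with hv
  have hvv : star v ⬝ᵥ v = 1 := by
    have h1 := (isHermitian_one_sub Z).eigenvectorBasis.orthonormal.1 i
    have h2 := EuclideanSpace.inner_eq_star_dotProduct
      ((isHermitian_one_sub Z).eigenvectorBasis i) ((isHermitian_one_sub Z).eigenvectorBasis i)
    rw [inner_self_eq_norm_sq_to_K, h1] at h2
    rw [dotProduct_comm]
    simpa using h2.symm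
  rw [h, Matrix.sub_mulVec, Matrix.one_mulVec, dotProduct_sub, hvv]
  have := (Complex.nonneg_iff.1
    ((Matrix.posSemidef_self_mul_conjTranspose Z).dotProduct_mulVec_nonneg v)).1
  simp only [map_sub, map_one, RCLike.re_eq_complex_re, Complex.one_re]
  linarith

theorem one_sub_smul_eq (Z : Matrix α β ℂ) (ζ : ℂ) :
    1 - (ζ • Z) * (ζ • Z)ᴴ = ((1 - ‖ζ‖ ^ 2 : ℝ) : ℂ) • (1 : Matrix α α ℂ) +
      ((‖ζ‖ ^ 2 : ℝ) : ℂ) • (1 - Z * Zᴴ) := by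
  rw [Matrix.conjTranspose_smul, Matrix.smul_mul, Matrix.mul_smul, smul_smul, Complex.star_def,
    Complex.mul_conj, Complex.normSq_eq_norm_sq]
  push_cast
  module

theorem posDef_one_sub_smul {Z : Matrix α β ℂ} (hZ : (1 - Z * Zᴴ).PosDef) {ζ : ℂ} (hζ : ‖ζ‖ ≤ 1) :
    (1 - (ζ • Z) * (ζ • Z)ᴴ).PosDef := by
  rw [one_sub_smul_eq]
  rcases eq_or_ne ζ 0 with rfl | h0
  · simpa using Matrix.PosDef.one
  · have h1 : (0 : ℂ) ≤ ((1 - ‖ζ‖ ^ 2 : ℝ) : ℂ) := by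
      rw [Complex.zero_le_real]; nlinarith [norm_nonneg ζ]
    have h2 : (0 : ℂ) < ((‖ζ‖ ^ 2 : ℝ) : ℂ) := by
      rw [Complex.zero_lt_real]; positivity
    exact Matrix.PosDef.posSemidef_add (Matrix.PosSemidef.one.smul h1) (hZ.smul h2)

/-- Scaling by `ζ` replaces each eigenvalue `λ ≤ 1` of `1 - Z Zᴴ` by the convex combination `(1 -
|ζ|²) + |ζ|² λ`, which is at least `λ`. -/
theorem det_one_sub_le_smul {Z : Matrix α β ℂ} (hZ : (1 - Z * Zᴴ).PosDef) {ζ : ℂ} (hζ : ‖ζ‖ ≤ 1) :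
    (1 - Z * Zᴴ).det.re ≤ (1 - (ζ • Z) * (ζ • Z)ᴴ).det.re := by
  have h0 := det_smul_one_add_smul (isHermitian_one_sub Z) 0 1
  simp only [Complex.ofReal_zero, zero_smul, zero_add, Complex.ofReal_one, one_smul, one_mul] at h0
  rw [one_sub_smul_eq, det_smul_one_add_smul (isHermitian_one_sub Z), h0, Complex.ofReal_re,
    Complex.ofReal_re]
  have hs : ‖ζ‖ ^ 2 ≤ 1 := by nlinarith [norm_nonneg ζ]
  refine Finset.prod_le_prod (fun i _ => (hZ.eigenvalues_pos i).le) fun i _ => ?_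
  have := eigenvalues_le_one (Z := Z) i
  nlinarith

theorem det_one_sub_re_le_one {Z : Matrix α β ℂ} (hZ : (1 - Z * Zᴴ).PosDef) :
    (1 - Z * Zᴴ).det.re ≤ 1 := by
  have := det_one_sub_le_smul hZ (ζ := 0) (by simp)
  simpa using this

theorem sum_normSq_row_lt_one {Z : Matrix α β ℂ} (hZ : (1 - Z * Zᴴ).PosDef) (i : α) :
    ∑ j, ‖Z i j‖ ^ 2 < 1 := by
  have h := (Complex.pos_iff.1 (hZ.diag_pos (i := i))).1
  simp only [Matrix.sub_apply, Matrix.one_apply_eq, Matrix.mul_apply, Matrix.conjTranspose_apply,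
    Complex.star_def, Complex.mul_conj, Complex.normSq_eq_norm_sq] at h
  rw [← Complex.ofReal_sum, Complex.sub_re, Complex.one_re, Complex.ofReal_re] at h
  linarith

end MatrixBall

/-! ### The domain `Y_I`: open, bounded, stable under contractions -/

section Domain

variable {N m n : ℕ} {K : ℝ}

theorem continuous_matZ : Continuous (matZ : (Idx N m n → ℂ) → Matrix (Fin m) (Fin n) ℂ) :=
  continuous_pi fun _ => continuous_pi fun _ => continuous_apply _

theorem genNorm_pos {p : Idx N m n → ℂ} (hp : matZ p ∈ cartanI m n) : 0 < genNorm p :=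
  (Complex.pos_iff.1 (Matrix.PosDef.det_pos hp)).1

theorem genNorm_le_one {p : Idx N m n → ℂ} (hp : matZ p ∈ cartanI m n) : genNorm p ≤ 1 :=
  det_one_sub_re_le_one hp

theorem normSqW_nonneg (p : Idx N m n → ℂ) : 0 ≤ normSqW p := by
  unfold normSqW; positivity

theorem continuous_one_sub {α β T : Type*} [Fintype α] [Fintype β] [DecidableEq α]
    [TopologicalSpace T] {Z : T → Matrix α β ℂ} (hZ : Continuous Z) :
    Continuous fun t => 1 - Z t * (Z t)ᴴ :=
  continuous_const.sub (hZ.matrix_mul hZ.matrix_conjTranspose)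

theorem isOpen_domainY (hK : 0 < K) : IsOpen (domainY N m n K) := by
  have h1 := isOpen_posDef (continuous_one_sub (continuous_matZ (N := N) (m := m) (n := n)))
    fun t => isHermitian_one_sub _
  refine h1.inter (isOpen_lt (f := fun p => normSqW p ^ K) (g := genNorm) ?_ ?_)
  · have : Continuous (normSqW : (Idx N m n → ℂ) → ℝ) := by unfold normSqW; fun_prop
    exact this.rpow_const fun _ => Or.inr hK.le
  · exact Complex.continuous_re.comp ((continuous_one_sub continuous_matZ).matrix_det)

theorem normSqW_lt {p : Idx N m n → ℂ} (hK : 0 < K) (hp : p ∈ domainY N m n K) :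
    normSqW p < 1 := by
  by_contra h
  have h1 := Real.one_le_rpow (not_lt.1 h) hK.le
  have := hp.2
  have := genNorm_le_one hp.1
  linarith

theorem norm_inl_lt {p : Idx N m n → ℂ} (hK : 0 < K) (hp : p ∈ domainY N m n K) (j : Fin N) :
    ‖p (Sum.inl j)‖ < 1 := by
  have h1 : ‖p (Sum.inl j)‖ ^ 2 ≤ normSqW p :=
    Finset.single_le_sum (f := fun j => ‖p (Sum.inl j)‖ ^ 2) (fun _ _ => by positivity)
      (Finset.mem_univ j)
  have h2 := normSqW_lt hK hp
  nlinarith [norm_nonneg (p (Sum.inl j))]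

theorem norm_inr_lt {p : Idx N m n → ℂ} (hp : matZ p ∈ cartanI m n) (i : Fin m × Fin n) :
    ‖p (Sum.inr i)‖ < 1 := by
  have h1 : ‖p (Sum.inr i)‖ ^ 2 ≤ ∑ j, ‖matZ p i.1 j‖ ^ 2 :=
    Finset.single_le_sum (f := fun j => ‖matZ p i.1 j‖ ^ 2) (fun _ _ => by positivity)
      (Finset.mem_univ i.2)
  have h2 := sum_normSq_row_lt_one hp i.1
  nlinarith [norm_nonneg (p (Sum.inr i))]

theorem domainY_subset_ball (hK : 0 < K) : domainY N m n K ⊆ Metric.closedBall 0 1 := by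
  intro p hp
  rw [mem_closedBall_zero_iff, pi_norm_le_iff_of_nonneg zero_le_one]
  rintro (j | i)
  · exact (norm_inl_lt hK hp j).le
  · exact (norm_inr_lt hp.1 i).le

theorem volume_domainY_lt_top (hK : 0 < K) : volume (domainY N m n K) < ⊤ :=
  (measure_mono (domainY_subset_ball hK)).trans_lt
    (isCompact_closedBall (0 : Idx N m n → ℂ) 1).measure_lt_top

theorem mem_domainY_of_contraction {p q : Idx N m n → ℂ} (hK : 0 < K) (hp : p ∈ domainY N m n K)
    {ζ : ℂ} (hζ : ‖ζ‖ ≤ 1) (hW : ∀ j, ‖q (Sum.inl j)‖ ≤ ‖p (Sum.inl j)‖)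
    (hZ : matZ q = ζ • matZ p) : q ∈ domainY N m n K := by
  refine ⟨?_, ?_⟩
  · show (1 - matZ q * (matZ q)ᴴ).PosDef
    rw [hZ]
    exact posDef_one_sub_smul hp.1 hζ
  · have h1 : normSqW q ≤ normSqW p := Finset.sum_le_sum fun j _ => by gcongr; exact hW j
    have h2 : genNorm p ≤ genNorm q := by
      unfold genNorm
      rw [hZ]
      exact det_one_sub_le_smul hp.1 hζ
    exact ((Real.rpow_le_rpow (normSqW_nonneg q) h1 hK.le).trans_lt hp.2).trans_le h2

end Domain

/-! ### Integrals of powers over balls -/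

open scoped ENNReal

/-- The truncated power `x₊ ^ a` as an extended nonnegative real. -/
def truncPow (x a : ℝ) : ℝ≥0∞ := if 0 < x then ENNReal.ofReal (x ^ a) else 0

theorem measurable_truncPow (a : ℝ) : Measurable fun x => truncPow x a :=
  Measurable.ite measurableSet_Ioi (by fun_prop) measurable_const

@[fun_prop]
theorem measurable_truncPow_comp {α : Type*} [MeasurableSpace α] {f : α → ℝ} (hf : Measurable f)
    (a : ℝ) : Measurable fun x => truncPow (f x) a := (measurable_truncPow a).comp hf

theorem integral_normSq (f : ℝ → ℝ) :
    ∫ z : ℂ, f (‖z‖ ^ 2) = Real.pi * ∫ t in Ioi (0 : ℝ), f t := by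
  have h := integral_fun_norm_addHaar (volume : Measure ℂ) fun r => f (r ^ 2)
  have h2 := integral_comp_rpow_Ioi_of_pos (g := f) (p := 2) two_pos
  have hb : (volume : Measure ℂ).real (Metric.ball 0 1) = Real.pi := by
    rw [Measure.real, Complex.volume_ball]
    simp
  rw [h, hb, ← h2, Complex.finrank_real_complex, ← integral_const_mul]
  simp only [smul_eq_mul, nsmul_eq_mul]
  rw [← integral_const_mul, ← integral_const_mul]
  refine setIntegral_congr_fun measurableSet_Ioi fun x _ => ?_
  norm_num
  ring

theorem integral_pow_mul_rpow {c a : ℝ} (hc : 0 < c) (ha : 0 ≤ a) (k : ℕ) :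
    ∫ t in (0 : ℝ)..c, t ^ k * (c - t) ^ a =
      c ^ (a + k + 1) * (k.factorial / ∏ j ∈ Finset.range (k + 1), (a + 1 + j)) := by
  have h := Complex.betaIntegral_scaled ((k : ℂ) + 1) ((a : ℂ) + 1) hc
  have h2 : Complex.betaIntegral ((k : ℂ) + 1) ((a : ℂ) + 1) =
      k.factorial / ∏ j ∈ Finset.range (k + 1), ((a : ℂ) + 1 + j) := by
    rw [Complex.betaIntegral_symm]
    exact Complex.betaIntegral_eval_nat_add_one_right (by simp; linarith) k
  rw [h2] at h
  have h3 : (∫ x in (0 : ℝ)..c, (x : ℂ) ^ ((k : ℂ) + 1 - 1) * ((c : ℂ) - x) ^ ((a : ℂ) + 1 - 1)) =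
      ∫ x in (0 : ℝ)..c, ((x ^ k * (c - x) ^ a : ℝ) : ℂ) := by
    refine intervalIntegral.integral_congr fun x hx => ?_
    rw [uIcc_of_le hc.le] at hx
    simp only [add_sub_cancel_right]
    rw [Complex.cpow_natCast, ← Complex.ofReal_sub, ← Complex.ofReal_cpow (by linarith [hx.2])]
    push_cast
    rfl
  rw [h3, intervalIntegral.integral_ofReal, show (k : ℂ) + 1 + ((a : ℂ) + 1) - 1 =
    ((a + k + 1 : ℝ) : ℂ) by push_cast; ring, ← Complex.ofReal_cpow hc.le] at h
  exact_mod_cast h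

theorem lintegral_truncPow (k : ℕ) {a : ℝ} (ha : 0 ≤ a) (c : ℝ) :
    ∫⁻ z : ℂ, ENNReal.ofReal (‖z‖ ^ (2 * k)) * truncPow (c - ‖z‖ ^ 2) a =
      ENNReal.ofReal (Real.pi * (k.factorial / ∏ j ∈ Finset.range (k + 1), (a + 1 + j))) *
        truncPow c (a + k + 1) := by
  by_cases hc : 0 < c
  swap
  · have : ∀ z : ℂ, truncPow (c - ‖z‖ ^ 2) a = 0 := fun z => by
      rw [truncPow, if_neg (by nlinarith [sq_nonneg ‖z‖])]
    simp only [this, mul_zero, lintegral_zero]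
    rw [truncPow, if_neg hc, mul_zero]
  set f : ℝ → ℝ := (Iio c).indicator fun t => t ^ k * (c - t) ^ a with hf
  have h1 : ∀ z : ℂ, ENNReal.ofReal (‖z‖ ^ (2 * k)) * truncPow (c - ‖z‖ ^ 2) a =
      ENNReal.ofReal (f (‖z‖ ^ 2)) := by
    intro z
    rw [truncPow, hf]
    by_cases hz : ‖z‖ ^ 2 < c
    · rw [if_pos (by linarith), indicator_of_mem (mem_Iio.2 hz), ← ENNReal.ofReal_mul (by positivity),
        pow_mul]
    · rw [if_neg (by linarith), indicator_of_notMem (by simpa using hz)]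
      simp
  have hnn : ∀ t, 0 ≤ t → 0 ≤ f t := fun t ht => by
    by_cases h : t < c
    · rw [hf, indicator_of_mem (mem_Iio.2 h)]
      have : 0 ≤ c - t := by linarith
      positivity
    · rw [hf, indicator_of_notMem (by simpa using h)]
  have hint : Integrable fun z : ℂ => f (‖z‖ ^ 2) := by
    have hm : Measurable fun z : ℂ => f (‖z‖ ^ 2) :=
      (Measurable.indicator (by fun_prop) measurableSet_Iio).comp (by fun_prop)
    refine IntegrableOn.integrable_of_forall_notMem_eq_zero (s := Metric.closedBall 0 √c)
      (Measure.integrableOn_of_bounded (M := c ^ k * c ^ a) measure_closedBall_lt_top.ne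
        hm.aestronglyMeasurable (ae_of_all _ fun z => ?_)) fun z hz => ?_
    · rw [Real.norm_of_nonneg (hnn _ (by positivity)), hf]
      by_cases h : ‖z‖ ^ 2 < c
      · rw [indicator_of_mem (mem_Iio.2 h)]
        have : 0 ≤ c - ‖z‖ ^ 2 := by linarith
        have h5 : c - ‖z‖ ^ 2 ≤ c := by nlinarith [sq_nonneg ‖z‖]
        gcongr
      · rw [indicator_of_notMem (by simpa using h)]
        positivity
    · rw [mem_closedBall_zero_iff, Real.le_sqrt (norm_nonneg z) hc.le, not_le] at hz
      rw [hf, indicator_of_notMem (by simpa using hz.le)]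
  simp only [h1]
  rw [← ofReal_integral_eq_lintegral_ofReal hint (ae_of_all _ fun z => hnn _ (by positivity)),
    integral_normSq]
  have h2 : ∫ t in Ioi (0 : ℝ), f t = ∫ t in (0 : ℝ)..c, t ^ k * (c - t) ^ a := by
    rw [hf, setIntegral_indicator measurableSet_Iio, intervalIntegral.integral_of_le hc.le,
      Ioi_inter_Iio, integral_Ioc_eq_integral_Ioo]
  rw [h2, integral_pow_mul_rpow hc ha, truncPow, if_pos hc, ← ENNReal.ofReal_mul (by positivity)]
  congr 1
  ring

theorem lintegral_fin_succ {n : ℕ} (f : (Fin (n + 1) → ℂ) → ℝ≥0∞) (hf : Measurable f) :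
    ∫⁻ y, f y = ∫⁻ z : ℂ, ∫⁻ y : Fin n → ℂ, f (Fin.cons z y) := by
  have h := (volume_preserving_piFinSuccAbove (fun _ : Fin (n + 1) => ℂ) 0).symm
  rw [← h.lintegral_comp hf, Measure.volume_eq_prod, lintegral_prod _ (by fun_prop)]
  simp [MeasurableEquiv.piFinSuccAbove, Fin.insertNthEquiv]

theorem lintegral_fin_succ' {n : ℕ} (f : (Fin (n + 1) → ℂ) → ℝ≥0∞) (hf : Measurable f) :
    ∫⁻ y, f y = ∫⁻ y : Fin n → ℂ, ∫⁻ z : ℂ, f (Fin.cons z y) := by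
  have h := (volume_preserving_piFinSuccAbove (fun _ : Fin (n + 1) => ℂ) 0).symm
  rw [← h.lintegral_comp hf, Measure.volume_eq_prod, lintegral_prod_symm _ (by fun_prop)]
  simp [MeasurableEquiv.piFinSuccAbove, Fin.insertNthEquiv]

/-- Integrating out one complex coordinate yields the factor `π/(s+1)` and raises the exponent from
`s` to `s + 1`. -/
theorem lintegral_truncPow_pi (n : ℕ) : ∀ {s : ℝ}, 0 ≤ s → ∀ c : ℝ,
    ∫⁻ y : Fin n → ℂ, truncPow (c - ∑ i, ‖y i‖ ^ 2) s =
      ENNReal.ofReal (Real.pi ^ n / ∏ j ∈ Finset.range n, (s + j + 1)) * truncPow c (s + n) := by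
  induction n with
  | zero =>
    intro s hs c
    rw [lintegral_unique]
    simp [volume_pi]
  | succ n ih =>
    intro s hs c
    have hm : Measurable fun y : Fin (n + 1) → ℂ => truncPow (c - ∑ i, ‖y i‖ ^ 2) s :=
      by fun_prop
    rw [lintegral_fin_succ' _ hm]
    have h1 := fun y : Fin n → ℂ => lintegral_truncPow 0 hs (c - ∑ i, ‖y i‖ ^ 2)
    simp only [mul_zero, pow_zero, ENNReal.ofReal_one, one_mul, Nat.factorial_zero, Nat.cast_one,
      zero_add, Finset.prod_range_one, Nat.cast_zero, add_zero] at h1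
    have h2 : ∀ y : Fin n → ℂ, ∫⁻ z : ℂ, truncPow (c - ∑ i, ‖(Fin.cons z y : Fin (n + 1) → ℂ) i‖ ^ 2) s =
        ENNReal.ofReal (Real.pi * (1 / (s + 1))) * truncPow (c - ∑ i, ‖y i‖ ^ 2) (s + 1) := by
      intro y
      rw [← h1]
      simp only [Fin.sum_univ_succ, Fin.cons_zero, Fin.cons_succ]
      refine lintegral_congr fun z => ?_
      congr 1
      ring
    simp only [h2]
    rw [lintegral_const_mul _ (by fun_prop), ih (by linarith),
      ← mul_assoc, ← ENNReal.ofReal_mul (by positivity)]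
    congr 2
    · rw [Finset.prod_range_succ']
      have : ∀ j : ℕ, s + 1 + j + 1 = s + ((j + 1 : ℕ) : ℝ) + 1 := fun j => by push_cast; ring
      simp only [this]
      have h3 : 0 < ∏ k ∈ Finset.range n, (s + ((k + 1 : ℕ) : ℝ) + 1) :=
        Finset.prod_pos fun k _ => by positivity
      simp only [Nat.cast_zero, add_zero]
      field_simp
      ring
    · push_cast
      ring

/-- The exponent 0 turns the truncated power into the indicator of the ball `|W|² < c`. The `N`
coordinates other than `W₀` are integrated first, which leaves a Beta integral in `W₀`. -/
theorem lintegral_moment (N k : ℕ) (c : ℝ) :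
    ∫⁻ W : Fin (N + 1) → ℂ, ENNReal.ofReal (‖W 0‖ ^ (2 * k)) * truncPow (c - ∑ i, ‖W i‖ ^ 2) 0 =
      ENNReal.ofReal (Real.pi ^ (N + 1) / ∏ l ∈ Finset.range (N + 1), ((k : ℝ) + 1 + l)) *
        truncPow c ((N + 1 : ℕ) + k) := by
  have hm : Measurable fun W : Fin (N + 1) → ℂ =>
      ENNReal.ofReal (‖W 0‖ ^ (2 * k)) * truncPow (c - ∑ i, ‖W i‖ ^ 2) 0 := by fun_prop
  rw [lintegral_fin_succ _ hm]
  have h2 : ∀ z : ℂ, ∫⁻ y : Fin N → ℂ, ENNReal.ofReal (‖(Fin.cons z y : Fin (N + 1) → ℂ) 0‖ ^ (2 * k)) *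
      truncPow (c - ∑ i, ‖(Fin.cons z y : Fin (N + 1) → ℂ) i‖ ^ 2) 0 =
      ENNReal.ofReal (Real.pi ^ N / N.factorial) * (ENNReal.ofReal (‖z‖ ^ (2 * k)) * truncPow (c - ‖z‖ ^ 2) N) := by
    intro z
    simp only [Fin.sum_univ_succ, Fin.cons_zero, Fin.cons_succ]
    have h3 : Measurable fun y : Fin N → ℂ => truncPow (c - (‖z‖ ^ 2 + ∑ i, ‖y i‖ ^ 2)) 0 :=
      by fun_prop
    rw [lintegral_const_mul _ h3]
    simp only [← sub_sub]
    rw [lintegral_truncPow_pi N le_rfl, mul_left_comm]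
    congr 2
    · congr 2
      rw [← Finset.prod_range_add_one_eq_factorial]
      push_cast
      simp
    · simp
  simp only [h2]
  rw [lintegral_const_mul _ (by fun_prop),
    lintegral_truncPow k (by positivity), ← mul_assoc, ← ENNReal.ofReal_mul (by positivity)]
  congr 2
  -- Both constants are `π^(N+1) k! / (N+k+1)!`; the two ways of writing the factorial quotient are
  -- compared through binomial coefficients.
  · have h1 : ∏ j ∈ Finset.range (k + 1), ((N : ℝ) + 1 + j) = (k + 1).factorial * (N + (k + 1)).choose (k + 1) :=
      prod_range_add_one_eq N (k + 1)
    have h2 := prod_range_add_one_eq k (N + 1)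
    rw [h1, h2]
    have h3 := Nat.add_choose_mul_factorial_mul_factorial N (k + 1)
    have h4 := Nat.add_choose_mul_factorial_mul_factorial k (N + 1)
    rw [show N + (k + 1) = k + (N + 1) by ring, ← h4] at h3
    rw [show N + (k + 1) = k + (N + 1) by ring]
    have h5 : (((k + (N + 1)).choose (k + 1) * N.factorial * (k + 1).factorial : ℕ) : ℝ) =
      (((k + (N + 1)).choose (N + 1) * k.factorial * (N + 1).factorial : ℕ) : ℝ) := by
      rw [h3]
    have h6 : 0 < (k + (N + 1)).choose (k + 1) := Nat.choose_pos (by omega)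
    have h7 : 0 < (k + (N + 1)).choose (N + 1) := Nat.choose_pos (by omega)
    push_cast at h5
    field_simp
    linear_combination (-Real.pi ^ (N + 1)) * h5
  · push_cast
    ring


open scoped ENNReal

/-! ### Hua's integral -/

theorem lintegral_vecMul {n : ℕ} {B : Matrix (Fin n) (Fin n) ℂ} (hB : B.det ≠ 0)
    (f : (Fin n → ℂ) → ℝ≥0∞) (hf : Measurable f) :
    ∫⁻ z, f z = ENNReal.ofReal (‖B.det‖ ^ 2) * ∫⁻ y, f (y ᵥ* B) := by
  set L : (Fin n → ℂ) →ₗ[ℝ] (Fin n → ℂ) := (Matrix.toLin' Bᵀ).restrictScalars ℝ with hL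
  have hdet : LinearMap.det L = ‖B.det‖ ^ 2 := by
    rw [hL, LinearMap.det_restrictScalars, Algebra.norm_complex_apply, LinearMap.det_toLin',
      Matrix.det_transpose, Complex.normSq_eq_norm_sq]
  have hne : ‖B.det‖ ^ 2 ≠ 0 := pow_ne_zero _ (norm_ne_zero_iff.2 hB)
  have h1 := Measure.map_linearMap_addHaar_eq_smul_addHaar (volume : Measure (Fin n → ℂ))
    (f := L) (by rw [hdet]; exact hne)
  have hLc : Continuous L := L.continuous_of_finiteDimensional
  have h2 : ∫⁻ y, f (L y) = ENNReal.ofReal |(LinearMap.det L)⁻¹| * ∫⁻ z, f z := by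
    rw [← lintegral_map hf hLc.measurable, h1, lintegral_smul_measure, smul_eq_mul]
  have h3 : ∀ y, L y = y ᵥ* B := fun y => by
    rw [hL, LinearMap.restrictScalars_apply, Matrix.toLin'_apply, Matrix.mulVec_transpose]
  simp only [h3] at h2
  rw [h2, ← mul_assoc, ← ENNReal.ofReal_mul (by positivity), hdet, abs_of_nonneg (by positivity),
    mul_inv_cancel₀ hne, ENNReal.ofReal_one, one_mul]

open Classical in
/-- `det (A) ^ s` for positive definite `A`, extended by zero. -/
def detPow {α : Type} [Fintype α] [DecidableEq α] (A : Matrix α α ℂ) (s : ℝ) : ℝ≥0∞ :=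
  if A.PosDef then ENNReal.ofReal (A.det.re ^ s) else 0

theorem measurable_detPow {α T : Type} [Fintype α] [DecidableEq α] [TopologicalSpace T]
    [MeasurableSpace T] [OpensMeasurableSpace T] {A : T → Matrix α α ℂ} (hA : Continuous A)
    (hh : ∀ t, (A t).IsHermitian) (s : ℝ) : Measurable fun t => detPow (A t) s := by
  classical
  have h : Continuous fun t => (A t).det.re := Complex.continuous_re.comp hA.matrix_det
  exact Measurable.ite (isOpen_posDef hA hh).measurableSet
    (h.measurable.pow_const s).ennreal_ofReal measurable_const

theorem detPow_rank_one {n : ℕ} (y : Fin n → ℂ) (s : ℝ) :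
    detPow (1 - Matrix.vecMulVec (star y) y) s = truncPow (1 - ∑ i, ‖y i‖ ^ 2) s := by
  set Z : Matrix Unit (Fin n) ℂ := Matrix.of fun _ => y with hZ
  have h1 : Zᴴ * Z = Matrix.vecMulVec (star y) y := by
    ext i j
    simp [Matrix.mul_apply, hZ, Matrix.vecMulVec_apply]
  have h2 : (1 - Z * Zᴴ) = ((1 - ∑ i, ‖y i‖ ^ 2 : ℝ) : ℂ) • (1 : Matrix Unit Unit ℂ) := by
    ext i j
    simp [Matrix.mul_apply, hZ, Complex.mul_conj']
  have h3 : (1 - Z * Zᴴ).PosDef ↔ 0 < 1 - ∑ i, ‖y i‖ ^ 2 := by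
    rw [h2]
    constructor
    · intro h
      have := h.det_pos
      simp only [Matrix.det_unique, Matrix.smul_apply, Matrix.one_apply_eq, smul_eq_mul, mul_one] at this
      exact_mod_cast this
    · intro h
      exact Matrix.PosDef.one.smul (by exact_mod_cast h)
  rw [detPow, truncPow, ← h1]
  have h4 : (1 - Zᴴ * Z).det.re = 1 - ∑ i, ‖y i‖ ^ 2 := by
    rw [← det_one_sub_comm, h2, Matrix.det_unique, Matrix.smul_apply, Matrix.one_apply_eq,
      smul_eq_mul, mul_one, Complex.ofReal_re]
  rw [h4]
  congr 1
  rw [← posDef_one_sub_comm, h3]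

open scoped MatrixOrder Matrix.Norms.L2Operator in
theorem exists_eq_conjTranspose_mul_self {α : Type} [Fintype α] [DecidableEq α] {A : Matrix α α ℂ}
    (hA : A.PosSemidef) : ∃ B : Matrix α α ℂ, A = Bᴴ * B :=
  CStarAlgebra.nonneg_iff_eq_star_mul_self.1 hA.nonneg

/-- Write `A = Bᴴ B` and substitute `z = y B`: the matrix becomes `Bᴴ (1 - y* y) B`, a rank-one
problem over the ball. The Jacobian `|det B|² = det A` raises the exponent by one. If `A` is not
positive definite, neither is `A - z* z`. -/
theorem lintegral_detPow_sub {n : ℕ} (A : Matrix (Fin n) (Fin n) ℂ) (hA : A.IsHermitian) {s : ℝ}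
    (hs : 0 ≤ s) :
    ∫⁻ z : Fin n → ℂ, detPow (A - Matrix.vecMulVec (star z) z) s =
      ENNReal.ofReal (Real.pi ^ n / ∏ j ∈ Finset.range n, (s + j + 1)) * detPow A (s + 1) := by
  by_cases hp : A.PosDef
  swap
  · have : ∀ z : Fin n → ℂ, detPow (A - Matrix.vecMulVec (star z) z) s = 0 := fun z => by
      rw [detPow, if_neg]
      intro h
      apply hp
      have h2 := h.add_posSemidef (Matrix.posSemidef_vecMulVec_star_self z)
      rwa [sub_add_cancel] at h2
    simp only [this, lintegral_zero]
    rw [detPow, if_neg hp, mul_zero]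
  obtain ⟨B, hB⟩ : ∃ B : Matrix (Fin n) (Fin n) ℂ, A = Bᴴ * B :=
    exists_eq_conjTranspose_mul_self hp.posSemidef
  have hdet : A.det = ((‖B.det‖ ^ 2 : ℝ) : ℂ) := by
    rw [hB, Matrix.det_mul, Matrix.det_conjTranspose, Complex.star_def, Complex.conj_mul']
    push_cast; rfl
  have hBd : B.det ≠ 0 := fun h => by
    have := hp.det_pos
    rw [hdet, h] at this
    simp at this
  have hm : Measurable fun z : Fin n → ℂ => detPow (A - Matrix.vecMulVec (star z) z) s := by
    refine measurable_detPow ?_ (fun z => hA.sub ?_) s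
    · refine continuous_const.sub ?_
      exact Continuous.matrix_vecMulVec continuous_star continuous_id
    · exact (Matrix.posSemidef_vecMulVec_star_self z).1
  rw [lintegral_vecMul hBd _ hm]
  have key : ∀ y : Fin n → ℂ, detPow (A - Matrix.vecMulVec (star (y ᵥ* B)) (y ᵥ* B)) s =
      ENNReal.ofReal ((‖B.det‖ ^ 2) ^ s) * truncPow (1 - ∑ i, ‖y i‖ ^ 2) s := by
    intro y
    have h1 : A - Matrix.vecMulVec (star (y ᵥ* B)) (y ᵥ* B) =
        Bᴴ * (1 - Matrix.vecMulVec (star y) y) * B := by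
      rw [hB, mul_sub, sub_mul, mul_one, Matrix.star_vecMul, Matrix.mul_vecMulVec,
        Matrix.vecMulVec_mul]
    have h2 : (A - Matrix.vecMulVec (star (y ᵥ* B)) (y ᵥ* B)).PosDef ↔
        (1 - Matrix.vecMulVec (star y) y).PosDef := by
      rw [h1]
      exact Matrix.IsUnit.posDef_star_left_conjugate_iff
        ((Matrix.isUnit_iff_isUnit_det B).2 (isUnit_iff_ne_zero.2 hBd))
    have h3 : (A - Matrix.vecMulVec (star (y ᵥ* B)) (y ᵥ* B)).det.re =
        ‖B.det‖ ^ 2 * (1 - Matrix.vecMulVec (star y) y).det.re := by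
      rw [h1, Matrix.det_mul, Matrix.det_mul, mul_right_comm, ← Matrix.det_mul, ← hB, hdet,
        Complex.re_ofReal_mul]
    rw [← detPow_rank_one, detPow, detPow, h3]
    by_cases h4 : (1 - Matrix.vecMulVec (star y) y).PosDef
    · rw [if_pos (h2.2 h4), if_pos h4, Real.mul_rpow (by positivity) (Complex.pos_iff.1 h4.det_pos).1.le,
        ENNReal.ofReal_mul (by positivity)]
    · rw [if_neg (mt h2.1 h4), if_neg h4, mul_zero]
  simp only [key]
  rw [lintegral_const_mul _ (by fun_prop), lintegral_truncPow_pi n hs 1, detPow, if_pos hp, hdet,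
    truncPow, if_pos one_pos, Real.one_rpow, ENNReal.ofReal_one, mul_one, ← mul_assoc,
    ← ENNReal.ofReal_mul (by positivity), mul_comm, Complex.ofReal_re,
    Real.rpow_add_one (pow_ne_zero _ (norm_ne_zero_iff.2 hBd)), mul_comm (_ ^ s)]

theorem lintegral_sum_index {κ κ' : Type} [Fintype κ] [Fintype κ'] (f : (κ ⊕ κ' → ℂ) → ℝ≥0∞)
    (hf : Measurable f) :
    ∫⁻ p, f p = ∫⁻ z : κ' → ℂ, ∫⁻ y : κ → ℂ, f (Sum.elim y z) := by
  have hmp := volume_measurePreserving_sumPiEquivProdPi_symm (fun _ : κ ⊕ κ' => ℂ)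
  rw [← hmp.lintegral_comp hf, Measure.volume_eq_prod, lintegral_prod_symm _ (by fun_prop)]
  refine lintegral_congr fun z => lintegral_congr fun y => congrArg f ?_
  funext i
  cases i <;> rfl

theorem lintegral_reindex {κ κ' : Type} [Fintype κ] [Fintype κ'] (e : κ ≃ κ')
    (f : (κ' → ℂ) → ℝ≥0∞) (hf : Measurable f) :
    ∫⁻ z, f z = ∫⁻ y : κ → ℂ, f (fun k => y (e.symm k)) := by
  rw [← (volume_measurePreserving_piCongrLeft (fun _ => ℂ) e).lintegral_comp hf]
  refine lintegral_congr fun y => congrArg f ?_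
  funext k
  obtain ⟨a, rfl⟩ := e.surjective k
  rw [e.symm_apply_apply, MeasurableEquiv.piCongrLeft_apply_apply]

/-- Hua's integral over the Cartan domain of the first type. -/
theorem lintegral_detPow (n : ℕ) (m : ℕ) : ∀ {s : ℝ}, 0 ≤ s →
    ∫⁻ z : Fin m × Fin n → ℂ, detPow (1 - (Matrix.of fun i j => z (i, j))ᴴ *
      (Matrix.of fun i j => z (i, j))) s =
    ENNReal.ofReal (Real.pi ^ (m * n) / ∏ p : Fin m × Fin n, (s + ((p.1 : ℕ) + (p.2 : ℕ) + 1))) := by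
  have hm : ∀ (m : ℕ) (s : ℝ), Measurable fun z : Fin m × Fin n → ℂ =>
      detPow (1 - (Matrix.of fun i j => z (i, j))ᴴ * (Matrix.of fun i j => z (i, j))) s := by
    intro m s
    refine measurable_detPow (continuous_const.sub ?_)
      (fun z => Matrix.isHermitian_one.sub (Matrix.isHermitian_conjTranspose_mul_self _)) s
    have : Continuous fun z : Fin m × Fin n → ℂ => Matrix.of fun i j => z (i, j) :=
      continuous_matrix fun i j => continuous_apply _
    exact this.matrix_conjTranspose.matrix_mul this
  induction m with
  | zero =>
    intro s hs
    rw [lintegral_unique]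
    simp [volume_pi, detPow, Matrix.PosDef.one]
  | succ m ih =>
    intro s hs
    -- The first row `y` is split off: `Zᴴ Z` is the same product for the remaining rows plus `y*
    -- y`. In the form `1 - Zᴴ Z` the size of the matrix does not change with the number of rows.
    let e : Fin n ⊕ (Fin m × Fin n) ≃ Fin (m + 1) × Fin n :=
      Equiv.ofBijective (Sum.elim (fun j => (0, j)) fun p => (p.1.succ, p.2)) <| by
        refine ⟨?_, ?_⟩
        · rintro (j | ⟨i, j⟩) (j' | ⟨i', j'⟩) h <;> simp_all
          exact (Fin.succ_ne_zero _ h.1.symm).elim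
        · rintro ⟨i, j⟩
          refine Fin.cases ⟨Sum.inl j, rfl⟩ (fun i => ⟨Sum.inr (i, j), rfl⟩) i
    have he1 : ∀ j, e.symm (0, j) = Sum.inl j := fun j => e.symm_apply_eq.2 rfl
    have he2 : ∀ i j, e.symm (Fin.succ i, j) = Sum.inr (i, j) := fun i j => e.symm_apply_eq.2 rfl
    rw [lintegral_reindex e _ (hm (m + 1) s), lintegral_sum_index (fun y => detPow
        (1 - (Matrix.of fun i j => y (e.symm (i, j)))ᴴ * (Matrix.of fun i j => y (e.symm (i, j)))) s)
      ((hm (m + 1) s).comp (f := fun (y : Fin n ⊕ Fin m × Fin n → ℂ) k => y (e.symm k)) (by fun_prop))]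
    have h1 : ∀ (z : Fin m × Fin n → ℂ) (y : Fin n → ℂ),
        1 - (Matrix.of fun (i : Fin (m + 1)) (j : Fin n) => (Sum.elim y z) (e.symm (i, j)))ᴴ *
          (Matrix.of fun (i : Fin (m + 1)) (j : Fin n) => (Sum.elim y z) (e.symm (i, j))) =
        (1 - (Matrix.of fun i j => z (i, j))ᴴ * (Matrix.of fun i j => z (i, j))) -
          Matrix.vecMulVec (star y) y := by
      intro z y
      ext i j
      simp only [Matrix.sub_apply, Matrix.mul_apply, Matrix.conjTranspose_apply, Matrix.of_apply,
        Fin.sum_univ_succ, he1, he2, Sum.elim_inl, Sum.elim_inr, Matrix.vecMulVec_apply,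
        Pi.star_apply]
      ring
    simp only [h1]
    have h2 := fun z : Fin m × Fin n → ℂ => lintegral_detPow_sub
      (1 - (Matrix.of fun i j => z (i, j))ᴴ * (Matrix.of fun i j => z (i, j)))
      (Matrix.isHermitian_one.sub (Matrix.isHermitian_conjTranspose_mul_self _)) hs
    simp only [h2]
    rw [lintegral_const_mul _ (hm m _), ih (by linarith), ← ENNReal.ofReal_mul (by positivity)]
    congr 1
    rw [Fintype.prod_prod_type, Fintype.prod_prod_type, Fin.prod_univ_succ, Finset.prod_range]
    have h3 : ∀ (i : Fin m) (j : Fin n), s + 1 + ((i : ℕ) + (j : ℕ) + 1 : ℝ) =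
        s + (((Fin.succ i : Fin (m + 1)) : ℕ) + (j : ℕ) + 1) := by
      intro i j
      simp only [Fin.val_succ]
      push_cast
      ring
    simp only [h3]
    simp only [Fin.val_zero, Nat.cast_zero, zero_add, add_assoc]
    rw [Nat.succ_mul, pow_add]
    ring

/-- The monomial moments of `Y_I`. -/
theorem lintegral_domainY (N m n : ℕ) {K : ℝ} (hK : 0 < K) (k : ℕ) :
    ∫⁻ p in domainY (N + 1) m n K, ENNReal.ofReal (‖p (Sum.inl 0)‖ ^ (2 * k)) =
      ENNReal.ofReal (K ^ (m * n) * Real.pi ^ (m * n + (N + 1)) / taylorCoeff (N + 1) m n K k) := by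
  have hmeas := (isOpen_domainY (N := N + 1) (m := m) (n := n) hK).measurableSet
  rw [← lintegral_indicator hmeas, lintegral_sum_index _ (Measurable.indicator (by fun_prop) hmeas)]
  -- For fixed `Z` the fibre is the ball `|W|² < det^{1/K}`, so its moment is a constant times `det`
  -- to the power `(N+1+k)/K`, to which Hua's integral applies.
  have h1 : ∀ (z : Fin m × Fin n → ℂ), ∫⁻ y : Fin (N + 1) → ℂ,
      (domainY (N + 1) m n K).indicator (fun p => ENNReal.ofReal (‖p (Sum.inl 0)‖ ^ (2 * k)))
        (Sum.elim y z) =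
      ENNReal.ofReal (Real.pi ^ (N + 1) / ∏ l ∈ Finset.range (N + 1), ((k : ℝ) + 1 + l)) *
        detPow (1 - (Matrix.of fun i j => z (i, j))ᴴ * (Matrix.of fun i j => z (i, j)))
          (((N + 1 : ℕ) + k) / K) := by
    intro z
    set Z : Matrix (Fin m) (Fin n) ℂ := Matrix.of fun i j => z (i, j) with hZ
    by_cases hp : (1 - Z * Zᴴ).PosDef
    · have hb : 0 < (1 - Zᴴ * Z).det.re := by
        rw [← det_one_sub_comm]
        exact (Complex.pos_iff.1 hp.det_pos).1
      have h2 : ∀ y : Fin (N + 1) → ℂ,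
          (domainY (N + 1) m n K).indicator (fun p => ENNReal.ofReal (‖p (Sum.inl 0)‖ ^ (2 * k)))
            (Sum.elim y z) = ENNReal.ofReal (‖y 0‖ ^ (2 * k)) *
              truncPow ((1 - Zᴴ * Z).det.re ^ K⁻¹ - ∑ i, ‖y i‖ ^ 2) 0 := by
        intro y
        have h3 : Sum.elim y z ∈ domainY (N + 1) m n K ↔
            0 < (1 - Zᴴ * Z).det.re ^ K⁻¹ - ∑ i, ‖y i‖ ^ 2 := by
          rw [← det_one_sub_comm] at hb ⊢
          have h4 : (∑ i, ‖y i‖ ^ 2) ^ K < (1 - Z * Zᴴ).det.re ↔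
              ∑ i, ‖y i‖ ^ 2 < (1 - Z * Zᴴ).det.re ^ K⁻¹ :=
            (Real.lt_rpow_inv_iff_of_pos (by positivity) hb.le hK).symm
          rw [sub_pos, ← h4]
          exact ⟨fun h => h.2, fun h => ⟨hp, h⟩⟩
        by_cases h4 : Sum.elim y z ∈ domainY (N + 1) m n K
        · rw [indicator_of_mem h4, truncPow, if_pos (h3.1 h4)]
          simp
        · rw [indicator_of_notMem h4, truncPow, if_neg (mt h3.2 h4), mul_zero]
      simp only [h2]
      rw [lintegral_moment, truncPow, if_pos (by positivity), detPow,
        if_pos ((posDef_one_sub_comm Z).1 hp), ← Real.rpow_mul hb.le]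
      congr 3
      ring
    · have h2 : ∀ y : Fin (N + 1) → ℂ, Sum.elim y z ∉ domainY (N + 1) m n K := fun y h => hp h.1
      simp only [indicator_of_notMem (h2 _), lintegral_zero]
      rw [detPow, if_neg (mt (posDef_one_sub_comm Z).2 hp), mul_zero]
  simp only [h1]
  rw [lintegral_const_mul' _ _ ENNReal.ofReal_ne_top, lintegral_detPow n m (by positivity),
    ← ENNReal.ofReal_mul (by positivity)]
  congr 1
  have h5 : ∏ p : Fin m × Fin n, (((N + 1 : ℕ) + k : ℝ) / K + ((p.1 : ℕ) + (p.2 : ℕ) + 1)) =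
      huaProd (N + 1) m n K k / K ^ (m * n) := by
    rw [huaProd, show K ^ (m * n) = ∏ p : Fin m × Fin n, K by simp, ← Finset.prod_div_distrib]
    refine Finset.prod_congr rfl fun p _ => ?_
    field_simp
    push_cast
    ring
  rw [h5, taylorCoeff, pow_add]
  have h6 := huaProd_pos (N + 1) m n hK k
  have h7 : 0 < ∏ l ∈ Finset.range (N + 1), ((k : ℝ) + 1 + l) :=
    Finset.prod_pos fun l _ => by positivity
  field_simp
  ring


/-! ### The kernel function at the points `(w e₁, 0)` -/

/-- On the unit circle `conj ζ = ζ⁻¹`, so this is Cauchy's formula for the `k`-th derivative. -/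
theorem circleAverage_conj_pow_mul {H : ℂ → ℂ} (hH : DifferentiableOn ℂ H (Metric.closedBall 0 1))
    (k : ℕ) : Real.circleAverage (fun ζ => conj ζ ^ k * H ζ) 0 1 =
      (k.factorial : ℂ)⁻¹ * iteratedDeriv k H 0 := by
  have h1 := hH.circleIntegral_one_div_sub_center_pow_smul one_pos k
  rw [Real.circleAverage_eq_circleIntegral one_ne_zero]
  have h2 : (∮ z in C(0, 1), (z - 0)⁻¹ • (conj z ^ k * H z)) =
      ∮ z in C(0, 1), (1 / (z - 0) ^ (k + 1)) • H z := by
    refine circleIntegral.integral_congr zero_le_one fun z hz => ?_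
    have hz1 : ‖z‖ = 1 := by simpa using hz
    have hz0 : z ≠ 0 := norm_ne_zero_iff.1 (by rw [hz1]; norm_num)
    have : conj z = z⁻¹ := by
      rw [Complex.inv_def, Complex.normSq_eq_norm_sq, hz1]
      simp
    simp only [this, smul_eq_mul, sub_zero, inv_pow, one_div, pow_succ, mul_inv]
    ring
  rw [h2, h1, smul_smul]
  have : (2 * (Real.pi : ℂ) * Complex.I) ≠ 0 := Complex.two_pi_I_ne_zero
  have h3 : (k.factorial : ℂ) ≠ 0 := by exact_mod_cast k.factorial_ne_zero
  rw [smul_eq_mul]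
  field_simp

theorem iteratedDeriv_comp_mul_of_norm_lt {F : ℂ → ℂ} (hF : DifferentiableOn ℂ F (Metric.ball 0 1))
    {z : ℂ} (hz : ‖z‖ < 1) (k : ℕ) :
    iteratedDeriv k (fun ζ => F (z * ζ)) 0 = z ^ k * iteratedDeriv k F 0 := by
  have h0 : (0 : ℂ) ∈ Metric.ball (0 : ℂ) 1 := Metric.mem_ball_self one_pos
  have h := iteratedDerivWithin_comp_const_smul (n := k) h0
    Metric.isOpen_ball.uniqueDiffOn (hF.contDiffOn Metric.isOpen_ball) z (fun ζ hζ => by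
      rw [mem_ball_zero_iff] at hζ ⊢
      rw [norm_mul]
      nlinarith [norm_nonneg z, norm_nonneg ζ])
  rw [iteratedDerivWithin_of_isOpen Metric.isOpen_ball h0, mul_zero,
    iteratedDerivWithin_of_isOpen Metric.isOpen_ball h0] at h
  simpa using h

section Normal

variable {N m n : ℕ} {K : ℝ}

theorem single_mem_domainY (hK : 0 < K) {u : ℂ} (j : Fin N) (hu : ‖u‖ < 1) :
    (Pi.single (Sum.inl j) u : Idx N m n → ℂ) ∈ domainY N m n K := by
  have h1 : matZ (Pi.single (Sum.inl j) u : Idx N m n → ℂ) = 0 := by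
    ext a b
    simp [matZ]
  have h2 : normSqW (Pi.single (Sum.inl j) u : Idx N m n → ℂ) = ‖u‖ ^ 2 := by
    rw [normSqW, Finset.sum_eq_single j]
    · simp
    · intro b _ hb
      simp [hb]
    · simp
  refine ⟨?_, ?_⟩
  · rw [h1, cartanI, mem_ofPred_eq, Matrix.zero_mul, sub_zero]
    exact Matrix.PosDef.one
  · rw [h2, genNorm, h1, Matrix.zero_mul, sub_zero, Matrix.det_one, Complex.one_re]
    exact Real.rpow_lt_one (by positivity) (by nlinarith [norm_nonneg u]) hK

/-- The `Z` coordinates must be scaled all together or not at all, since only a common scalar acts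
on the matrix ball through `1 - Z Zᴴ` in a simple way; the `W` coordinates are free. -/
theorem rot_mem_domainY (hK : 0 < K) {S : Idx N m n → Prop} [DecidablePred S]
    (hS : (∀ i, S (Sum.inr i)) ∨ ∀ i, ¬ S (Sum.inr i)) {ζ : ℂ} (hζ : ‖ζ‖ ≤ 1)
    {p : Idx N m n → ℂ} (hp : p ∈ domainY N m n K) : rot S ζ p ∈ domainY N m n K := by
  have hW : ∀ j, ‖rot S ζ p (Sum.inl j)‖ ≤ ‖p (Sum.inl j)‖ := fun j => by
    unfold rot
    split_ifs
    · rw [norm_mul]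
      exact mul_le_of_le_one_left (norm_nonneg _) hζ
    · exact le_rfl
  rcases hS with h | h
  · refine mem_domainY_of_contraction hK hp hζ hW ?_
    ext a b
    simp [matZ, rot, h]
  · refine mem_domainY_of_contraction hK hp (ζ := 1) (by simp) hW ?_
    ext a b
    simp [matZ, rot, h]

theorem integrableOn_of_mem_bergmanSpace (hK : 0 < K) {f : (Idx N m n → ℂ) → ℂ}
    (hf : f ∈ bergmanSpace (domainY N m n K)) : IntegrableOn f (domainY N m n K) := by
  have : IsFiniteMeasure (volume.restrict (domainY N m n K)) :=
    ⟨by rw [Measure.restrict_apply_univ]; exact volume_domainY_lt_top hK⟩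
  exact hf.2.integrable (by norm_num)

/-- Averaging over rotations of all coordinates but one. -/
theorem integral_mul_comp_coord (hK : 0 < K) (j : Fin N) {f : (Idx N m n → ℂ) → ℂ}
    (hf : f ∈ bergmanSpace (domainY N m n K)) {g : ℂ → ℂ} {C : ℝ}
    (hg : ContinuousOn g (Metric.ball 0 1)) (hC : ∀ z ∈ Metric.ball 0 1, ‖g z‖ ≤ C) :
    IntegrableOn (fun p => f (Pi.single (Sum.inl j) (p (Sum.inl j))) * g (p (Sum.inl j)))
      (domainY N m n K) ∧
    ∫ p in domainY N m n K, f p * g (p (Sum.inl j)) =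
      ∫ p in domainY N m n K, f (Pi.single (Sum.inl j) (p (Sum.inl j))) * g (p (Sum.inl j)) := by
  set Y := domainY N m n K with hY
  have hΩ : IsOpen Y := isOpen_domainY hK
  have hgc : ContinuousOn (fun p : Idx N m n → ℂ => g (p (Sum.inl j))) Y :=
    hg.comp (continuous_apply _).continuousOn fun p hp => by
      rw [mem_ball_zero_iff]; exact norm_inl_lt hK hp j
  have hφ : IntegrableOn (fun p => f p * g (p (Sum.inl j))) Y := by
    refine (integrableOn_of_mem_bergmanSpace hK hf).mul_bdd (c := C)
      (hgc.aestronglyMeasurable hΩ.measurableSet) ?_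
    filter_upwards [ae_restrict_mem hΩ.measurableSet] with p hp
    exact hC _ (by rw [mem_ball_zero_iff]; exact norm_inl_lt hK hp j)
  have hS : (∀ i : Fin m × Fin n, (Sum.inr i : Idx N m n) ≠ Sum.inl j) := fun i => by simp
  have h := integral_circleAverage_rot (S := fun i : Idx N m n => i ≠ Sum.inl j) hΩ
    (fun ζ hζ p hp => rot_mem_domainY hK (Or.inl hS) hζ.le hp)
    (φ := fun p => f p * g (p (Sum.inl j))) (hf.1.continuousOn.mul hgc) hφ
  have key : ∀ p ∈ Y, Real.circleAverage (fun ζ => f (rot (fun i => i ≠ Sum.inl j) ζ p) *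
      g (rot (fun i => i ≠ Sum.inl j) ζ p (Sum.inl j))) 0 1 =
      f (Pi.single (Sum.inl j) (p (Sum.inl j))) * g (p (Sum.inl j)) := by
    intro p hp
    have h1 : ∀ ζ, rot (fun i => i ≠ Sum.inl j) ζ p (Sum.inl j) = p (Sum.inl j) := fun ζ => by
      simp [rot]
    simp only [h1]
    have h2 : rot (fun i => i ≠ Sum.inl j) 0 p = Pi.single (Sum.inl j) (p (Sum.inl j)) := by
      funext i
      by_cases hi : i = Sum.inl j
      · subst hi; simp [rot]
      · simp [rot, hi]
    have hd : DifferentiableOn ℂ (fun ζ => f (rot (fun i => i ≠ Sum.inl j) ζ p) * g (p (Sum.inl j)))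
        (Metric.closedBall 0 1) := by
      refine DifferentiableOn.mul_const (hf.1.comp ?_ fun ζ hζ =>
        rot_mem_domainY hK (Or.inl hS) (by simpa using hζ) hp) _
      refine differentiableOn_pi.2 fun i => ?_
      by_cases hi : i = Sum.inl j
      · simp [rot, hi]
      · simp only [rot, ne_eq, hi, not_false_eq_true, if_true]
        fun_prop
    -- Mean value property: the average over the circle is the value at `ζ = 0`, where all other
    -- coordinates vanish. That the rotated point stays in the domain for `|ζ| ≤ 1` is used here.
    have h3 := DiffContOnCl.circleAverage (c := 0) (R := 1) (f := fun ζ =>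
      f (rot (fun i => i ≠ Sum.inl j) ζ p) * g (p (Sum.inl j))) (by
        rw [abs_one]
        exact (hd.mono Metric.closure_ball_subset_closedBall).diffContOnCl)
    rw [h3, h2]
  refine ⟨(integrableOn_congr_fun key hΩ.measurableSet).1 h.1, ?_⟩
  rw [← h.2]
  exact setIntegral_congr_fun hΩ.measurableSet key

theorem integral_norm_pow_domainY {N m n : ℕ} (hK : 0 < K) (k : ℕ) :
    ∫ p in domainY (N + 1) m n K, ‖p (Sum.inl 0)‖ ^ (2 * k) =
      K ^ (m * n) * Real.pi ^ (m * n + (N + 1)) / taylorCoeff (N + 1) m n K k := by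
  rw [integral_eq_lintegral_of_nonneg_ae (ae_of_all _ fun p => by positivity)
    (Continuous.aestronglyMeasurable (by fun_prop)), lintegral_domainY N m n hK, ENNReal.toReal_ofReal]
  have := taylorCoeff_pos (N + 1) m n hK k
  positivity

/-- Averaging over rotations of `W₀` keeps from `F` only its Taylor term of order `k`, and what
remains is the squared norm of the monomial. -/
theorem integral_coord_mul_conj_pow {N m n : ℕ} (hK : 0 < K) {F : ℂ → ℂ}
    (hF : DifferentiableOn ℂ F (Metric.ball 0 1)) (k : ℕ)
    (hi : IntegrableOn (fun p : Idx (N + 1) m n → ℂ =>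
      F (p (Sum.inl 0)) * conj (p (Sum.inl 0)) ^ k) (domainY (N + 1) m n K)) :
    ∫ p in domainY (N + 1) m n K, F (p (Sum.inl 0)) * conj (p (Sum.inl 0)) ^ k =
      ((k.factorial : ℂ)⁻¹ * iteratedDeriv k F 0) *
        ((K ^ (m * n) * Real.pi ^ (m * n + (N + 1)) / taylorCoeff (N + 1) m n K k : ℝ) : ℂ) := by
  set Y := domainY (N + 1) m n K with hY
  have hΩ : IsOpen Y := isOpen_domainY hK
  have hS : (∀ i : Fin m × Fin n, ¬ ((Sum.inr i : Idx (N + 1) m n) = Sum.inl 0)) := fun i => by simp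
  have hFc : ContinuousOn (fun p : Idx (N + 1) m n → ℂ =>
      F (p (Sum.inl 0)) * conj (p (Sum.inl 0)) ^ k) Y := by
    refine ContinuousOn.mul (hF.continuousOn.comp (continuous_apply _).continuousOn fun p hp => ?_)
      (Continuous.continuousOn (by fun_prop))
    rw [mem_ball_zero_iff]; exact norm_inl_lt hK hp 0
  have h := integral_circleAverage_rot (S := fun i : Idx (N + 1) m n => i = Sum.inl 0) hΩ
    (fun ζ hζ p hp => rot_mem_domainY hK (Or.inr hS) hζ.le hp) hFc hi
  have key : ∀ p ∈ Y, Real.circleAverage (fun ζ => F (rot (fun i => i = Sum.inl 0) ζ p (Sum.inl 0)) *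
      conj (rot (fun i => i = Sum.inl 0) ζ p (Sum.inl 0)) ^ k) 0 1 =
      ((k.factorial : ℂ)⁻¹ * iteratedDeriv k F 0) * ((‖p (Sum.inl 0)‖ ^ (2 * k) : ℝ) : ℂ) := by
    intro p hp
    have hp1 := norm_inl_lt hK hp 0
    set z := p (Sum.inl 0) with hz
    have h1 : ∀ ζ, rot (fun i => i = Sum.inl 0) ζ p (Sum.inl 0) = z * ζ := fun ζ => by
      simp [rot, mul_comm, hz]
    simp only [h1]
    have hd : DifferentiableOn ℂ (fun ζ => conj z ^ k * F (z * ζ)) (Metric.closedBall 0 1) := by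
      refine DifferentiableOn.const_mul (hF.comp (by fun_prop) fun ζ hζ => ?_) _
      rw [mem_closedBall_zero_iff] at hζ
      rw [mem_ball_zero_iff, norm_mul]
      nlinarith [norm_nonneg z, norm_nonneg ζ]
    have h2 := circleAverage_conj_pow_mul hd k
    have h3 : (fun ζ => F (z * ζ) * conj (z * ζ) ^ k) =
        fun ζ => conj ζ ^ k * (conj z ^ k * F (z * ζ)) := by
      funext ζ
      rw [map_mul]
      ring
    have h4 : iteratedDeriv k (fun ζ => conj z ^ k * F (z * ζ)) 0 =
        conj z ^ k * iteratedDeriv k (fun ζ => F (z * ζ)) 0 :=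
      iteratedDeriv_const_mul_field _ _
    rw [h3, h2, h4, iteratedDeriv_comp_mul_of_norm_lt hF hp1]
    have h5 : ((‖z‖ ^ (2 * k) : ℝ) : ℂ) = conj z ^ k * z ^ k := by
      rw [← mul_pow, Complex.conj_mul']
      push_cast
      rw [pow_mul]
    rw [h5]
    ring
  rw [← h.2, setIntegral_congr_fun hΩ.measurableSet key, integral_const_mul, integral_complex_ofReal,
    integral_norm_pow_domainY hK]

theorem differentiableAt_complexG (N m n : ℕ) (K : ℝ) {z : ℂ} (hz : z ≠ 1) :
    DifferentiableAt ℂ (complexG N m n K) z := by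
  unfold complexG
  refine DifferentiableAt.fun_sum fun i _ => DifferentiableAt.const_mul (DifferentiableAt.inv ?_ ?_) _
  · fun_prop
  · exact pow_ne_zero _ (sub_ne_zero.2 hz.symm)

/-- The kernel function at `(w e₁, 0)`. -/
theorem isReproAt_single {N m n : ℕ} (hK : 0 < K) {w : ℂ} (hw : ‖w‖ < 1) :
    IsReproAt (domainY (N + 1) m n K) (Pi.single (Sum.inl 0) w) fun z =>
      (((K ^ (m * n))⁻¹ * (Real.pi ^ (m * n + (N + 1)))⁻¹ : ℝ) : ℂ) *
        complexG (N + 1) m n K (conj w * z (Sum.inl 0)) := by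
  set Y := domainY (N + 1) m n K with hY
  have hΩ : IsOpen Y := isOpen_domainY hK
  set c : ℝ := (K ^ (m * n))⁻¹ * (Real.pi ^ (m * n + (N + 1)))⁻¹ with hc
  set a := taylorCoeff (N + 1) m n K with ha
  have ha0 : ∀ k, 0 < a k := taylorCoeff_pos (N + 1) m n hK
  have hc0 : 0 < c := by positivity
  have hlt : ∀ z : ℂ, ‖z‖ < 1 → ‖conj w * z‖ ≤ ‖w‖ := fun z hz => by
    rw [norm_mul, RCLike.norm_conj]
    exact mul_le_of_le_one_right (norm_nonneg _) hz.le
  have hsum : Summable fun k => a k * ‖w‖ ^ k :=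
    (hasSum_bergmanG (N + 1) m n K (norm_nonneg w) hw).summable
  have hG : ∀ z : ℂ, ‖z‖ < 1 → HasSum (fun k => (a k : ℂ) * (conj w * z) ^ k)
      (complexG (N + 1) m n K (conj w * z)) := fun z hz =>
    hasSum_complexG (N + 1) m n K ((hlt z hz).trans_lt hw)
  have hGb : ∀ z : ℂ, ‖z‖ < 1 → ‖complexG (N + 1) m n K (conj w * z)‖ ≤ ∑' k, a k * ‖w‖ ^ k := by
    intro z hz
    rw [← (hG z hz).tsum_eq]
    refine tsum_of_norm_bounded hsum.hasSum fun k => ?_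
    rw [norm_mul, norm_pow, Complex.norm_real, Real.norm_of_nonneg (ha0 k).le]
    have := hlt z hz
    have := (ha0 k).le
    gcongr
  have hGd : DifferentiableOn ℂ (fun z => complexG (N + 1) m n K (conj w * z)) (Metric.ball 0 1) := by
    intro z hz
    rw [mem_ball_zero_iff] at hz
    refine DifferentiableAt.differentiableWithinAt (DifferentiableAt.fun_comp' z
      (differentiableAt_complexG _ _ _ _ ?_) (by fun_prop))
    intro h
    have := hlt z hz
    rw [h, norm_one] at this
    linarith
  have hmaps : MapsTo (fun p : Idx (N + 1) m n → ℂ => p (Sum.inl 0)) Y (Metric.ball 0 1) :=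
    fun p hp => by rw [mem_ball_zero_iff]; exact norm_inl_lt hK hp 0
  refine ⟨⟨?_, ?_⟩, fun f hf => ?_⟩
  · exact DifferentiableOn.const_mul (hGd.comp (by fun_prop) hmaps) _
  · have : IsFiniteMeasure (volume.restrict Y) :=
      ⟨by rw [Measure.restrict_apply_univ]; exact volume_domainY_lt_top hK⟩
    refine MemLp.of_bound (C := c * ∑' k, a k * ‖w‖ ^ k) ?_ ?_
    · exact (continuousOn_const.mul (hGd.continuousOn.comp (by fun_prop) hmaps)).aestronglyMeasurable
        hΩ.measurableSet
    · filter_upwards [ae_restrict_mem hΩ.measurableSet] with p hp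
      rw [norm_mul, Complex.norm_real, Real.norm_of_nonneg hc0.le]
      exact mul_le_mul_of_nonneg_left (hGb _ (norm_inl_lt hK hp 0)) hc0.le
  · set F : ℂ → ℂ := fun u => f (Pi.single (Sum.inl 0) u) with hFdef
    have hF : DifferentiableOn ℂ F (Metric.ball 0 1) := by
      refine hf.1.comp ?_ fun u hu => single_mem_domainY hK 0 (by simpa using hu)
      exact (ContinuousLinearMap.single ℂ (fun _ : Idx (N + 1) m n => ℂ)
        (Sum.inl 0)).differentiable.differentiableOn
    have h1 := (integral_mul_comp_coord hK 0 hf (g := fun z => conj ((c : ℂ) *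
      complexG (N + 1) m n K (conj w * z))) (C := c * ∑' k, a k * ‖w‖ ^ k)
      (Complex.continuous_conj.comp_continuousOn (continuousOn_const.mul hGd.continuousOn))
      (fun z hz => by
        rw [mem_ball_zero_iff] at hz
        rw [RCLike.norm_conj, norm_mul, Complex.norm_real, Real.norm_of_nonneg hc0.le]
        exact mul_le_mul_of_nonneg_left (hGb z hz) hc0.le)).2
    rw [h1]
    have hint : ∀ k : ℕ, IntegrableOn (fun p : Idx (N + 1) m n → ℂ =>
        F (p (Sum.inl 0)) * conj (p (Sum.inl 0)) ^ k) Y := fun k =>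
      (integral_mul_comp_coord hK 0 hf (g := fun z => conj z ^ k) (C := 1)
        (Continuous.continuousOn (by fun_prop)) (fun z hz => by
          rw [mem_ball_zero_iff] at hz
          rw [norm_pow, RCLike.norm_conj]
          exact pow_le_one₀ (norm_nonneg z) hz.le)).1
    -- The kernel series is integrated term by term; the norms are dominated by `c a_k |w|^k ∫ |F|`,
    -- which is summable because `|w| < 1`.
    have h2 := hasSum_integral_of_summable_integral_norm (μ := volume.restrict Y)
      (F := fun (k : ℕ) (p : Idx (N + 1) m n → ℂ) =>
        ((c : ℂ) * a k * w ^ k) * (F (p (Sum.inl 0)) * conj (p (Sum.inl 0)) ^ k))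
      (fun k => (hint k).const_mul _) (by
        have hI : IntegrableOn (fun p : Idx (N + 1) m n → ℂ => F (p (Sum.inl 0))) Y := by
          simpa using hint 0
        refine Summable.of_nonneg_of_le (fun k => by positivity) (fun k => ?_)
          ((hsum.mul_left c).mul_right (∫ p in Y, ‖F (p (Sum.inl 0))‖))
        rw [← integral_const_mul]
        refine setIntegral_mono_on ((hint k).const_mul _).norm (hI.norm.const_mul _)
          hΩ.measurableSet fun p hp => ?_
        have hp1 := norm_inl_lt hK hp 0
        rw [norm_mul, norm_mul, norm_mul, norm_mul, norm_pow, norm_pow, RCLike.norm_conj,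
          Complex.norm_real, Complex.norm_real, Real.norm_of_nonneg hc0.le,
          Real.norm_of_nonneg (ha0 k).le]
        have h5 : ‖p (Sum.inl 0)‖ ^ k ≤ 1 := pow_le_one₀ (norm_nonneg _) hp1.le
        have h6 : ‖F (p (Sum.inl 0))‖ * ‖p (Sum.inl 0)‖ ^ k ≤ ‖F (p (Sum.inl 0))‖ :=
          mul_le_of_le_one_right (norm_nonneg _) h5
        have := (ha0 k).le
        rw [mul_assoc c]
        gcongr)
    have h3 : ∀ k, ∫ p in Y, ((c : ℂ) * a k * w ^ k) *
        (F (p (Sum.inl 0)) * conj (p (Sum.inl 0)) ^ k) =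
        (k.factorial : ℂ)⁻¹ • (w - 0) ^ k • iteratedDeriv k F 0 := by
      intro k
      rw [integral_const_mul, integral_coord_mul_conj_pow hK hF k (hint k)]
      -- The coefficients were chosen as inverses of the squared norms, so each integrated term is
      -- the Taylor term of `F` at `w`.
      have h7 : c * a k * (K ^ (m * n) * Real.pi ^ (m * n + (N + 1)) / a k) = 1 := by
        have := (ha0 k).ne'
        rw [hc]
        field_simp
      have h8 : (c : ℂ) * a k * ((K ^ (m * n) * Real.pi ^ (m * n + (N + 1)) / a k : ℝ) : ℂ) = 1 := by
        exact_mod_cast h7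
      simp only [smul_eq_mul, sub_zero]
      linear_combination (w ^ k * ((k.factorial : ℂ)⁻¹ * iteratedDeriv k F 0)) * h8
    simp only [h3] at h2
    have h4 := Complex.hasSum_taylorSeries_on_ball hF (z := w) (by simpa using hw)
    refine (h4.unique h2).trans (setIntegral_congr_fun hΩ.measurableSet fun p hp => ?_)
    have h9 := ((hG _ (norm_inl_lt hK hp 0)).mul_left (c : ℂ)).map (starRingEnd ℂ)
      Complex.continuous_conj
    have h10 := h9.mul_left (F (p (Sum.inl 0)))
    refine HasSum.tsum_eq ?_
    convert! h10 using 2 with k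
    simp only [Function.comp_apply, map_mul, map_pow, Complex.conj_ofReal, Complex.conj_conj]
    ring

end Normal

/-! ### Möbius transformations of the matrix ball -/

section Mobius

variable {α β : Type} [Fintype α] [DecidableEq α] [Fintype β] [DecidableEq β]

/-- Block matrices `(A, B; C, D)` in `U(α, β)`. -/
structure PseudoUnitary (α β : Type) [Fintype α] [DecidableEq α] [Fintype β] [DecidableEq β] where
  A : Matrix α α ℂ
  B : Matrix α β ℂ
  C : Matrix β α ℂ
  D : Matrix β β ℂ
  hD : Dᴴ * D - Bᴴ * B = 1
  hA : Aᴴ * A - Cᴴ * C = 1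
  hCB : Dᴴ * C = Bᴴ * A
  hD' : D * Dᴴ - C * Cᴴ = 1
  hA' : A * Aᴴ - B * Bᴴ = 1
  hCB' : D * Bᴴ = C * Aᴴ

namespace PseudoUnitary

/-- The block identities on one side imply those on the other side. -/
def mk' (A : Matrix α α ℂ) (B : Matrix α β ℂ) (C : Matrix β α ℂ) (D : Matrix β β ℂ)
    (hD : Dᴴ * D - Bᴴ * B = 1) (hA : Aᴴ * A - Cᴴ * C = 1) (hCB : Dᴴ * C = Bᴴ * A) :
    PseudoUnitary α β :=
  have hCB2 : Cᴴ * D = Aᴴ * B := by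
    have := congrArg Matrix.conjTranspose hCB
    simpa using this
  have h : Matrix.fromBlocks Aᴴ (-Cᴴ) (-Bᴴ) Dᴴ * Matrix.fromBlocks A B C D = 1 := by
    rw [Matrix.fromBlocks_multiply, ← Matrix.fromBlocks_one]
    congr 1
    · rw [← hA, Matrix.neg_mul, sub_eq_add_neg]
    · rw [Matrix.neg_mul, hCB2, add_neg_cancel]
    · rw [Matrix.neg_mul, hCB, neg_add_cancel]
    · rw [← hD, Matrix.neg_mul]; abel
  -- A left inverse of a square matrix is a right inverse; the other three identities are the blocks
  -- of the reversed product.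
  have h' := mul_eq_one_comm.1 h
  have h2 : A * Aᴴ - B * Bᴴ = 1 ∧ A * -Cᴴ + B * Dᴴ = 0 ∧ C * Aᴴ + D * -Bᴴ = 0 ∧
      D * Dᴴ - C * Cᴴ = 1 := by
    rw [Matrix.fromBlocks_multiply, ← Matrix.fromBlocks_one, Matrix.fromBlocks_inj] at h'
    refine ⟨?_, h'.2.1, h'.2.2.1, ?_⟩
    · rw [← h'.1, Matrix.mul_neg, sub_eq_add_neg]
    · rw [← h'.2.2.2, Matrix.mul_neg]; abel
  { A := A, B := B, C := C, D := D, hD := hD, hA := hA, hCB := hCB, hD' := h2.2.2.2, hA' := h2.1,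
    hCB' := by
      have := h2.2.2.1
      rw [Matrix.mul_neg, ← sub_eq_add_neg, sub_eq_zero] at this
      exact this.symm }

/-- The inverse block matrix. -/
def inv (g : PseudoUnitary α β) : PseudoUnitary α β where
  A := g.Aᴴ
  B := -g.Cᴴ
  C := -g.Bᴴ
  D := g.Dᴴ
  hD := by simpa using g.hD'
  hA := by simpa using g.hA'
  hCB := by simpa using g.hCB'
  hD' := by simpa using g.hD
  hA' := by simpa using g.hA
  hCB' := by simpa using g.hCB

/-- The block matrix acting on adjoints. -/
def flip (g : PseudoUnitary α β) : PseudoUnitary β α where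
  A := g.D
  B := g.C
  C := g.B
  D := g.A
  hD := g.hA
  hA := g.hD
  hCB := by simpa using (congrArg Matrix.conjTranspose g.hCB).symm
  hD' := g.hA'
  hA' := g.hD'
  hCB' := by simpa using (congrArg Matrix.conjTranspose g.hCB').symm

theorem inv_inv (g : PseudoUnitary α β) : g.inv.inv = g := by
  cases g
  simp [inv]

/-- The denominator `C Z + D`. -/
def den (g : PseudoUnitary α β) (Z : Matrix α β ℂ) : Matrix β β ℂ := g.C * Z + g.D

/-- The numerator `A Z + B`. -/
def num (g : PseudoUnitary α β) (Z : Matrix α β ℂ) : Matrix α β ℂ := g.A * Z + g.B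

/-- The Möbius transformation `Z ↦ (A Z + B) (C Z + D)⁻¹`. -/
def act (g : PseudoUnitary α β) (Z : Matrix α β ℂ) : Matrix α β ℂ := g.num Z * (g.den Z)⁻¹

variable (g : PseudoUnitary α β) {Z : Matrix α β ℂ}

theorem hCB_conj : g.Cᴴ * g.D = g.Aᴴ * g.B := by simpa using congrArg Matrix.conjTranspose g.hCB

/-- The block matrix preserves the indefinite form `|y|² - |x|²`; this is the invariance applied to
the columns of `(Z; 1)`. -/
theorem den_sub_num (Z : Matrix α β ℂ) :
    (g.den Z)ᴴ * g.den Z - (g.num Z)ᴴ * g.num Z = 1 - Zᴴ * Z := by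
  have h : (g.den Z)ᴴ * g.den Z - (g.num Z)ᴴ * g.num Z =
      (g.Dᴴ * g.D - g.Bᴴ * g.B) - Zᴴ * (g.Aᴴ * g.A - g.Cᴴ * g.C) * Z +
      (g.Dᴴ * g.C - g.Bᴴ * g.A) * Z + Zᴴ * (g.Cᴴ * g.D - g.Aᴴ * g.B) := by
    simp only [den, num, Matrix.conjTranspose_add, Matrix.conjTranspose_mul, Matrix.add_mul,
      Matrix.mul_add, Matrix.sub_mul, Matrix.mul_sub, Matrix.mul_assoc]
    abel
  rw [h, g.hD, g.hA, g.hCB, g.hCB_conj]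
  simp

theorem isUnit_det_den (hZ : (1 - Zᴴ * Z).PosDef) : IsUnit (g.den Z).det := by
  have h : ((g.den Z)ᴴ * g.den Z).PosDef := by
    rw [← sub_add_cancel ((g.den Z)ᴴ * g.den Z) ((g.num Z)ᴴ * g.num Z), den_sub_num]
    exact hZ.add_posSemidef (Matrix.posSemidef_conjTranspose_mul_self _)
  have := h.det_pos.ne'
  rw [Matrix.det_mul] at this
  exact isUnit_iff_ne_zero.2 (right_ne_zero_of_mul this)

theorem act_mul_den (hZ : (1 - Zᴴ * Z).PosDef) : g.act Z * g.den Z = g.num Z := by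
  rw [act, Matrix.mul_assoc, Matrix.nonsing_inv_mul _ (g.isUnit_det_den hZ), Matrix.mul_one]

theorem one_sub_act (hZ : (1 - Zᴴ * Z).PosDef) :
    (g.den Z)ᴴ * (1 - (g.act Z)ᴴ * g.act Z) * g.den Z = 1 - Zᴴ * Z := by
  rw [← g.den_sub_num Z, ← g.act_mul_den hZ]
  simp only [Matrix.conjTranspose_mul, Matrix.mul_sub, Matrix.sub_mul, Matrix.mul_assoc,
    Matrix.mul_one, Matrix.one_mul]

theorem posDef_act (hZ : (1 - Zᴴ * Z).PosDef) : (1 - (g.act Z)ᴴ * g.act Z).PosDef := by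
  refine (Matrix.IsUnit.posDef_star_left_conjugate_iff
    ((Matrix.isUnit_iff_isUnit_det _).2 (g.isUnit_det_den hZ))).1 ?_
  rw [Matrix.star_eq_conjTranspose, g.one_sub_act hZ]
  exact hZ

theorem det_act (hZ : (1 - Zᴴ * Z).PosDef) :
    ‖(g.den Z).det‖ ^ 2 * (1 - (g.act Z)ᴴ * g.act Z).det.re = (1 - Zᴴ * Z).det.re := by
  rw [← g.one_sub_act hZ, Matrix.det_mul, Matrix.det_mul, mul_right_comm, Matrix.det_conjTranspose,
    Complex.star_def, Complex.conj_mul', ← Complex.ofReal_pow, Complex.re_ofReal_mul]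

theorem inv_den_act (hZ : (1 - Zᴴ * Z).PosDef) : g.inv.den (g.act Z) = (g.den Z)⁻¹ := by
  refine (Matrix.inv_eq_left_inv ?_).symm
  rw [den, Matrix.add_mul, Matrix.mul_assoc, g.act_mul_den hZ]
  show -g.Bᴴ * (g.A * Z + g.B) + g.Dᴴ * (g.C * Z + g.D) = 1
  have h : -g.Bᴴ * (g.A * Z + g.B) + g.Dᴴ * (g.C * Z + g.D) =
      (g.Dᴴ * g.D - g.Bᴴ * g.B) + (g.Dᴴ * g.C - g.Bᴴ * g.A) * Z := by
    simp only [Matrix.mul_add, Matrix.sub_mul, Matrix.neg_mul, Matrix.mul_assoc]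
    abel
  rw [h, g.hD, g.hCB]
  simp

theorem inv_act_act (hZ : (1 - Zᴴ * Z).PosDef) : g.inv.act (g.act Z) = Z := by
  have hu := g.isUnit_det_den hZ
  rw [act, g.inv_den_act hZ, Matrix.nonsing_inv_nonsing_inv _ hu, num, Matrix.add_mul,
    Matrix.mul_assoc, g.act_mul_den hZ]
  show g.Aᴴ * (g.A * Z + g.B) + -g.Cᴴ * (g.C * Z + g.D) = Z
  have h : g.Aᴴ * (g.A * Z + g.B) + -g.Cᴴ * (g.C * Z + g.D) =
      (g.Aᴴ * g.A - g.Cᴴ * g.C) * Z - (g.Cᴴ * g.D - g.Aᴴ * g.B) := by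
    simp only [Matrix.mul_add, Matrix.sub_mul, Matrix.neg_mul, Matrix.mul_assoc]
    abel
  rw [h, g.hA, g.hCB_conj]
  simp

theorem flip_den_conj (Z : Matrix α β ℂ) : (g.flip.den Zᴴ)ᴴ = Z * g.Bᴴ + g.Aᴴ := by
  simp [den, flip]

/-- The transformation can also be written with its denominator on the left, `(Z Bᴴ + Aᴴ)⁻¹ (Z Dᴴ +
Cᴴ)`. -/
theorem flip_den_mul_act (hZ : (1 - Zᴴ * Z).PosDef) :
    (g.flip.den Zᴴ)ᴴ * g.act Z = (g.flip.num Zᴴ)ᴴ := by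
  have hu := g.isUnit_det_den hZ
  have h1 : (g.flip.den Zᴴ)ᴴ * g.num Z - (g.flip.num Zᴴ)ᴴ * g.den Z = 0 := by
    have h : (g.flip.den Zᴴ)ᴴ * g.num Z - (g.flip.num Zᴴ)ᴴ * g.den Z =
        (g.Aᴴ * g.A - g.Cᴴ * g.C) * Z - Z * (g.Dᴴ * g.D - g.Bᴴ * g.B) -
        Z * (g.Dᴴ * g.C - g.Bᴴ * g.A) * Z - (g.Cᴴ * g.D - g.Aᴴ * g.B) := by
      rw [g.flip_den_conj]
      simp only [num, den, flip, Matrix.conjTranspose_add, Matrix.conjTranspose_mul,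
        Matrix.conjTranspose_conjTranspose, Matrix.add_mul,
        Matrix.mul_add, Matrix.sub_mul, Matrix.mul_sub, Matrix.mul_assoc]
      abel
    rw [h, g.hA, g.hD, g.hCB, g.hCB_conj]
    simp
  rw [act, ← Matrix.mul_assoc, sub_eq_zero.1 h1, Matrix.mul_assoc, Matrix.mul_nonsing_inv _ hu,
    Matrix.mul_one]

theorem flip_act (hZ : (1 - Zᴴ * Z).PosDef) : g.flip.act Zᴴ = (g.act Z)ᴴ := by
  have hZ' : (1 - Zᴴᴴ * Zᴴ).PosDef := by
    rw [Matrix.conjTranspose_conjTranspose]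
    exact (posDef_one_sub_comm Z).2 hZ
  have hu := g.flip.isUnit_det_den hZ'
  rw [act, ← Matrix.conjTranspose_conjTranspose (g.flip.num Zᴴ), ← g.flip_den_mul_act hZ,
    Matrix.conjTranspose_mul, Matrix.conjTranspose_conjTranspose, Matrix.mul_assoc,
    Matrix.mul_nonsing_inv _ hu, Matrix.mul_one]

/-- Both denominators govern how the same number `det (1 - Z Zᴴ) = det (1 - Zᴴ Z)` changes. -/
theorem norm_det_flip_den (hZ : (1 - Zᴴ * Z).PosDef) :
    ‖(g.flip.den Zᴴ).det‖ = ‖(g.den Z).det‖ := by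
  have hZ' : (1 - Zᴴᴴ * Zᴴ).PosDef := by
    rw [Matrix.conjTranspose_conjTranspose]
    exact (posDef_one_sub_comm Z).2 hZ
  have h1 := g.flip.det_act hZ'
  have h2 := g.det_act hZ
  rw [g.flip_act hZ, Matrix.conjTranspose_conjTranspose, Matrix.conjTranspose_conjTranspose,
    det_one_sub_comm, det_one_sub_comm, ← h2] at h1
  have h3 : 0 < (1 - (g.act Z)ᴴ * g.act Z).det.re := (Complex.pos_iff.1 (g.posDef_act hZ).det_pos).1
  have h4 := mul_right_cancel₀ h3.ne' h1
  exact (pow_left_inj₀ (norm_nonneg _) (norm_nonneg _) two_ne_zero).1 h4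

/-- The left factor of the differential of the Möbius transformation. -/
theorem flip_den_mul (hZ : (1 - Zᴴ * Z).PosDef) :
    (g.flip.den Zᴴ)ᴴ * (g.A - g.act Z * g.C) = 1 := by
  rw [Matrix.mul_sub, ← Matrix.mul_assoc, g.flip_den_mul_act hZ, g.flip_den_conj]
  have h : (Z * g.Bᴴ + g.Aᴴ) * g.A - (g.flip.num Zᴴ)ᴴ * g.C =
      (g.Aᴴ * g.A - g.Cᴴ * g.C) - Z * (g.Dᴴ * g.C - g.Bᴴ * g.A) := by
    simp only [num, flip, Matrix.conjTranspose_add, Matrix.conjTranspose_mul,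
        Matrix.conjTranspose_conjTranspose, Matrix.add_mul,
        Matrix.mul_add, Matrix.sub_mul, Matrix.mul_sub, Matrix.mul_assoc]
    abel
  rw [h, g.hA, g.hCB]
  simp

/-- The differential is `H ↦ (A - g(Z) C) H (C Z + D)⁻¹`. Both outer factors have determinant of
modulus `|det (C Z + D)|⁻¹`, which is why the exponent `m + n` appears in the Jacobian. -/
theorem norm_det_left (hZ : (1 - Zᴴ * Z).PosDef) :
    ‖(g.A - g.act Z * g.C).det‖ = ‖(g.den Z).det‖⁻¹ := by
  have h := congrArg Matrix.det (g.flip_den_mul hZ)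
  rw [Matrix.det_mul, Matrix.det_one, Matrix.det_conjTranspose] at h
  have h2 := congrArg norm h
  rw [norm_mul, norm_star, g.norm_det_flip_den hZ, norm_one] at h2
  exact (eq_inv_of_mul_eq_one_right h2)

/-- The difference quotient of the Möbius transformation. -/
theorem act_sub_act {Z' : Matrix α β ℂ} (hZ : (1 - Zᴴ * Z).PosDef) (hZ' : IsUnit (g.den Z').det) :
    g.act Z' - g.act Z = (g.A - g.act Z * g.C) * (Z' - Z) * (g.den Z')⁻¹ := by
  have h : g.act Z = g.act Z * g.den Z' * (g.den Z')⁻¹ := by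
    rw [Matrix.mul_assoc, Matrix.mul_nonsing_inv _ hZ', Matrix.mul_one]
  have h2 : g.den Z' = g.den Z + g.C * (Z' - Z) := by
    rw [den, den, Matrix.mul_sub]; abel
  have h3 : g.num Z' = g.num Z + g.A * (Z' - Z) := by
    rw [num, num, Matrix.mul_sub]; abel
  conv_lhs => rw [h]
  rw [act, ← Matrix.sub_mul]
  congr 1
  rw [h2, h3, Matrix.mul_add, g.act_mul_den hZ, Matrix.sub_mul, Matrix.mul_assoc]
  abel

end PseudoUnitary

end Mobius

/-! ### Holomorphy and Jacobian of Möbius transformations -/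

section MobiusDiff

variable {E : Type*} [NormedAddCommGroup E] [NormedSpace ℂ E]
variable {α β γ : Type} [Fintype α] [DecidableEq α] [Fintype β] [DecidableEq β] [Fintype γ]

theorem differentiableAt_det {M : E → Matrix α α ℂ} {x : E}
    (h : ∀ i j, DifferentiableAt ℂ (fun y => M y i j) x) :
    DifferentiableAt ℂ (fun y => (M y).det) x := by
  have h1 : DifferentiableAt ℂ (fun y => (M y : α → α → ℂ)) x :=
    differentiableAt_pi.2 fun i => differentiableAt_pi.2 fun j => h i j
  exact ((contDiff_det (κ := α) (k := 1)).differentiable one_ne_zero _).comp x h1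

theorem differentiableAt_matrix_mul {M : E → Matrix α β ℂ} {M' : E → Matrix β γ ℂ} {x : E}
    (h : ∀ i j, DifferentiableAt ℂ (fun y => M y i j) x)
    (h' : ∀ i j, DifferentiableAt ℂ (fun y => M' y i j) x) (i : α) (j : γ) :
    DifferentiableAt ℂ (fun y => (M y * M' y) i j) x := by
  simp only [Matrix.mul_apply]
  exact DifferentiableAt.fun_sum fun k _ => (h i k).mul (h' k j)

/-- By Cramer's rule the entries of the inverse are quotients of determinants. -/
theorem differentiableAt_matrix_inv {M : E → Matrix α α ℂ} {x : E}
    (h : ∀ i j, DifferentiableAt ℂ (fun y => M y i j) x) (hx : IsUnit (M x).det) (i j : α) :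
    DifferentiableAt ℂ (fun y => (M y)⁻¹ i j) x := by
  have h1 : (fun y => (M y)⁻¹ i j) = fun y => (M y).det⁻¹ *
      ((M y).updateRow j (Pi.single i 1)).det := by
    funext y
    rw [Matrix.inv_def, Ring.inverse_eq_inv', Matrix.smul_apply, smul_eq_mul, Matrix.adjugate_apply]
  rw [h1]
  refine ((differentiableAt_det h).inv hx.ne_zero).mul (differentiableAt_det fun a b => ?_)
  by_cases ha : a = j
  · subst ha
    simp
  · simpa [Matrix.updateRow_ne ha] using h a b

namespace PseudoUnitary

variable (g : PseudoUnitary α β)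

theorem differentiableAt_den {Zf : E → Matrix α β ℂ} {x : E}
    (h : ∀ i j, DifferentiableAt ℂ (fun y => Zf y i j) x) (i j : β) :
    DifferentiableAt ℂ (fun y => g.den (Zf y) i j) x := by
  simp only [den, Matrix.add_apply]
  exact (differentiableAt_matrix_mul (M := fun _ => g.C) (fun _ _ => differentiableAt_const _)
    h i j).add_const _

theorem differentiableAt_act {Zf : E → Matrix α β ℂ} {x : E}
    (h : ∀ i j, DifferentiableAt ℂ (fun y => Zf y i j) x) (hx : IsUnit (g.den (Zf x)).det)
    (i : α) (j : β) : DifferentiableAt ℂ (fun y => g.act (Zf y) i j) x := by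
  refine differentiableAt_matrix_mul (fun i j => ?_)
    (differentiableAt_matrix_inv (g.differentiableAt_den h) hx) i j
  simp only [num, Matrix.add_apply]
  exact (differentiableAt_matrix_mul (M := fun _ => g.A) (fun _ _ => differentiableAt_const _)
    h i j).add_const _

theorem hasDerivAt_act {Z : Matrix α β ℂ} (hZ : (1 - Zᴴ * Z).PosDef) (H : Matrix α β ℂ) (i : α)
    (j : β) : HasDerivAt (fun t : ℂ => g.act (Z + t • H) i j)
      (((g.A - g.act Z * g.C) * H * (g.den Z)⁻¹) i j) 0 := by
  have hl : ∀ i j, DifferentiableAt ℂ (fun t : ℂ => (Z + t • H) i j) 0 := fun i j => by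
    simp only [Matrix.add_apply, Matrix.smul_apply, smul_eq_mul]
    fun_prop
  have h0 : IsUnit (g.den (Z + (0 : ℂ) • H)).det := by
    rw [zero_smul, add_zero]
    exact g.isUnit_det_den hZ
  have hd : DifferentiableAt ℂ (fun t : ℂ => ((g.A - g.act Z * g.C) * H * (g.den (Z + t • H))⁻¹) i j) 0 :=
    differentiableAt_matrix_mul (M := fun _ => (g.A - g.act Z * g.C) * H)
      (fun _ _ => differentiableAt_const _)
      (differentiableAt_matrix_inv (g.differentiableAt_den hl) h0) i j
  have h1 := ((hasDerivAt_id (0 : ℂ)).mul hd.hasDerivAt).const_add (g.act Z i j)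
  simp only [id_eq, one_mul, zero_mul, add_zero, zero_smul] at h1
  refine h1.congr_of_eventuallyEq ?_
  have hu : ∀ᶠ t : ℂ in 𝓝 0, (g.den (Z + t • H)).det ≠ 0 :=
    (differentiableAt_det (g.differentiableAt_den hl)).continuousAt.eventually_ne h0.ne_zero
  filter_upwards [hu] with t ht
  have h2 := congrFun (congrFun (g.act_sub_act hZ (isUnit_iff_ne_zero.2 ht)) i) j
  rw [Matrix.sub_apply, add_sub_cancel_left, Matrix.mul_smul, Matrix.smul_mul, Matrix.smul_apply,
    smul_eq_mul] at h2
  simp only [Pi.mul_apply, id_eq]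
  rw [← h2]
  ring

end PseudoUnitary

end MobiusDiff

/-! ### Automorphisms of the Cartan–Hartogs domain -/

section Automorphisms

variable {N m n : ℕ} {K : ℝ}

/-- Biholomorphic self-maps of `Y_I` preserving `X` and the form of the kernel. -/
structure IsAdapted (N m n : ℕ) (K : ℝ) (f g : (Idx N m n → ℂ) → (Idx N m n → ℂ)) : Prop
    extends IsBiholo (domainY N m n K) f g where
  jac_eq : ∀ p ∈ domainY N m n K, ‖jac f p‖ ^ 2 * genNorm p ^ ((m : ℝ) + n + N / K) =
    genNorm (f p) ^ ((m : ℝ) + n + N / K)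
  varX_eq : ∀ p ∈ domainY N m n K, varX K (f p) = varX K p

theorem IsAdapted.comp (hK : 0 < K) {f g f' g' : (Idx N m n → ℂ) → (Idx N m n → ℂ)}
    (h : IsAdapted N m n K f g) (h' : IsAdapted N m n K f' g') :
    IsAdapted N m n K (fun q => f' (f q)) (fun q => g (g' q)) where
  toIsBiholo := h.toIsBiholo.comp h'.toIsBiholo
  jac_eq p hp := by
    have hΩ := isOpen_domainY (N := N) (m := m) (n := n) hK
    rw [jac_comp (h'.diff.differentiableAt (hΩ.mem_nhds (h.maps hp)))
      (h.diff.differentiableAt (hΩ.mem_nhds hp)), norm_mul, mul_pow, mul_assoc, h.jac_eq p hp,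
      h'.jac_eq _ (h.maps hp)]
  varX_eq p hp := by rw [h'.varX_eq _ (h.maps hp), h.varX_eq p hp]

theorem isAdapted_id : IsAdapted N m n K (fun q => q) (fun q => q) where
  diff := differentiableOn_id
  diff' := differentiableOn_id
  maps := fun _ h => h
  maps' := fun _ h => h
  inv := ⟨fun _ _ => rfl, fun _ _ => rfl⟩
  jac_eq p hp := by
    have : jac (fun q : Idx N m n → ℂ => q) p = 1 := by
      rw [jac_eq_det, fderiv_fun_id]
      exact LinearMap.det_id
    rw [this]
    simp
  varX_eq p hp := rfl

theorem posDef_conj_of_mem {p : Idx N m n → ℂ} (hp : matZ p ∈ cartanI m n) :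
    (1 - (matZ p)ᴴ * matZ p).PosDef := (posDef_one_sub_comm _).1 hp

/-- The lift of a Möbius transformation to `Y_I`; `lg` is a logarithm of its denominator. -/
def lift (K : ℝ) (g : PseudoUnitary (Fin m) (Fin n)) (lg : Matrix (Fin m) (Fin n) ℂ → ℂ)
    (p : Idx N m n → ℂ) : Idx N m n → ℂ :=
  Sum.elim (fun j => Complex.exp (-lg (matZ p) / K) * p (Sum.inl j)) fun i => g.act (matZ p) i.1 i.2

/-- The inverse of `lift`. -/
def liftInv (K : ℝ) (g : PseudoUnitary (Fin m) (Fin n)) (lg : Matrix (Fin m) (Fin n) ℂ → ℂ)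
    (p : Idx N m n → ℂ) : Idx N m n → ℂ :=
  Sum.elim (fun j => Complex.exp (lg (g.inv.act (matZ p)) / K) * p (Sum.inl j))
    fun i => g.inv.act (matZ p) i.1 i.2

variable {g : PseudoUnitary (Fin m) (Fin n)} {lg : Matrix (Fin m) (Fin n) ℂ → ℂ}

theorem genNorm_eq {p : Idx N m n → ℂ} : genNorm p = (1 - (matZ p)ᴴ * matZ p).det.re := by
  rw [genNorm, det_one_sub_comm]

theorem genNorm_of_act {p q : Idx N m n → ℂ} (hp : matZ p ∈ cartanI m n)
    (hl : Complex.exp (lg (matZ p)) = (g.den (matZ p)).det) (hq : matZ q = g.act (matZ p)) :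
    genNorm p = Real.exp (2 * (lg (matZ p)).re) * genNorm q := by
  rw [genNorm_eq, genNorm_eq, hq, ← g.det_act (posDef_conj_of_mem hp), ← hl, Complex.norm_exp,
    ← Real.exp_nat_mul]
  norm_num

theorem normSqW_of_smul {p q : Idx N m n → ℂ} {r : ℂ}
    (hq : ∀ j, q (Sum.inl j) = Complex.exp r * p (Sum.inl j)) :
    normSqW q = Real.exp (2 * r.re) * normSqW p := by
  rw [normSqW, normSqW, Finset.mul_sum]
  refine Finset.sum_congr rfl fun j _ => ?_
  rw [hq, norm_mul, mul_pow, Complex.norm_exp, ← Real.exp_nat_mul]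
  norm_num

/-- The factor on `W` is chosen so that `|W|^{2K}` and `det (I - Z Z̄ᵗ)` are both multiplied by
`e^{-2r}`. -/
theorem mem_domainY_scaling (hK : 0 < K) {p q : Idx N m n → ℂ} {r : ℝ}
    (hb : genNorm p = Real.exp (2 * r) * genNorm q)
    (hW : normSqW q = Real.exp (2 * (-r / K)) * normSqW p) (hZ : matZ q ∈ cartanI m n) :
    (q ∈ domainY N m n K ↔ normSqW p ^ K < genNorm p) := by
  have h1 : normSqW q ^ K = Real.exp (-(2 * r)) * normSqW p ^ K := by
    rw [hW, Real.mul_rpow (Real.exp_pos _).le (normSqW_nonneg p), ← Real.exp_mul]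
    congr 2
    field_simp
  have h2 : genNorm q = Real.exp (-(2 * r)) * genNorm p := by
    rw [hb, ← mul_assoc, ← Real.exp_add]
    simp
  show (matZ q ∈ cartanI m n ∧ normSqW q ^ K < genNorm q) ↔ _
  rw [h1, h2, mul_lt_mul_iff_right₀ (Real.exp_pos _)]
  exact and_iff_right hZ

theorem varX_scaling (hK : 0 < K) {p q : Idx N m n → ℂ} {r : ℝ}
    (hb : genNorm p = Real.exp (2 * r) * genNorm q)
    (hW : normSqW q = Real.exp (2 * (-r / K)) * normSqW p) (hq : 0 < genNorm q) :
    varX K q = varX K p := by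
  rw [varX, varX, hb, hW, Real.mul_rpow (Real.exp_pos _).le hq.le, ← Real.exp_mul]
  have : Real.exp (2 * (-r / K)) = Real.exp (2 * r * -(1 / K)) := by
    congr 1
    ring
  rw [this]
  ring

theorem act_mem_cartanI {Z : Matrix (Fin m) (Fin n) ℂ} (hZ : Z ∈ cartanI m n) :
    g.act Z ∈ cartanI m n :=
  (posDef_one_sub_comm _).2 (g.posDef_act ((posDef_one_sub_comm _).1 hZ))

theorem differentiableAt_matZ (p : Idx N m n → ℂ) (i : Fin m) (j : Fin n) :
    DifferentiableAt ℂ (fun q : Idx N m n → ℂ => matZ q i j) p := by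
  simp only [matZ, Matrix.of_apply]
  fun_prop

/-- The Jacobian matrix is block triangular: a scalar block on `W`, and on `Z` the Kronecker product
of the left and right factors of the differential of the Möbius map. -/
theorem jacobian_lift (hK : 0 < K)
    (hd : DifferentiableOn ℂ (fun p : Idx N m n → ℂ => lg (matZ p)) {p | matZ p ∈ cartanI m n})
    {p : Idx N m n → ℂ} (hp : p ∈ domainY N m n K) (hF : DifferentiableAt ℂ (lift K g lg) p) :
    ‖jac (lift K g lg) p‖ = ‖Complex.exp (-lg (matZ p) / K)‖ ^ N * (‖(g.den (matZ p)).det‖⁻¹) ^ (m + n) := by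
  have hZ := posDef_conj_of_mem hp.1
  set L := g.A - g.act (matZ p) * g.C with hL
  set Q := (g.den (matZ p))⁻¹ with hQ
  set e := Complex.exp (-lg (matZ p) / K) with he
  have hline : ∀ v : Idx N m n → ℂ, HasDerivAt (fun t : ℂ => lift K g lg (p + t • v))
      (fderiv ℂ (lift K g lg) p v) 0 := by
    intro v
    have h1 : HasDerivAt (fun t : ℂ => p + t • v) v 0 := by
      simpa using ((hasDerivAt_id (0 : ℂ)).smul_const v).const_add p
    have h2 : HasFDerivAt (lift K g lg) (fderiv ℂ (lift K g lg) p) (p + (0 : ℂ) • v) := by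
      simpa using hF.hasFDerivAt
    exact h2.comp_hasDerivAt (0 : ℂ) h1
  have hZlin : ∀ (v : Idx N m n → ℂ) (t : ℂ), matZ (p + t • v) = matZ p + t • matZ v := fun v t => by
    ext i j
    simp [matZ]
  have hr : ∀ (v : Idx N m n → ℂ) (i : Fin m × Fin n),
      fderiv ℂ (lift K g lg) p v (Sum.inr i) = (L * matZ v * Q) i.1 i.2 := by
    intro v i
    have h1 := hasDerivAt_pi.1 (hline v) (Sum.inr i)
    have h2 := g.hasDerivAt_act hZ (matZ v) i.1 i.2
    refine h1.unique ?_
    simp only [lift, Sum.elim_inr, hZlin]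
    exact h2
  have hl : ∀ (b a : Fin N), fderiv ℂ (lift K g lg) p (Pi.single (Sum.inl b) 1) (Sum.inl a) =
      e * (1 : Matrix (Fin N) (Fin N) ℂ) a b := by
    intro b a
    have h1 := hasDerivAt_pi.1 (hline (Pi.single (Sum.inl b) 1)) (Sum.inl a)
    have h3 : matZ (Pi.single (Sum.inl b) 1 : Idx N m n → ℂ) = 0 := by
      ext i j
      simp [matZ]
    refine h1.unique ?_
    simp only [lift, Sum.elim_inl, hZlin, h3, smul_zero, add_zero]
    refine HasDerivAt.const_mul _ ?_
    by_cases hab : a = b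
    · subst hab
      simpa using (hasDerivAt_id (0 : ℂ)).const_add (p (Sum.inl a))
    · simpa [hab] using hasDerivAt_const (0 : ℂ) (p (Sum.inl a))
  have hJ : jacobian (lift K g lg) p = Matrix.fromBlocks (e • (1 : Matrix (Fin N) (Fin N) ℂ))
      (Matrix.of fun a j => fderiv ℂ (lift K g lg) p (Pi.single (Sum.inr j) 1) (Sum.inl a)) 0
      (Matrix.kroneckerMap (· * ·) L Qᵀ) := by
    ext i j
    rw [jacobian, LinearMap.toMatrix'_apply]
    have hs : (fun j' => if j' = j then (1 : ℂ) else 0) = Pi.single j 1 := by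
      funext k
      simp [Pi.single_apply]
    rcases i with a | i <;> rcases j with b | j
    · exact hl b a
    · rfl
    · refine (hr _ i).trans ?_
      have h3 : matZ (Pi.single (Sum.inl b) 1 : Idx N m n → ℂ) = 0 := by
        ext i j
        simp [matZ]
      rw [h3]
      simp
    · refine (hr _ i).trans ?_
      have h3 : matZ (Pi.single (Sum.inr j) 1 : Idx N m n → ℂ) = Matrix.single j.1 j.2 1 := by
        ext k l
        rcases j with ⟨j1, j2⟩
        simp only [matZ, Matrix.of_apply, Matrix.single_apply, Pi.single_apply, Sum.inr.injEq,
          Prod.mk.injEq]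
        congr 1
        simp only [eq_comm]
      rw [h3, Matrix.fromBlocks_apply₂₂, Matrix.kroneckerMap_apply, Matrix.transpose_apply]
      simp [Matrix.mul_apply, Matrix.single_apply, Finset.sum_ite_eq, ite_and]
  rw [jac, hJ, Matrix.det_fromBlocks_zero₂₁, Matrix.det_smul, Matrix.det_one, mul_one]
  have hk := Matrix.det_kronecker L Qᵀ
  rw [show (Matrix.kroneckerMap (· * ·) L Qᵀ).det = L.det ^ Fintype.card (Fin n) *
    Qᵀ.det ^ Fintype.card (Fin m) from hk, Matrix.det_transpose, norm_mul, norm_mul, norm_pow,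
    norm_pow, norm_pow, hL, g.norm_det_left hZ, hQ, Matrix.det_nonsing_inv, Ring.inverse_eq_inv',
    norm_inv]
  simp only [Fintype.card_fin]
  ring

theorem isAdapted_lift (hK : 0 < K)
    (hd : DifferentiableOn ℂ (fun p : Idx N m n → ℂ => lg (matZ p)) {p | matZ p ∈ cartanI m n})
    (hl : ∀ Z ∈ cartanI m n, Complex.exp (lg Z) = (g.den Z).det) :
    IsAdapted N m n K (lift K g lg) (liftInv K g lg) := by
  have hΩ := isOpen_domainY (N := N) (m := m) (n := n) hK
  have hO : IsOpen {p : Idx N m n → ℂ | matZ p ∈ cartanI m n} := by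
    exact isOpen_posDef (continuous_one_sub (continuous_matZ (N := N) (m := m) (n := n)))
      fun t => isHermitian_one_sub _
  have hK0 : (K : ℂ) ≠ 0 := by exact_mod_cast hK.ne'
  have hb : ∀ p ∈ domainY N m n K,
      genNorm p = Real.exp (2 * (lg (matZ p)).re) * genNorm (lift K g lg p) := fun p hp =>
    genNorm_of_act hp.1 (hl _ hp.1) rfl
  have hW : ∀ p : Idx N m n → ℂ,
      normSqW (lift K g lg p) = Real.exp (2 * (-(lg (matZ p)).re / K)) * normSqW p := fun p => by
    rw [normSqW_of_smul (p := p) (q := lift K g lg p) (r := -lg (matZ p) / K) fun j => rfl,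
      Complex.div_ofReal_re, Complex.neg_re]
  have hinv1 : ∀ Z ∈ cartanI m n, g.inv.act (g.act Z) = Z := fun Z hZ =>
    g.inv_act_act ((posDef_one_sub_comm _).1 hZ)
  have hinv2 : ∀ Z ∈ cartanI m n, g.act (g.inv.act Z) = Z := fun Z hZ => by
    have := g.inv.inv_act_act ((posDef_one_sub_comm _).1 hZ)
    rwa [g.inv_inv] at this
  have hLR : ∀ p : Idx N m n → ℂ, matZ p ∈ cartanI m n → liftInv K g lg (lift K g lg p) = p := by
    intro p hp
    funext i
    rcases i with j | i
    · show Complex.exp (lg (g.inv.act (g.act (matZ p))) / K) *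
        (Complex.exp (-lg (matZ p) / K) * p (Sum.inl j)) = _
      rw [hinv1 _ hp, ← mul_assoc, ← Complex.exp_add, neg_div, add_neg_cancel, Complex.exp_zero,
        one_mul]
    · show g.inv.act (g.act (matZ p)) i.1 i.2 = _
      rw [hinv1 _ hp]
      rfl
  have hRL : ∀ p : Idx N m n → ℂ, matZ p ∈ cartanI m n → lift K g lg (liftInv K g lg p) = p := by
    intro p hp
    funext i
    rcases i with j | i
    · show Complex.exp (-lg (g.inv.act (matZ p)) / K) *
        (Complex.exp (lg (g.inv.act (matZ p)) / K) * p (Sum.inl j)) = _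
      rw [← mul_assoc, ← Complex.exp_add, neg_div, neg_add_cancel, Complex.exp_zero, one_mul]
    · show g.act (g.inv.act (matZ p)) i.1 i.2 = _
      rw [hinv2 _ hp]
      rfl
  have hmaps : MapsTo (lift K g lg) (domainY N m n K) (domainY N m n K) := fun p hp =>
    (mem_domainY_scaling hK (hb p hp) (hW p) (act_mem_cartanI hp.1)).2 hp.2
  have hmaps' : MapsTo (liftInv K g lg) (domainY N m n K) (domainY N m n K) := by
    intro p hp
    have hq : matZ (liftInv K g lg p) ∈ cartanI m n := act_mem_cartanI (g := g.inv) hp.1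
    have h1 := genNorm_of_act (p := liftInv K g lg p) (q := p) hq (hl _ hq) (hinv2 _ hp.1).symm
    have h2 := hW (liftInv K g lg p)
    rw [hRL p hp.1] at h2
    exact ⟨hq, (mem_domainY_scaling hK h1 h2 hp.1).1 hp⟩
  have hdiff : DifferentiableOn ℂ (lift K g lg) (domainY N m n K) := by
    refine fun p hp => DifferentiableAt.differentiableWithinAt (differentiableAt_pi.2 fun i => ?_)
    have h1 := hd.differentiableAt (hO.mem_nhds hp.1)
    rcases i with j | i
    · simp only [lift, Sum.elim_inl]
      simp only [div_eq_mul_inv]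
      exact ((h1.neg.mul_const _).cexp).mul (by fun_prop)
    · simp only [lift, Sum.elim_inr]
      exact g.differentiableAt_act (differentiableAt_matZ p) (g.isUnit_det_den
        (posDef_conj_of_mem hp.1)) _ _
  have hdiff' : DifferentiableOn ℂ (liftInv K g lg) (domainY N m n K) := by
    refine fun p hp => DifferentiableAt.differentiableWithinAt (differentiableAt_pi.2 fun i => ?_)
    have hact := g.inv.differentiableAt_act (differentiableAt_matZ p) (g.inv.isUnit_det_den
        (posDef_conj_of_mem hp.1))
    rcases i with j | i
    · simp only [liftInv, Sum.elim_inl]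
      -- The logarithm is known to be holomorphic only as a function on `ℂ^N × ℂ^{m×n}`, so it is
      -- evaluated along the auxiliary point `(0, g⁻¹ Z)`.
      have h2 : DifferentiableAt ℂ (fun q : Idx N m n → ℂ =>
          (Sum.elim 0 fun i => g.inv.act (matZ q) i.1 i.2 : Idx N m n → ℂ)) p := by
        refine differentiableAt_pi.2 fun i => ?_
        rcases i with j | i
        · exact differentiableAt_const _
        · exact hact _ _
      have h1 : DifferentiableAt ℂ (fun p : Idx N m n → ℂ => lg (matZ p))
          (Sum.elim 0 fun i => g.inv.act (matZ p) i.1 i.2) :=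
        hd.differentiableAt (hO.mem_nhds (act_mem_cartanI (g := g.inv) hp.1))
      simp only [div_eq_mul_inv]
      exact (((h1.comp p h2).mul_const _).cexp).mul (by fun_prop)
    · simp only [liftInv, Sum.elim_inr]
      exact hact _ _
  refine ⟨⟨hdiff, hdiff', hmaps, hmaps', fun p hp => hLR p hp.1, fun p hp => hRL p hp.1⟩,
    fun p hp => ?_, fun p hp => varX_scaling hK (hb p hp) (hW p) (genNorm_pos (hmaps hp).1)⟩
  have hq := genNorm_pos (hmaps hp).1
  -- With `ρ = Re lg`, the squared Jacobian is `exp (-2ρ (N/K + m + n))`, which cancels the factor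
  -- produced by the power of `det (I - Z Z̄ᵗ)`.
  rw [jacobian_lift hK hd hp (hdiff.differentiableAt (hΩ.mem_nhds hp)), hb p hp,
    Real.mul_rpow (Real.exp_pos _).le hq.le, ← hl _ hp.1, Complex.norm_exp, Complex.norm_exp,
    Complex.div_ofReal_re, Complex.neg_re, ← Real.exp_neg, ← Real.exp_nat_mul, ← Real.exp_nat_mul,
    ← Real.exp_add, ← Real.exp_nat_mul, ← Real.exp_mul, ← mul_assoc, ← Real.exp_add]
  convert! one_mul _ using 2
  rw [Real.exp_eq_one_iff]
  push_cast
  ring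

end Automorphisms

/-! ### Normalization of points -/

section Boost

variable {α β : Type} [Fintype α] [DecidableEq α] [Fintype β] [DecidableEq β]

/-- The matrix whose only nonzero row is the row `e`, equal to `v`. -/
def rowMatrix (e : α) (v : β → ℂ) : Matrix α β ℂ := Matrix.vecMulVec (Pi.single e 1) v

theorem rowMatrix_conj (e : α) (v : β → ℂ) :
    (rowMatrix e v)ᴴ = Matrix.vecMulVec (star v) (Pi.single e 1) := by
  rw [rowMatrix, Matrix.conjTranspose_vecMulVec]
  congr 1
  funext i
  by_cases h : i = e
  · subst h; simp
  · simp [h]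

theorem rowMatrix_mul_conj_mul (e : α) (v : β → ℂ) :
    rowMatrix e v * (rowMatrix e v)ᴴ * rowMatrix e v =
      ((∑ j, ‖v j‖ ^ 2 : ℝ) : ℂ) • rowMatrix e v := by
  have h : v ⬝ᵥ star v = ((∑ j, ‖v j‖ ^ 2 : ℝ) : ℂ) := by
    rw [dotProduct]
    push_cast
    exact Finset.sum_congr rfl fun j _ => Complex.mul_conj' _
  rw [rowMatrix_conj, rowMatrix, Matrix.vecMulVec_mul_vecMulVec, h,
    Matrix.vecMulVec_mul_vecMulVec, smul_dotProduct]
  simp [Matrix.vecMulVec_smul]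

/-- Here `r = (1-ν)^{-1/2}` and `a = (r-1)/ν`, the latter written so that `ν = 0` needs no separate
treatment. The second relation makes the boost pseudo-unitary; the first lets it send the chosen row
to 0. -/
theorem exists_boost_coeff {ν : ℝ} (hν : ν < 1) :
    ∃ a r : ℝ, 1 + a * ν = r ∧ 2 * a + a ^ 2 * ν = r ^ 2 := by
  have hs : 0 < √(1 - ν) := Real.sqrt_pos.2 (by linarith)
  have hs2 : √(1 - ν) ^ 2 = 1 - ν := Real.sq_sqrt (by linarith)
  refine ⟨1 / (√(1 - ν) * (1 + √(1 - ν))), 1 / √(1 - ν), ?_, ?_⟩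
  · field_simp
    linear_combination hs2
  · field_simp
    linear_combination hs2

/-- The boost attached to a matrix `E` with `E E* E = ν E`. -/
def boost (E : Matrix α β ℂ) (a r ν : ℝ) (hE : E * Eᴴ * E = (ν : ℂ) • E)
    (h : 2 * a + a ^ 2 * ν = r ^ 2) : PseudoUnitary α β :=
  have hc : 2 * (a : ℂ) + (a : ℂ) ^ 2 * ν = (r : ℂ) ^ 2 := by exact_mod_cast h
  have hE' : Eᴴ * E * Eᴴ = (ν : ℂ) • Eᴴ := by
    have := congrArg Matrix.conjTranspose hE
    simpa [Matrix.mul_assoc] using this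
  PseudoUnitary.mk' (1 + (a : ℂ) • (E * Eᴴ)) (-(r : ℂ) • E) (-(r : ℂ) • Eᴴ)
    (1 + (a : ℂ) • (Eᴴ * E))
    (by
      have hT : Eᴴ * E * (Eᴴ * E) = (ν : ℂ) • (Eᴴ * E) := by
        rw [← Matrix.mul_assoc, hE', Matrix.smul_mul]
      simp only [Matrix.conjTranspose_add, Matrix.conjTranspose_smul, Matrix.conjTranspose_mul,
        Matrix.conjTranspose_one, Matrix.conjTranspose_conjTranspose, star_neg, Complex.star_def,
        Complex.conj_ofReal, add_mul, mul_add, one_mul, mul_one, Matrix.smul_mul, Matrix.mul_smul,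
        hT]
      have h2 : (2 * (a : ℂ) + (a : ℂ) ^ 2 * ν) • (Eᴴ * E) = ((r : ℂ) ^ 2) • (Eᴴ * E) := by rw [hc]
      linear_combination (norm := module) h2)
    (by
      have hT : E * Eᴴ * (E * Eᴴ) = (ν : ℂ) • (E * Eᴴ) := by
        rw [← Matrix.mul_assoc, hE, Matrix.smul_mul]
      simp only [Matrix.conjTranspose_add, Matrix.conjTranspose_smul, Matrix.conjTranspose_mul,
        Matrix.conjTranspose_one, Matrix.conjTranspose_conjTranspose, star_neg, Complex.star_def,
        Complex.conj_ofReal, add_mul, mul_add, one_mul, mul_one, Matrix.smul_mul, Matrix.mul_smul,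
        hT]
      have h2 : (2 * (a : ℂ) + (a : ℂ) ^ 2 * ν) • (E * Eᴴ) = ((r : ℂ) ^ 2) • (E * Eᴴ) := by rw [hc]
      linear_combination (norm := module) h2)
    (by
      simp only [Matrix.conjTranspose_add, Matrix.conjTranspose_smul, Matrix.conjTranspose_mul,
        Matrix.conjTranspose_one, Matrix.conjTranspose_conjTranspose, star_neg, Complex.star_def,
        Complex.conj_ofReal, Matrix.add_mul, Matrix.mul_add, Matrix.one_mul, Matrix.mul_one,
        Matrix.smul_mul, Matrix.mul_smul, Matrix.mul_assoc]
      module)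

variable {E : Matrix α β ℂ} {a r ν : ℝ} (hE : E * Eᴴ * E = (ν : ℂ) • E)
  (h : 2 * a + a ^ 2 * ν = r ^ 2)

/-- The denominator is a constant matrix times `1 - Eᴴ Z`. For a single row its determinant is
therefore a constant times `1 - ⟨Z_e, v⟩`, which has positive real part, so the principal logarithm
serves in the lift. -/
theorem boost_den (h1 : 1 + a * ν = r) (Z : Matrix α β ℂ) :
    (boost E a r ν hE h).den Z = (boost E a r ν hE h).D * (1 - Eᴴ * Z) := by
  have hE' : Eᴴ * E * Eᴴ = (ν : ℂ) • Eᴴ := by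
    have := congrArg Matrix.conjTranspose hE
    simpa [Matrix.mul_assoc] using this
  have hc' : 1 + (a : ℂ) * ν = r := by exact_mod_cast h1
  show -(r : ℂ) • Eᴴ * Z + (1 + (a : ℂ) • (Eᴴ * E)) = (1 + (a : ℂ) • (Eᴴ * E)) * (1 - Eᴴ * Z)
  rw [← hc', Matrix.mul_sub, ← Matrix.mul_assoc, Matrix.add_mul _ _ Eᴴ, Matrix.smul_mul _ _ Eᴴ, hE',
    Matrix.one_mul, Matrix.mul_one, Matrix.add_mul, Matrix.smul_mul, Matrix.smul_mul, Matrix.smul_mul]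
  module

theorem boost_det_D_ne_zero (h1 : 1 + a * ν = r) : (boost E a r ν hE h).D.det ≠ 0 := by
  have h := (boost E a r ν hE h).isUnit_det_den (Z := 0) (by
    rw [Matrix.mul_zero, sub_zero]; exact Matrix.PosDef.one)
  rw [boost_den _ _ h1, Matrix.mul_zero, sub_zero, Matrix.mul_one] at h
  exact h.ne_zero

theorem boost_num (Z : Matrix α β ℂ) :
    (boost E a r ν hE h).num Z = Z + (a : ℂ) • (E * (Eᴴ * Z)) - (r : ℂ) • E := by
  show (1 + (a : ℂ) • (E * Eᴴ)) * Z + (-(r : ℂ) • E) = _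
  rw [Matrix.add_mul, Matrix.one_mul, Matrix.smul_mul, Matrix.mul_assoc]
  module

/-- The boost attached to a single row kills this row. -/
theorem boost_row_num {e : α} {Z : Matrix α β ℂ} (h : 2 * a + a ^ 2 * ∑ j, ‖Z e j‖ ^ 2 = r ^ 2)
    (h1 : 1 + a * ∑ j, ‖Z e j‖ ^ 2 = r) (i : α) (hi : i = e ∨ Z i = 0) (j : β) :
    (boost (rowMatrix e (Z e)) a r _ (rowMatrix_mul_conj_mul e (Z e)) h).num Z i j = 0 := by
  rw [boost_num]
  have h2 : rowMatrix e (Z e) * ((rowMatrix e (Z e))ᴴ * Z) =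
      ((∑ j, ‖Z e j‖ ^ 2 : ℝ) : ℂ) • rowMatrix e (Z e) := by
    rw [← rowMatrix_mul_conj_mul, Matrix.mul_assoc]
    congr 1
    rw [rowMatrix_conj, Matrix.vecMulVec_mul, rowMatrix, Matrix.vecMulVec_mul_vecMulVec]
    simp [Matrix.single_one_vecMul, Matrix.row]
  rw [h2]
  by_cases he : i = e
  · subst he
    simp only [Matrix.sub_apply, Matrix.add_apply, Matrix.smul_apply, rowMatrix,
      Matrix.vecMulVec_apply, Pi.single_eq_same, one_mul, smul_eq_mul]
    have hc' : 1 + (a : ℂ) * ((∑ j, ‖Z i j‖ ^ 2 : ℝ) : ℂ) = r := by exact_mod_cast h1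
    linear_combination (Z i j) * hc'
  · have h3 : Z i = 0 := hi.resolve_left he
    simp [rowMatrix, Matrix.vecMulVec_apply, he, h3]

theorem boost_row_act {e : α} {Z : Matrix α β ℂ} (h : 2 * a + a ^ 2 * ∑ j, ‖Z e j‖ ^ 2 = r ^ 2)
    (h1 : 1 + a * ∑ j, ‖Z e j‖ ^ 2 = r) (i : α) (hi : i = e ∨ Z i = 0) :
    (boost (rowMatrix e (Z e)) a r _ (rowMatrix_mul_conj_mul e (Z e)) h).act Z i = 0 := by
  funext j
  rw [PseudoUnitary.act, Matrix.mul_apply]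
  exact Finset.sum_eq_zero fun k _ => by rw [boost_row_num h h1 i hi, zero_mul]

theorem det_one_sub_rowMatrix (e : α) (v : β → ℂ) (Z : Matrix α β ℂ) :
    (1 - (rowMatrix e v)ᴴ * Z).det = 1 - ∑ j, Z e j * conj (v j) := by
  have h : (rowMatrix e v)ᴴ * Z = Matrix.replicateCol Unit (star v) * Matrix.replicateRow Unit (Z e) := by
    rw [rowMatrix_conj, Matrix.vecMulVec_mul, Matrix.single_one_vecMul, Matrix.vecMulVec_eq Unit]
    rfl
  rw [h, Matrix.det_one_sub_mul_comm, Matrix.det_unique]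
  simp [Matrix.mul_apply]

theorem re_one_sub_pos {v w : β → ℂ} (hv : ∑ j, ‖v j‖ ^ 2 < 1) (hw : ∑ j, ‖w j‖ ^ 2 < 1) :
    0 < (1 - ∑ j, w j * conj (v j)).re := by
  have h1 : ‖∑ j, w j * conj (v j)‖ ≤ ∑ j, (‖w j‖ ^ 2 + ‖v j‖ ^ 2) / 2 := by
    refine (norm_sum_le _ _).trans (Finset.sum_le_sum fun j _ => ?_)
    rw [norm_mul, RCLike.norm_conj]
    nlinarith [sq_nonneg (‖w j‖ - ‖v j‖)]
  rw [← Finset.sum_div, Finset.sum_add_distrib] at h1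
  have h2 := Complex.re_le_norm (∑ j, w j * conj (v j))
  rw [Complex.sub_re, Complex.one_re]
  linarith

end Boost

/-! ### Moving points to `(√X e₁, 0)` -/

section Normalize

variable {N m n : ℕ} {K : ℝ}

/-- The boost attached to row `e` of `Z` sends that row to 0 and leaves rows that already vanish at
0, so the rows can be removed one after another. -/
theorem exists_isAdapted_row (hK : 0 < K) {p : Idx N m n → ℂ} (hp : p ∈ domainY N m n K)
    (e : Fin m) : ∃ f g, IsAdapted N m n K f g ∧
      ∀ i, i = e ∨ matZ p i = 0 → matZ (f p) i = 0 := by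
  have hrow : ∀ Z ∈ cartanI m n, ∑ j, ‖Z e j‖ ^ 2 < 1 := fun Z hZ => sum_normSq_row_lt_one hZ e
  set v := matZ p e with hv
  obtain ⟨a, r, hr1, hr2⟩ := exists_boost_coeff (hrow _ hp.1)
  set B := boost (rowMatrix e v) a r _ (rowMatrix_mul_conj_mul e v) hr2 with hB
  set lg : Matrix (Fin m) (Fin n) ℂ → ℂ := fun Z =>
    Complex.log B.D.det + Complex.log (1 - ∑ j, Z e j * conj (v j)) with hlg
  have hpos : ∀ Z ∈ cartanI m n, 1 - ∑ j, Z e j * conj (v j) ∈ Complex.slitPlane := fun Z hZ =>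
    Or.inl (re_one_sub_pos (hrow _ hp.1) (hrow Z hZ))
  refine ⟨_, _, isAdapted_lift (g := B) (lg := lg) hK (fun q hq => ?_) (fun Z hZ => ?_), fun i hi => ?_⟩
  · refine DifferentiableAt.differentiableWithinAt ?_
    have h1 : DifferentiableAt ℂ (fun q : Idx N m n → ℂ => 1 - ∑ j, matZ q e j * conj (v j)) q :=
      (DifferentiableAt.fun_sum fun j _ => (differentiableAt_matZ q e j).mul_const _).const_sub _
    exact (h1.clog (hpos _ hq)).const_add _
  · rw [hlg, hB, boost_den _ _ hr1, Matrix.det_mul, det_one_sub_rowMatrix]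
    simp only
    rw [Complex.exp_add, Complex.exp_log (boost_det_D_ne_zero _ _ hr1),
      Complex.exp_log (Complex.slitPlane_ne_zero (hpos Z hZ))]
  · exact boost_row_act hr2 hr1 i hi

theorem exists_isAdapted_matZ_eq_zero (hK : 0 < K) {p : Idx N m n → ℂ}
    (hp : p ∈ domainY N m n K) : ∃ f g, IsAdapted N m n K f g ∧ matZ (f p) = 0 := by
  suffices h : ∀ S : Finset (Fin m), ∃ f g, IsAdapted N m n K f g ∧ ∀ i ∈ S, matZ (f p) i = 0 by
    obtain ⟨f, g, h1, h2⟩ := h Finset.univ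
    exact ⟨f, g, h1, funext fun i => h2 i (Finset.mem_univ i)⟩
  intro S
  induction S using Finset.induction_on with
  | empty => exact ⟨_, _, isAdapted_id, by simp⟩
  | insert e S _ ih =>
    obtain ⟨f, g, h1, h2⟩ := ih
    obtain ⟨f', g', h3, h4⟩ := exists_isAdapted_row hK (h1.maps hp) e
    refine ⟨_, _, h1.comp hK h3, fun i hi => h4 i ?_⟩
    rcases Finset.mem_insert.1 hi with h | h
    · exact Or.inl h
    · exact Or.inr (h2 i h)

/-- The unit vector in direction `W` is completed to an orthonormal basis; the rows of `U` are the
conjugated basis vectors. -/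
theorem exists_unitary_mulVec (W : Fin (N + 1) → ℂ) : ∃ U : Matrix (Fin (N + 1)) (Fin (N + 1)) ℂ,
    U * Uᴴ = 1 ∧ U *ᵥ W = Pi.single 0 ((√(∑ j, ‖W j‖ ^ 2) : ℝ) : ℂ) := by
  set w : EuclideanSpace ℂ (Fin (N + 1)) := WithLp.toLp 2 W with hw
  have hnorm : ‖w‖ = √(∑ j, ‖W j‖ ^ 2) := by rw [EuclideanSpace.norm_eq]
  obtain ⟨u, hu, hwu⟩ : ∃ u : EuclideanSpace ℂ (Fin (N + 1)), ‖u‖ = 1 ∧ w = (‖w‖ : ℂ) • u := by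
    by_cases h : w = 0
    · exact ⟨EuclideanSpace.single 0 1, by simp, by simp [h]⟩
    · refine ⟨((‖w‖⁻¹ : ℝ) : ℂ) • w, ?_, ?_⟩
      · rw [norm_smul, Complex.norm_real, norm_inv, norm_norm, inv_mul_cancel₀ (norm_ne_zero_iff.2 h)]
      · rw [smul_smul, ← Complex.ofReal_mul, mul_inv_cancel₀ (norm_ne_zero_iff.2 h)]
        simp
  obtain ⟨b, hb⟩ := Orthonormal.exists_orthonormalBasis_extension_of_card_eq (𝕜 := ℂ)
    (ι := Fin (N + 1)) (E := EuclideanSpace ℂ (Fin (N + 1))) (by simp) (v := fun _ => u) (s := {0})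
    (by
      rw [orthonormal_iff_ite]
      rintro ⟨i, hi⟩ ⟨j, hj⟩
      have : i = j := hi.trans hj.symm
      subst this
      simp [hu, inner_self_eq_norm_sq_to_K])
  have hb0 : b 0 = u := hb 0 rfl
  have hin : ∀ (i : Fin (N + 1)) (y : EuclideanSpace ℂ (Fin (N + 1))),
      ∑ j, conj (b i j) * y j = inner ℂ (b i) y := fun i y => by
    rw [PiLp.inner_apply]
    exact Finset.sum_congr rfl fun j _ => by rw [RCLike.inner_apply]; ring
  refine ⟨Matrix.of fun i j => conj (b i j), ?_, ?_⟩
  · ext i k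
    rw [Matrix.mul_apply]
    simp only [Matrix.conjTranspose_apply, Matrix.of_apply, Complex.star_def, Complex.conj_conj]
    rw [hin, orthonormal_iff_ite.1 b.orthonormal, Matrix.one_apply]
  · funext i
    rw [Matrix.mulVec, dotProduct]
    simp only [Matrix.of_apply]
    have := hin i w
    rw [hwu, inner_smul_right, ← hb0, orthonormal_iff_ite.1 b.orthonormal] at this
    rw [hb0, ← hwu] at this
    refine this.trans ?_
    rw [← hnorm, Pi.single_apply]
    simp

/-- Unitary maps of the `W` coordinates. -/
def rotW (U : Matrix (Fin N) (Fin N) ℂ) (p : Idx N m n → ℂ) : Idx N m n → ℂ :=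
  Sum.elim (U *ᵥ fun j => p (Sum.inl j)) fun i => p (Sum.inr i)

theorem normSqW_rotW {U : Matrix (Fin N) (Fin N) ℂ} (hU : Uᴴ * U = 1) (p : Idx N m n → ℂ) :
    normSqW (rotW U p) = normSqW p := by
  have h : ∀ W : Fin N → ℂ, ((∑ j, ‖W j‖ ^ 2 : ℝ) : ℂ) = star W ⬝ᵥ W := fun W => by
    rw [dotProduct]
    push_cast
    exact Finset.sum_congr rfl fun j _ => (Complex.conj_mul' _).symm
  have h1 := h (U *ᵥ fun j => p (Sum.inl j))
  rw [Matrix.star_mulVec, ← Matrix.dotProduct_mulVec, Matrix.mulVec_mulVec, hU, Matrix.one_mulVec,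
    ← h] at h1
  exact_mod_cast h1

theorem rotW_mem (U : Matrix (Fin N) (Fin N) ℂ) (hU : Uᴴ * U = 1) {p : Idx N m n → ℂ}
    (hp : p ∈ domainY N m n K) : rotW U p ∈ domainY N m n K :=
  ⟨hp.1, by rw [normSqW_rotW hU]; exact hp.2⟩

theorem hasFDerivAt_rotW (U : Matrix (Fin N) (Fin N) ℂ) (p : Idx N m n → ℂ) :
    HasFDerivAt (𝕜 := ℂ) (rotW U) (LinearMap.toContinuousLinearMap (Matrix.toLin'
      (Matrix.fromBlocks U 0 0 (1 : Matrix (Fin m × Fin n) (Fin m × Fin n) ℂ)))) p := by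
  have : (rotW U : (Idx N m n → ℂ) → _) = LinearMap.toContinuousLinearMap (Matrix.toLin'
      (Matrix.fromBlocks U 0 0 (1 : Matrix (Fin m × Fin n) (Fin m × Fin n) ℂ))) := by
    funext q
    rw [LinearMap.coe_toContinuousLinearMap', Matrix.toLin'_apply, Matrix.fromBlocks_mulVec]
    simp only [Matrix.zero_mulVec, add_zero, zero_add, Matrix.one_mulVec]
    rfl
  rw [this]
  exact ContinuousLinearMap.hasFDerivAt _

theorem isAdapted_rotW {U : Matrix (Fin N) (Fin N) ℂ} (hU : U * Uᴴ = 1) :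
    IsAdapted N m n K (rotW U) (rotW Uᴴ) := by
  have hU' : Uᴴ * U = 1 := mul_eq_one_comm.1 hU
  have hdiff : ∀ U : Matrix (Fin N) (Fin N) ℂ, DifferentiableOn ℂ (rotW U) (domainY N m n K) :=
    fun U p _ => (hasFDerivAt_rotW U p).differentiableAt.differentiableWithinAt
  have hcomp : ∀ U V : Matrix (Fin N) (Fin N) ℂ, U * V = 1 → ∀ p : Idx N m n → ℂ,
      rotW U (rotW V p) = p := by
    intro U V h p
    funext i
    rcases i with j | i
    · show (U *ᵥ (V *ᵥ fun j => p (Sum.inl j))) j = _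
      rw [Matrix.mulVec_mulVec, h, Matrix.one_mulVec]
    · rfl
  refine ⟨⟨hdiff _, hdiff _, fun p hp => rotW_mem U hU' hp, fun p hp => rotW_mem Uᴴ (by simpa using hU) hp,
    fun p _ => hcomp _ _ hU' p, fun p _ => hcomp _ _ hU p⟩, fun p hp => ?_, fun p hp => ?_⟩
  · have h1 : jac (rotW U) p = U.det := by
      rw [jac_eq_det, (hasFDerivAt_rotW U p).fderiv]
      show LinearMap.det (Matrix.toLin'
        (Matrix.fromBlocks U 0 0 (1 : Matrix (Fin m × Fin n) (Fin m × Fin n) ℂ))) = _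
      rw [LinearMap.det_toLin', Matrix.det_fromBlocks_zero₂₁, Matrix.det_one, mul_one]
    have h2 := congrArg Matrix.det hU
    rw [Matrix.det_mul, Matrix.det_conjTranspose, Matrix.det_one, Complex.star_def,
      Complex.mul_conj'] at h2
    have h3 : ‖U.det‖ ^ 2 = 1 := by exact_mod_cast h2
    rw [h1, h3, one_mul]
    rfl
  · show normSqW (rotW U p) * _ = _
    rw [normSqW_rotW hU']
    rfl

/-- Every point can be moved to a point `(w e₁, 0)`. -/
theorem exists_isAdapted_single (hK : 0 < K) {p : Idx (N + 1) m n → ℂ}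
    (hp : p ∈ domainY (N + 1) m n K) : ∃ f g, IsAdapted (N + 1) m n K f g ∧
      f p = Pi.single (Sum.inl 0) ((√(varX K p) : ℝ) : ℂ) := by
  obtain ⟨f, g, h1, h2⟩ := exists_isAdapted_matZ_eq_zero hK hp
  obtain ⟨U, hU, hUW⟩ := exists_unitary_mulVec fun j => f p (Sum.inl j)
  refine ⟨_, _, h1.comp hK (isAdapted_rotW hU), ?_⟩
  -- `X` is invariant, and at a point with `Z = 0` it equals `|W|²`.
  have hX : varX K p = ∑ j, ‖f p (Sum.inl j)‖ ^ 2 := by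
    rw [← h1.varX_eq p hp, varX, genNorm, h2, Matrix.zero_mul, sub_zero, Matrix.det_one,
      Complex.one_re, Real.one_rpow, mul_one]
    rfl
  funext i
  rcases i with j | i
  · show (U *ᵥ fun j => f p (Sum.inl j)) j = _
    rw [hUW, hX]
    simp [Pi.single_apply]
  · show f p (Sum.inr i) = _
    have : f p (Sum.inr i) = matZ (f p) i.1 i.2 := rfl
    rw [this, h2]
    simp

theorem varX_lt_one (hK : 0 < K) {p : Idx N m n → ℂ} (hp : p ∈ domainY N m n K) :
    varX K p < 1 := by
  have hb := genNorm_pos hp.1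
  have h1 : normSqW p < genNorm p ^ K⁻¹ :=
    (Real.lt_rpow_inv_iff_of_pos (normSqW_nonneg p) hb.le hK).2 hp.2
  rw [varX, Real.rpow_neg hb.le, one_div, ← div_eq_mul_inv, div_lt_one (by positivity)]
  exact h1

theorem varX_nonneg {p : Idx N m n → ℂ} (hp : p ∈ domainY N m n K) : 0 ≤ varX K p :=
  mul_nonneg (normSqW_nonneg p) (Real.rpow_nonneg (genNorm_pos hp.1).le _)

end Normalize

/-! ### The Bergman kernel -/

section Kernel

variable {N m n : ℕ} {K : ℝ}

theorem genNorm_single (w : ℂ) (j : Fin N) :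
    genNorm (Pi.single (Sum.inl j) w : Idx N m n → ℂ) = 1 := by
  have : matZ (Pi.single (Sum.inl j) w : Idx N m n → ℂ) = 0 := by
    ext i j
    simp [matZ]
  simp [genNorm, this]

theorem exists_isReproAt (hK : 0 < K) {p : Idx (N + 1) m n → ℂ} (hp : p ∈ domainY (N + 1) m n K) :
    ∃ k, IsReproAt (domainY (N + 1) m n K) p k := by
  obtain ⟨f, g, hf, hfp⟩ := exists_isAdapted_single hK hp
  have hw : ‖((√(varX K p) : ℝ) : ℂ)‖ < 1 := by
    rw [Complex.norm_real, Real.norm_of_nonneg (Real.sqrt_nonneg _), Real.sqrt_lt' one_pos, one_pow]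
    exact varX_lt_one hK hp
  have h := isReproAt_single (N := N) (m := m) (n := n) hK hw
  rw [← hfp] at h
  exact ⟨_, hf.toIsBiholo.isReproAt (isOpen_domainY hK) hp h⟩

/-- At the normal form `(√X e₁, 0)` the kernel is a constant times `G(X)` and the determinant is 1,
so the Jacobian factor of the transformation law is the stated power of `det (I - Z Z̄ᵗ)` at `p`. -/
theorem IsBergmanKernel.diag_eq (hK : 0 < K) {k : (Idx (N + 1) m n → ℂ) → (Idx (N + 1) m n → ℂ) → ℂ}
    (hk : IsBergmanKernel (domainY (N + 1) m n K) k) {p : Idx (N + 1) m n → ℂ}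
    (hp : p ∈ domainY (N + 1) m n K) :
    k p p = (((K ^ (m * n))⁻¹ * (Real.pi ^ (m * n + (N + 1)))⁻¹ *
      bergmanG (N + 1) m n (bCoeff (N + 1) m n K) (varX K p) *
      genNorm p ^ (-((m : ℝ) + n + (N + 1 : ℕ) / K)) : ℝ) : ℂ) := by
  obtain ⟨f, g, hf, hfp⟩ := exists_isAdapted_single hK hp
  have hX := varX_nonneg hp (K := K)
  have hw : ‖((√(varX K p) : ℝ) : ℂ)‖ < 1 := by
    rw [Complex.norm_real, Real.norm_of_nonneg (Real.sqrt_nonneg _), Real.sqrt_lt' one_pos, one_pow]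
    exact varX_lt_one hK hp
  have h := isReproAt_single (N := N) (m := m) (n := n) hK hw
  have hmem := single_mem_domainY (m := m) (n := n) hK (0 : Fin (N + 1)) hw
  rw [hk.transform (isOpen_domainY hK) hf.toIsBiholo hp, hfp,
    (hk.isReproAt hmem).unique hmem h, Pi.single_eq_same, Complex.conj_ofReal, ← Complex.ofReal_mul,
    Real.mul_self_sqrt hX, ← ofReal_bergmanG, ← Complex.ofReal_mul, ← Complex.ofReal_mul]
  have hj := hf.jac_eq p hp
  have hb := genNorm_pos hp.1
  rw [hfp, genNorm_single, Real.one_rpow] at hj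
  rw [Real.rpow_neg hb.le, ← eq_inv_of_mul_eq_one_left hj]
  congr 1
  ring

end Kernel

/-! ### The unit ball -/

section Ball

variable {α β : Type} [Fintype α] [DecidableEq α] [Fintype β] [DecidableEq β]

theorem one_sub_mul_conjTranspose_of_unique [Unique α] (Z : Matrix α β ℂ) :
    1 - Z * Zᴴ = Matrix.diagonal fun _ => ((1 - ∑ i, ∑ j, ‖Z i j‖ ^ 2 : ℝ) : ℂ) := by
  ext i k
  obtain rfl := Unique.eq_default i
  obtain rfl := Unique.eq_default k
  simp only [Matrix.sub_apply, Matrix.one_apply_eq, Matrix.mul_apply, Matrix.conjTranspose_apply,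
    Complex.star_def, Complex.mul_conj', Matrix.diagonal_apply_eq, Finset.univ_unique,
    Finset.sum_singleton]
  push_cast
  rfl

theorem posDef_one_sub_of_unique [Unique α] (Z : Matrix α β ℂ) :
    (1 - Z * Zᴴ).PosDef ↔ ∑ i, ∑ j, ‖Z i j‖ ^ 2 < 1 := by
  rw [one_sub_mul_conjTranspose_of_unique, Matrix.posDef_diagonal_iff]
  simp only [forall_const, Complex.zero_lt_real, sub_pos]

theorem det_one_sub_of_unique [Unique α] (Z : Matrix α β ℂ) :
    (1 - Z * Zᴴ).det.re = 1 - ∑ i, ∑ j, ‖Z i j‖ ^ 2 := by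
  rw [one_sub_mul_conjTranspose_of_unique, Matrix.det_diagonal]
  simp [-Complex.ofReal_sub, -Complex.ofReal_sum]

/-- For one row `det (I - Z Z̄ᵗ) = 1 - |Z|²`, and a column is the adjoint of a row; with `K = 1` the
defining inequality is `|W|² + |Z|² < 1`. -/
theorem domainY_eq_unitBall (N : ℕ) {m n : ℕ} (h : m = 1 ∨ n = 1) :
    domainY N m n 1 = unitBall (Idx N m n) := by
  have key : ∀ Z : Matrix (Fin m) (Fin n) ℂ, ((1 - Z * Zᴴ).PosDef ↔ ∑ i, ∑ j, ‖Z i j‖ ^ 2 < 1) ∧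
      (1 - Z * Zᴴ).det.re = 1 - ∑ i, ∑ j, ‖Z i j‖ ^ 2 := by
    intro Z
    rcases h with rfl | rfl
    · exact ⟨posDef_one_sub_of_unique Z, det_one_sub_of_unique Z⟩
    · have h1 := posDef_one_sub_of_unique Zᴴ
      have h2 := det_one_sub_of_unique Zᴴ
      simp only [Matrix.conjTranspose_conjTranspose, Matrix.conjTranspose_apply, norm_star] at h1 h2
      rw [Finset.sum_comm] at h1 h2
      exact ⟨(posDef_one_sub_comm Z).trans h1, by rw [det_one_sub_comm, h2]⟩
  ext p
  have h1 := key (matZ p)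
  have h2 : ∑ i, ‖p i‖ ^ 2 = normSqW p + ∑ i, ∑ j, ‖matZ p i j‖ ^ 2 := by
    rw [Fintype.sum_sum_type, Fintype.sum_prod_type]
    rfl
  have h3 := normSqW_nonneg p
  rw [unitBall, mem_ofPred_eq, h2, domainY, mem_ofPred_eq, cartanI, mem_ofPred_eq, h1.1, genNorm, h1.2,
    Real.rpow_one]
  exact ⟨fun h => by linarith [h.2], fun h => ⟨by linarith, by linarith⟩⟩

/-- The ball is the matrix ball of matrices with one row, and the boost attached to that row sends
it to 0. -/
theorem exists_isBiholo_unitBall_zero {p : β → ℂ} (hp : p ∈ unitBall β) :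
    ∃ f g, IsBiholo (unitBall β) f g ∧ f p = 0 := by
  have hmem : ∀ Z : Matrix Unit β ℂ, Z () ∈ unitBall β ↔ (1 - Zᴴ * Z).PosDef := fun Z => by
    rw [← posDef_one_sub_comm, posDef_one_sub_of_unique]
    simp [unitBall]
  set Z := Matrix.replicateRow Unit p with hZ
  obtain ⟨a, r, hr1, hr2⟩ := exists_boost_coeff (show ∑ j, ‖Z () j‖ ^ 2 < 1 from hp)
  set B := boost (rowMatrix () (Z ())) a r _ (rowMatrix_mul_conj_mul () (Z ())) hr2 with hB
  have hpos : ∀ q ∈ unitBall β, (1 - (Matrix.replicateRow Unit q)ᴴ * Matrix.replicateRow Unit q).PosDef :=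
    fun q hq => (hmem _).1 hq
  have hd : ∀ B : PseudoUnitary Unit β, DifferentiableOn ℂ
      (fun q => B.act (Matrix.replicateRow Unit q) ()) (unitBall β) := fun B q hq => by
    refine DifferentiableAt.differentiableWithinAt (differentiableAt_pi.2 fun j => ?_)
    refine B.differentiableAt_act (fun i j => ?_) (B.isUnit_det_den (hpos q hq)) () j
    simp only [Matrix.replicateRow_apply]
    fun_prop
  have hm : ∀ B : PseudoUnitary Unit β,
      MapsTo (fun q => B.act (Matrix.replicateRow Unit q) ()) (unitBall β) (unitBall β) :=
    fun B q hq => (hmem _).2 (B.posDef_act (hpos q hq))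
  have hi : ∀ B : PseudoUnitary Unit β, ∀ q ∈ unitBall β, B.inv.act (Matrix.replicateRow Unit
      (B.act (Matrix.replicateRow Unit q) ())) () = q := fun B q hq => by
    have h := B.inv_act_act (hpos q hq)
    exact congrFun h ()
  refine ⟨_, _, ⟨hd B, hd B.inv, hm B, hm B.inv, hi B, fun q hq => ?_⟩, ?_⟩
  · have h := hi B.inv q hq
    rwa [B.inv_inv] at h
  · exact boost_row_act hr2 hr1 () (Or.inl rfl)

theorem isHomogeneousDomain_unitBall : IsHomogeneousDomain (unitBall β) := by
  intro p hp q hq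
  obtain ⟨f, g, h1, h2⟩ := exists_isBiholo_unitBall_zero hp
  obtain ⟨f', g', h3, h4⟩ := exists_isBiholo_unitBall_zero hq
  have h := h1.comp h3.symm
  refine ⟨_, _, h.diff, h.diff', h.maps, h.maps', h.inv, ?_⟩
  rw [h2, ← h4, h3.inv.1 hq]

end Ball

/-! ### Second order jets of functions of one real variable -/

section Jet

/-- `f` has value `a`, derivative `b` and second derivative `c` at `0`. -/
def HasJet (f : ℝ → ℝ) (a b c : ℝ) : Prop :=
  ∃ f', (∀ᶠ t in 𝓝 (0 : ℝ), HasDerivAt f (f' t) t) ∧ HasDerivAt f' c 0 ∧ f 0 = a ∧ f' 0 = b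

theorem HasJet.deriv_deriv {f : ℝ → ℝ} {a b c : ℝ} (h : HasJet f a b c) :
    deriv (deriv f) 0 = c := by
  obtain ⟨f', h1, h2, -, -⟩ := h
  have : deriv f =ᶠ[𝓝 0] f' := by filter_upwards [h1] with t ht using ht.deriv
  rw [this.deriv_eq, h2.deriv]

theorem hasDerivAt_of_contDiffAt_two {f : ℝ → ℝ} {x : ℝ} (hf : ContDiffAt ℝ 2 f x) :
    (∀ᶠ y in 𝓝 x, HasDerivAt f (deriv f y) y) ∧ HasDerivAt (deriv f) (deriv (deriv f) x) x := by
  constructor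
  · filter_upwards [hf.eventually (by simp)] with y hy
    exact (hy.differentiableAt (by simp)).hasDerivAt
  · have h1 : DifferentiableAt ℝ (fun y => fderiv ℝ f y 1) x :=
      (contDiffAt_two_fderiv hf).clm_apply (differentiableAt_const _)
    exact h1.hasDerivAt

theorem HasJet.of_contDiffAt {f : ℝ → ℝ} (hf : ContDiffAt ℝ 2 f 0) :
    HasJet f (f 0) (deriv f 0) (deriv (deriv f) 0) :=
  ⟨deriv f, (hasDerivAt_of_contDiffAt_two hf).1, (hasDerivAt_of_contDiffAt_two hf).2, rfl, rfl⟩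

theorem HasJet.mul {f g : ℝ → ℝ} {a b c a' b' c' : ℝ} (hf : HasJet f a b c)
    (hg : HasJet g a' b' c') :
    HasJet (fun t => f t * g t) (a * a') (b * a' + a * b') (c * a' + 2 * b * b' + a * c') := by
  obtain ⟨f', h1, h2, rfl, rfl⟩ := hf
  obtain ⟨g', h1', h2', rfl, rfl⟩ := hg
  refine ⟨fun t => f' t * g t + f t * g' t, ?_, ?_, rfl, rfl⟩
  · filter_upwards [h1, h1'] with t ht ht' using ht.mul ht'
  · convert! (h2.mul h1'.self_of_nhds).add (h1.self_of_nhds.mul h2') using 1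
    ring

theorem HasJet.comp {f g : ℝ → ℝ} {a b c : ℝ} (hf : HasJet f a b c) (hg : ContDiffAt ℝ 2 g a) :
    HasJet (fun t => g (f t)) (g a) (deriv g a * b)
      (deriv (deriv g) a * b ^ 2 + deriv g a * c) := by
  obtain ⟨f', h1, h2, rfl, rfl⟩ := hf
  obtain ⟨h3, h4⟩ := hasDerivAt_of_contDiffAt_two hg
  have h0 := h1.self_of_nhds
  refine ⟨fun t => deriv g (f t) * f' t, ?_, ?_, rfl, rfl⟩
  · filter_upwards [h1, h0.continuousAt.eventually h3] with t ht ht' using ht'.comp t ht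
  · convert! (h4.comp (0 : ℝ) h0).mul h2 using 1
    simp only [Function.comp_apply]
    ring

theorem HasJet.sub {f g : ℝ → ℝ} {a b c a' b' c' : ℝ} (hf : HasJet f a b c)
    (hg : HasJet g a' b' c') : HasJet (fun t => f t - g t) (a - a') (b - b') (c - c') := by
  obtain ⟨f', h1, h2, rfl, rfl⟩ := hf
  obtain ⟨g', h1', h2', rfl, rfl⟩ := hg
  refine ⟨fun t => f' t - g' t, ?_, h2.sub h2', rfl, rfl⟩
  filter_upwards [h1, h1'] with t ht ht' using ht.sub ht'

theorem HasJet.const_mul {f : ℝ → ℝ} {a b c : ℝ} (hf : HasJet f a b c) (r : ℝ) :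
    HasJet (fun t => r * f t) (r * a) (r * b) (r * c) := by
  obtain ⟨f', h1, h2, rfl, rfl⟩ := hf
  refine ⟨fun t => r * f' t, ?_, h2.const_mul r, rfl, rfl⟩
  filter_upwards [h1] with t ht using ht.const_mul r

theorem HasJet.quadratic (a b c : ℝ) : HasJet (fun t => a + b * t + c * t ^ 2) a b (2 * c) := by
  refine ⟨fun t => b + 2 * c * t, Eventually.of_forall fun t => ?_, ?_, by simp, by simp⟩
  · convert! (((hasDerivAt_id t).const_mul b).const_add a).add ((hasDerivAt_pow 2 t).const_mul c) using 1
    simp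
    ring
  · convert! ((hasDerivAt_id (0 : ℝ)).const_mul (2 * c)).const_add b using 1
    simp

end Jet

/-! ### The Levi form of functions of `X` and `det (I - Z Z*)` -/

section Smooth

variable {N m n : ℕ} {K : ℝ}

theorem contDiff_normSqW (k : ℕ) : ContDiff ℝ k (normSqW : (Idx N m n → ℂ) → ℝ) := by
  refine ContDiff.sum fun j _ => ContDiff.norm_sq ℝ ?_
  exact contDiff_apply ℝ ℂ _

theorem contDiff_genNorm (k : ℕ) : ContDiff ℝ k (genNorm : (Idx N m n → ℂ) → ℝ) := by
  refine Complex.reCLM.contDiff.comp ?_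
  have h1 : ContDiff ℝ k fun p : Idx N m n → ℂ =>
      (fun i j => (1 - matZ p * (matZ p)ᴴ : Matrix (Fin m) (Fin m) ℂ) i j : Fin m → Fin m → ℂ) := by
    refine contDiff_pi.2 fun i => contDiff_pi.2 fun j => ?_
    simp only [Matrix.sub_apply, Matrix.mul_apply, Matrix.conjTranspose_apply, matZ, Matrix.of_apply,
      Complex.star_def]
    refine contDiff_const.sub (ContDiff.sum fun l _ => ?_)
    exact (contDiff_apply ℝ ℂ _).mul (Complex.conjCLE.contDiff.comp (contDiff_apply ℝ ℂ _))
  exact ((contDiff_det (κ := Fin m) (k := k)).restrict_scalars ℝ).comp h1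

theorem contDiffAt_varX (k : ℕ) {p : Idx N m n → ℂ} (hp : matZ p ∈ cartanI m n) :
    ContDiffAt ℝ k (varX K) p :=
  (contDiff_normSqW k).contDiffAt.mul
    ((contDiff_genNorm k).contDiffAt.rpow_const_of_ne (genNorm_pos hp).ne')

theorem contDiffAt_comp_varX (k : ℕ) {p : Idx N m n → ℂ} (hp : matZ p ∈ cartanI m n) {ℓ : ℝ → ℝ}
    (hℓ : ContDiffAt ℝ k ℓ (varX K p)) (lam : ℝ) :
    ContDiffAt ℝ k (fun q => ℓ (varX K q) - lam * Real.log (genNorm q)) p :=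
  (hℓ.comp p (contDiffAt_varX k hp)).sub
    (contDiffAt_const.mul ((contDiff_genNorm k).contDiffAt.log (genNorm_pos hp).ne'))

/-- On this line `Z = tV`, and `det (1 - t² V Vᴴ) = 1 - t² tr (V Vᴴ) + O(t⁴)`. -/
theorem hasJet_genNorm (w : ℂ) (j : Fin N) (ξ : Idx N m n → ℂ) :
    HasJet (fun t => genNorm ((Pi.single (Sum.inl j) w : Idx N m n → ℂ) + t • ξ)) 1 0
      (-2 * ∑ i, ‖ξ (Sum.inr i)‖ ^ 2) := by
  set V := matZ ξ with hV
  have h1 : ∀ t : ℝ, genNorm ((Pi.single (Sum.inl j) w : Idx N m n → ℂ) + t • ξ) =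
      1 - t ^ 2 * ((V * Vᴴ).trace.re - ((1 + (Polynomial.X : Polynomial ℂ) •
        (V * Vᴴ).map Polynomial.C).det.divX.divX.eval (-(t : ℂ) ^ 2)).re * t ^ 2) := by
    intro t
    have h2 : matZ ((Pi.single (Sum.inl j) w : Idx N m n → ℂ) + t • ξ) = (t : ℂ) • V := by
      ext a b
      simp [matZ, hV]
    have h3 : 1 - ((t : ℂ) • V) * ((t : ℂ) • V)ᴴ = 1 + (-(t : ℂ) ^ 2) • (V * Vᴴ) := by
      rw [Matrix.conjTranspose_smul, Matrix.smul_mul, Matrix.mul_smul, smul_smul, Complex.star_def,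
        Complex.conj_ofReal]
      module
    rw [genNorm, h2, h3, Matrix.det_one_add_smul]
    have h4 : (-(t : ℂ) ^ 2) = ((-t ^ 2 : ℝ) : ℂ) := by push_cast; ring
    have h5 : (-(t : ℂ) ^ 2) ^ 2 = ((t ^ 4 : ℝ) : ℂ) := by push_cast; ring
    rw [h5, h4]
    simp only [Complex.add_re, Complex.one_re, Complex.re_mul_ofReal]
    ring
  simp only [h1]
  set P := (1 + (Polynomial.X : Polynomial ℂ) • (V * Vᴴ).map Polynomial.C).det.divX.divX
  have hP : ContDiff ℝ 2 fun t : ℝ => (V * Vᴴ).trace.re - (P.eval (-(t : ℂ) ^ 2)).re * t ^ 2 := by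
    refine contDiff_const.sub (ContDiff.mul ?_ (contDiff_id.pow 2))
    refine Complex.reCLM.contDiff.comp ((P.differentiable.contDiff (n := 2)).restrict_scalars ℝ |>.comp ?_)
    exact (Complex.ofRealCLM.contDiff.pow 2).neg
  have h2 := (HasJet.quadratic 1 0 0).sub ((HasJet.quadratic 0 0 1).mul (HasJet.of_contDiffAt hP.contDiffAt))
  convert! h2 using 1
  · funext t; ring
  · ring
  · ring
  · have : (V * Vᴴ).trace.re = ∑ i, ‖ξ (Sum.inr i)‖ ^ 2 := by
      rw [Matrix.trace, Fintype.sum_prod_type, Complex.re_sum]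
      refine Finset.sum_congr rfl fun a _ => ?_
      rw [Matrix.diag_apply, Matrix.mul_apply, Complex.re_sum]
      refine Finset.sum_congr rfl fun b _ => ?_
      rw [Matrix.conjTranspose_apply, Complex.star_def, Complex.mul_conj', ← Complex.ofReal_pow,
        Complex.ofReal_re]
      rfl
    rw [← this]
    simp

theorem hasJet_normSqW (w : ℂ) (ξ : Idx (N + 1) m n → ℂ) :
    HasJet (fun t => normSqW ((Pi.single (Sum.inl 0) w : Idx (N + 1) m n → ℂ) + t • ξ)) (‖w‖ ^ 2)
      (2 * (w * conj (ξ (Sum.inl 0))).re) (2 * ∑ j, ‖ξ (Sum.inl j)‖ ^ 2) := by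
  convert! HasJet.quadratic (‖w‖ ^ 2) (2 * (w * conj (ξ (Sum.inl 0))).re)
    (∑ j, ‖ξ (Sum.inl j)‖ ^ 2) using 2 with t
  have h1 : ∀ x y : ℂ, ‖x + t • y‖ ^ 2 = ‖x‖ ^ 2 + 2 * (x * conj y).re * t + ‖y‖ ^ 2 * t ^ 2 := by
    intro x y
    simp only [← Complex.normSq_eq_norm_sq, Complex.normSq_apply, Complex.add_re, Complex.add_im,
      Complex.real_smul, Complex.mul_re, Complex.mul_im, Complex.ofReal_re, Complex.ofReal_im,
      Complex.conj_re, Complex.conj_im]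
    ring
  rw [normSqW]
  simp only [Pi.add_apply, Pi.smul_apply, h1, Finset.sum_add_distrib, ← Finset.sum_mul]
  congr 2
  · rw [Finset.sum_eq_single 0]
    · simp
    · intro j _ hj; simp [hj]
    · simp
  · rw [Finset.sum_eq_single 0]
    · simp
    · intro j _ hj; simp [hj]
    · simp

theorem hasJet_comp_varX {w : ℂ} {ℓ : ℝ → ℝ} (hℓ : ContDiffAt ℝ 2 ℓ (‖w‖ ^ 2)) (lam : ℝ)
    (ξ : Idx (N + 1) m n → ℂ) :
    HasJet (fun t => ℓ (varX K ((Pi.single (Sum.inl 0) w : Idx (N + 1) m n → ℂ) + t • ξ)) -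
        lam * Real.log (genNorm ((Pi.single (Sum.inl 0) w : Idx (N + 1) m n → ℂ) + t • ξ)))
      (ℓ (‖w‖ ^ 2)) (deriv ℓ (‖w‖ ^ 2) * (2 * (w * conj (ξ (Sum.inl 0))).re))
      (deriv (deriv ℓ) (‖w‖ ^ 2) * (2 * (w * conj (ξ (Sum.inl 0))).re) ^ 2 +
        deriv ℓ (‖w‖ ^ 2) * (2 * ∑ j, ‖ξ (Sum.inl j)‖ ^ 2 +
          ‖w‖ ^ 2 * (2 / K * ∑ i, ‖ξ (Sum.inr i)‖ ^ 2)) + lam * (2 * ∑ i, ‖ξ (Sum.inr i)‖ ^ 2)) := by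
  have hr : ContDiffAt ℝ 2 (fun x : ℝ => x ^ (-(1 / K))) 1 :=
    Real.contDiffAt_rpow_const_of_ne one_ne_zero
  have hlog : ContDiffAt ℝ 2 Real.log 1 := Real.contDiffAt_log.2 one_ne_zero
  have hr1 : deriv (fun x : ℝ => x ^ (-(1 / K))) 1 = -(1 / K) := by
    rw [Real.deriv_rpow_const]; simp
  have hg := hasJet_genNorm w (0 : Fin (N + 1)) ξ
  have hX := (hasJet_normSqW w ξ).mul (hg.comp hr)
  rw [Real.one_rpow, mul_one, hr1] at hX
  have h := (hX.comp hℓ).sub ((hg.comp hlog).const_mul lam)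
  rw [Real.log_one, Real.deriv_log] at h
  convert! h using 1 <;> ring

/-- The jets along `ξ` and `iξ` are added; the squared first-order terms, a real and an imaginary
part, combine to `4 |w|² |ξ₀|²`. Hence the form is diagonal at `(w e₁, 0)`. -/
theorem leviForm_comp_varX {w : ℂ} {ℓ : ℝ → ℝ} (hℓ : ContDiffAt ℝ 2 ℓ (‖w‖ ^ 2)) (lam : ℝ)
    (ξ : Idx (N + 1) m n → ℂ) :
    leviForm (fun p : Idx (N + 1) m n → ℂ => ℓ (varX K p) - lam * Real.log (genNorm p))
        (Pi.single (Sum.inl 0) w) ξ ξ =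
      ((‖w‖ ^ 2 * deriv (deriv ℓ) (‖w‖ ^ 2) * ‖ξ (Sum.inl 0)‖ ^ 2 +
        deriv ℓ (‖w‖ ^ 2) * ∑ j, ‖ξ (Sum.inl j)‖ ^ 2 +
        (lam + ‖w‖ ^ 2 / K * deriv ℓ (‖w‖ ^ 2)) * ∑ i, ‖ξ (Sum.inr i)‖ ^ 2 : ℝ) : ℂ) := by
  have hZ : matZ (Pi.single (Sum.inl 0) w : Idx (N + 1) m n → ℂ) = 0 := by
    ext i j
    simp [matZ]
  have hX : varX K (Pi.single (Sum.inl 0) w : Idx (N + 1) m n → ℂ) = ‖w‖ ^ 2 := by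
    have := (hasJet_normSqW w (0 : Idx (N + 1) m n → ℂ))
    rw [varX, genNorm_single, Real.one_rpow, mul_one]
    obtain ⟨_, _, _, h, _⟩ := this
    simpa using h
  have hmem : matZ (Pi.single (Sum.inl 0) w : Idx (N + 1) m n → ℂ) ∈ cartanI m n := by
    rw [hZ, cartanI, mem_ofPred_eq, Matrix.zero_mul, sub_zero]
    exact Matrix.PosDef.one
  rw [leviForm_self (contDiffAt_comp_varX 2 hmem (by rw [hX]; exact hℓ) lam),
    (hasJet_comp_varX hℓ lam ξ).deriv_deriv, (hasJet_comp_varX hℓ lam _).deriv_deriv]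
  have h1 : (2 * (w * conj (ξ (Sum.inl 0))).re) ^ 2 +
      (2 * (w * conj ((Complex.I • ξ) (Sum.inl 0))).re) ^ 2 = 4 * (‖w‖ ^ 2 * ‖ξ (Sum.inl 0)‖ ^ 2) := by
    simp only [← Complex.normSq_eq_norm_sq, Complex.normSq_apply, Pi.smul_apply, smul_eq_mul, map_mul,
      Complex.conj_I, Complex.mul_re, Complex.mul_im, Complex.conj_re, Complex.conj_im, Complex.neg_re,
      Complex.neg_im, Complex.I_re, Complex.I_im]
    ring
  have h2 : ∀ i, ‖(Complex.I • ξ) i‖ = ‖ξ i‖ := fun i => by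
    rw [Pi.smul_apply, norm_smul, Complex.norm_I, one_mul]
  rw [eq_comm, eq_div_iff (by norm_num)]
  norm_cast
  simp only [h2]
  linear_combination -deriv (deriv ℓ) (‖w‖ ^ 2) * h1

end Smooth

/-! ### The Bergman metric and biholomorphic maps -/

section Metric

variable {ι : Type} [Fintype ι] [DecidableEq ι]

/-- Polarization: testing on `e_i + c e_j` with `c = 1` and `c = i` kills the off-diagonal entries.
-/
theorem leviForm_single_of_diag {u : (ι → ℂ) → ℝ} {p : ι → ℂ} {d : ι → ℝ}
    (h : ∀ ξ, leviForm u p ξ ξ = ((∑ i, d i * ‖ξ i‖ ^ 2 : ℝ) : ℂ)) (i j : ι) :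
    leviForm u p (Pi.single i 1) (Pi.single j 1) = if i = j then (d i : ℂ) else 0 := by
  have hs : ∀ i, leviForm u p (Pi.single i 1) (Pi.single i 1) = (d i : ℂ) := fun i => by
    rw [h, Finset.sum_eq_single i]
    · simp
    · intro l _ hl; simp [hl]
    · simp
  split_ifs with hij
  · subst hij; exact hs i
  · have h2 : ∀ c : ℂ, conj c * leviForm u p (Pi.single i 1) (Pi.single j 1) +
        c * leviForm u p (Pi.single j 1) (Pi.single i 1) = 0 := by
      intro c
      have h3 := h (Pi.single i 1 + c • Pi.single j 1)
      have h4 : (∑ l, d l * ‖((Pi.single i 1 + c • Pi.single j 1 : ι → ℂ)) l‖ ^ 2 : ℝ) =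
          d i + d j * ‖c‖ ^ 2 := by
        rw [Finset.sum_eq_add i j hij]
        · simp [hij, Ne.symm hij]
        · intro l _ hl; simp [hl.1, hl.2]
        · simp
        · simp
      rw [h4, leviForm_add_left, leviForm_add_right, leviForm_add_right] at h3
      simp only [leviForm_smul_left, leviForm_smul_right, hs] at h3
      push_cast at h3
      rw [← Complex.mul_conj' c] at h3
      linear_combination h3
    have h3 := h2 1
    have h4 := h2 Complex.I
    rw [map_one] at h3
    rw [Complex.conj_I] at h4
    linear_combination (1 / 2 : ℂ) * h3 + (Complex.I / 2) * h4 +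
      (1 / 2 : ℂ) * (leviForm u p (Pi.single i 1) (Pi.single j 1) -
        leviForm u p (Pi.single j 1) (Pi.single i 1)) * Complex.I_sq

theorem complexHessian_of_diag {u : (ι → ℂ) → ℝ} {p : ι → ℂ} (hu : ContDiffAt ℝ 2 u p) {d : ι → ℝ}
    (h : ∀ ξ, leviForm u p ξ ξ = ((∑ i, d i * ‖ξ i‖ ^ 2 : ℝ) : ℂ)) :
    complexHessian u p = Matrix.diagonal fun i => (d i : ℂ) := by
  ext i j
  rw [complexHessian_apply hu, leviForm_single_of_diag h, Matrix.diagonal_apply]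

variable {Ω : Set (ι → ℂ)} {k : (ι → ℂ) → (ι → ℂ) → ℂ} {f g : (ι → ℂ) → (ι → ℂ)}

/-- The logarithms of the kernel at `q` and at `f q` differ by `log |jac f|²`, which has zero Levi
form. -/
theorem bergmanMetric_transform (hΩ : IsOpen Ω) (hk : IsBergmanKernel Ω k)
    (hpos : ∀ p ∈ Ω, 0 < (k p p).re) (hφ : ∀ p ∈ Ω, ContDiffAt ℝ 2 (fun q => Real.log (k q q).re) p)
    (h : IsBiholo Ω f g) {p : ι → ℂ} (hp : p ∈ Ω) :
    bergmanMetric k p = (jacobian f p)ᵀ * bergmanMetric k (f p) * (jacobian f p).map conj := by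
  have hf : ContDiffAt ℂ 2 f p :=
    (contDiffOn_of_differentiableOn hΩ h.diff 2).contDiffAt (hΩ.mem_nhds hp)
  have hj : ContDiffAt ℂ 2 (jac f) p := (contDiffOn_of_differentiableOn hΩ
    (jac_differentiableOn hΩ h.diff) 2).contDiffAt (hΩ.mem_nhds hp)
  have hj0 : ∀ q ∈ Ω, jac f q ≠ 0 := fun q hq => right_ne_zero_of_mul_eq_one (h.jac_mul hΩ hq)
  have he : (fun q => Real.log (k q q).re) =ᶠ[𝓝 p]
      fun q => Real.log (k (f q) (f q)).re + Real.log (‖jac f q‖ ^ 2) := by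
    filter_upwards [hΩ.mem_nhds hp] with q hq
    have h1 := norm_ne_zero_iff.2 (hj0 q hq)
    rw [hk.transform hΩ h hq, Complex.re_ofReal_mul,
      Real.log_mul (pow_ne_zero 2 h1) (hpos _ (h.maps hq)).ne', add_comm]
  have hφf := hφ _ (h.maps hp)
  have h2 : ContDiffAt ℝ 2 (fun q => Real.log (k (f q) (f q)).re) p :=
    hφf.comp p (hf.restrict_scalars ℝ)
  have h3 : ContDiffAt ℝ 2 (fun q => Real.log (‖jac f q‖ ^ 2)) p :=
    ((hj.restrict_scalars ℝ).norm_sq ℝ).log (pow_ne_zero 2 (norm_ne_zero_iff.2 (hj0 p hp)))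
  rw [bergmanMetric, bergmanMetric, ← complexHessian_comp hφf hf]
  ext i j
  rw [complexHessian_apply (hφ p hp), leviForm_congr he, leviForm_add h2 h3,
    leviForm_log_normSq hj (hj0 p hp), add_zero, complexHessian_apply h2]

/-- Both `det g` and the diagonal kernel acquire the factor `|jac f|²`, so their quotient is an
invariant function. -/
theorem det_bergmanMetric_transform (hΩ : IsOpen Ω) (hk : IsBergmanKernel Ω k)
    (hpos : ∀ p ∈ Ω, 0 < (k p p).re) (hφ : ∀ p ∈ Ω, ContDiffAt ℝ 2 (fun q => Real.log (k q q).re) p)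
    (h : IsBiholo Ω f g) {p : ι → ℂ} (hp : p ∈ Ω) :
    (bergmanMetric k p).det.re * (k (f p) (f p)).re =
      (bergmanMetric k (f p)).det.re * (k p p).re := by
  have h1 : (bergmanMetric k p).det = (‖jac f p‖ ^ 2 : ℝ) * (bergmanMetric k (f p)).det := by
    rw [bergmanMetric_transform hΩ hk hpos hφ h hp, Matrix.det_mul, Matrix.det_mul,
      Matrix.det_transpose, ← RingHom.mapMatrix_apply, ← RingHom.map_det, Complex.ofReal_pow,
      ← Complex.mul_conj', jac]
    ring
  rw [h1, hk.transform hΩ h hp, Complex.re_ofReal_mul, Complex.re_ofReal_mul]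
  ring

theorem posDef_bergmanMetric_transform (hΩ : IsOpen Ω) (hk : IsBergmanKernel Ω k)
    (hpos : ∀ p ∈ Ω, 0 < (k p p).re) (hφ : ∀ p ∈ Ω, ContDiffAt ℝ 2 (fun q => Real.log (k q q).re) p)
    (h : IsBiholo Ω f g) {p : ι → ℂ} (hp : p ∈ Ω) (hg : (bergmanMetric k (f p)).PosDef) :
    (bergmanMetric k p).PosDef := by
  have h1 : star ((jacobian f p).map conj) = (jacobian f p)ᵀ := by
    ext i j
    simp [Matrix.star_eq_conjTranspose]
  have hu : IsUnit ((jacobian f p).map conj) := by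
    rw [Matrix.isUnit_iff_isUnit_det, ← RingHom.mapMatrix_apply, ← RingHom.map_det]
    exact (isUnit_iff_ne_zero.2 (right_ne_zero_of_mul_eq_one (h.jac_mul hΩ hp))).map _
  rw [bergmanMetric_transform hΩ hk hpos hφ h hp, ← h1]
  exact (Matrix.IsUnit.posDef_star_left_conjugate_iff hu).2 hg

/-- Under transitivity the invariant quotient is constant, so `log det g` and `log k` have the same
Hessian and the Einstein constant is `-1`. -/
theorem isEinsteinOn_of_isHomogeneousDomain (hΩ : IsOpen Ω) (hk : IsBergmanKernel Ω k)
    (hpos : ∀ p ∈ Ω, 0 < (k p p).re) (hφ : ∀ p ∈ Ω, ContDiffAt ℝ 2 (fun q => Real.log (k q q).re) p)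
    (hΩh : IsHomogeneousDomain Ω) {p₀ : ι → ℂ} (hp₀ : p₀ ∈ Ω) (hg : (bergmanMetric k p₀).PosDef) :
    IsEinsteinOn Ω (bergmanMetric k) := by
  have hmove : ∀ p ∈ Ω, ∃ f g, IsBiholo Ω f g ∧ f p = p₀ := fun p hp => by
    obtain ⟨f, g, h1, h2, h3, h4, h5, h6⟩ := hΩh p hp p₀ hp₀
    exact ⟨f, g, ⟨h1, h2, h3, h4, h5⟩, h6⟩
  have hdet0 : 0 < (bergmanMetric k p₀).det.re := (Complex.pos_iff.1 hg.det_pos).1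
  refine ⟨fun p hp => ?_, -1, fun p hp => ?_⟩
  · obtain ⟨f, g, h, rfl⟩ := hmove p hp
    exact posDef_bergmanMetric_transform hΩ hk hpos hφ h hp hg
  · set C := Real.log ((bergmanMetric k p₀).det.re / (k p₀ p₀).re) with hC
    have he : (fun q => Real.log (bergmanMetric k q).det.re) =ᶠ[𝓝 p]
        fun q => Real.log (k q q).re + C := by
      filter_upwards [hΩ.mem_nhds hp] with q hq
      obtain ⟨f, g, h, h0⟩ := hmove q hq
      have h1 := det_bergmanMetric_transform hΩ hk hpos hφ h hq
      rw [h0] at h1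
      have h2 := hpos _ hp₀
      rw [hC, ← Real.log_mul (hpos q hq).ne' (div_pos hdet0 h2).ne', ← mul_div_assoc,
        mul_comm (k q q).re, ← h1, mul_div_cancel_right₀ _ h2.ne']
    have h1 : ContDiffAt ℝ 2 (fun q => Real.log (k q q).re + C) p := (hφ p hp).add contDiffAt_const
    rw [ricci, bergmanMetric]
    ext i j
    rw [Matrix.neg_apply, complexHessian_apply (h1.congr_of_eventuallyEq he), leviForm_congr he,
      leviForm_add_const, Matrix.smul_apply, complexHessian_apply (hφ p hp)]
    simp

end Metric

/-! ### The Bergman metric of `Y_I` -/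

section Cartan

variable {N m n : ℕ} {K : ℝ} {k : (Idx (N + 1) m n → ℂ) → (Idx (N + 1) m n → ℂ) → ℂ}

/-- The logarithm of `G` up to an additive constant: `log k(p,p)` is `logG (X)` minus a multiple of
`log det (I - Z Z*)`. -/
def logG (N m n : ℕ) (K : ℝ) (x : ℝ) : ℝ :=
  Real.log ((K ^ (m * n))⁻¹ * (Real.pi ^ (m * n + N))⁻¹ * bergmanG N m n (bCoeff N m n K) x)

theorem contDiffAt_bergmanG (N m n : ℕ) (b : ℕ → ℝ) (l : ℕ) {x : ℝ} (hx : x < 1) :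
    ContDiffAt ℝ l (bergmanG N m n b) x :=
  (contDiffOn_bergmanG N m n b l).contDiffAt (Iio_mem_nhds hx)

theorem kernelConst_pos (N m n : ℕ) (hK : 0 < K) :
    0 < (K ^ (m * n))⁻¹ * (Real.pi ^ (m * n + N))⁻¹ := by
  have := Real.pi_pos
  positivity

theorem contDiffAt_logG (N m n : ℕ) (hK : 0 < K) (l : ℕ) {x : ℝ} (h0 : 0 ≤ x) (h1 : x < 1) :
    ContDiffAt ℝ l (logG N m n K) x :=
  (contDiffAt_const.mul (contDiffAt_bergmanG N m n _ l h1)).log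
    (mul_pos (kernelConst_pos N m n hK) (bergmanG_pos N m n hK h0 h1)).ne'

theorem log_kernel (hK : 0 < K) (hk : IsBergmanKernel (domainY (N + 1) m n K) k)
    {p : Idx (N + 1) m n → ℂ} (hp : p ∈ domainY (N + 1) m n K) :
    0 < (k p p).re ∧ Real.log (k p p).re = logG (N + 1) m n K (varX K p) -
      ((m : ℝ) + n + (N + 1 : ℕ) / K) * Real.log (genNorm p) := by
  have hb := genNorm_pos hp.1
  have h1 := mul_pos (kernelConst_pos (N + 1) m n hK)
    (bergmanG_pos (N + 1) m n hK (varX_nonneg hp) (varX_lt_one hK hp))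
  have h2 := Real.rpow_pos_of_pos hb (-((m : ℝ) + n + (N + 1 : ℕ) / K))
  rw [hk.diag_eq hK hp, Complex.ofReal_re]
  refine ⟨mul_pos h1 h2, ?_⟩
  rw [Real.log_mul h1.ne' h2.ne', Real.log_rpow hb, logG]
  ring

theorem log_kernel_eventuallyEq (hK : 0 < K) (hk : IsBergmanKernel (domainY (N + 1) m n K) k)
    {p : Idx (N + 1) m n → ℂ} (hp : p ∈ domainY (N + 1) m n K) :
    (fun q => Real.log (k q q).re) =ᶠ[𝓝 p] fun q => logG (N + 1) m n K (varX K q) -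
      ((m : ℝ) + n + (N + 1 : ℕ) / K) * Real.log (genNorm q) := by
  filter_upwards [(isOpen_domainY hK).mem_nhds hp] with q hq using (log_kernel hK hk hq).2

theorem contDiffAt_log_kernel (hK : 0 < K) (hk : IsBergmanKernel (domainY (N + 1) m n K) k)
    {p : Idx (N + 1) m n → ℂ} (hp : p ∈ domainY (N + 1) m n K) :
    ContDiffAt ℝ 2 (fun q => Real.log (k q q).re) p :=
  (contDiffAt_comp_varX 2 hp.1 (contDiffAt_logG _ _ _ hK 2 (varX_nonneg hp) (varX_lt_one hK hp))
    _).congr_of_eventuallyEq (log_kernel_eventuallyEq hK hk hp)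

/-- The diagonal entries of the complex Hessian of `ℓ(X) - lam log det (I - Z Z*)` at
`(w e₁, 0)`, where `x = |w|²`. -/
def diagEntry (K : ℝ) (ℓ : ℝ → ℝ) (lam x : ℝ) : Idx (N + 1) m n → ℝ :=
  Sum.elim (fun j => deriv ℓ x + if j = 0 then x * deriv (deriv ℓ) x else 0)
    fun _ => lam + x / K * deriv ℓ x

theorem leviForm_comp_varX_eq_sum {w : ℂ} {ℓ : ℝ → ℝ} (hℓ : ContDiffAt ℝ 2 ℓ (‖w‖ ^ 2)) (lam : ℝ)
    (ξ : Idx (N + 1) m n → ℂ) :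
    leviForm (fun p : Idx (N + 1) m n → ℂ => ℓ (varX K p) - lam * Real.log (genNorm p))
        (Pi.single (Sum.inl 0) w) ξ ξ =
      ((∑ i, diagEntry K ℓ lam (‖w‖ ^ 2) i * ‖ξ i‖ ^ 2 : ℝ) : ℂ) := by
  rw [leviForm_comp_varX hℓ, Fintype.sum_sum_type]
  congr 1
  simp only [diagEntry, Sum.elim_inl, Sum.elim_inr, add_mul, ite_mul, zero_mul,
    Finset.sum_add_distrib, ← Finset.mul_sum, Finset.sum_ite_eq', Finset.mem_univ, if_true]
  ring

theorem varX_single (w : ℂ) : varX K (Pi.single (Sum.inl 0) w : Idx (N + 1) m n → ℂ) = ‖w‖ ^ 2 := by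
  rw [varX, genNorm_single, Real.one_rpow, mul_one, normSqW, Finset.sum_eq_single 0]
  · simp
  · intro j _ hj; simp [hj]
  · simp

theorem bergmanMetric_single (hK : 0 < K) (hk : IsBergmanKernel (domainY (N + 1) m n K) k) {w : ℂ}
    (hw : ‖w‖ < 1) : bergmanMetric k (Pi.single (Sum.inl 0) w) = Matrix.diagonal fun i =>
      (diagEntry K (logG (N + 1) m n K) ((m : ℝ) + n + (N + 1 : ℕ) / K) (‖w‖ ^ 2) i : ℂ) := by
  have hp := single_mem_domainY (m := m) (n := n) hK (0 : Fin (N + 1)) hw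
  refine complexHessian_of_diag (contDiffAt_log_kernel hK hk hp) fun ξ => ?_
  rw [leviForm_congr (log_kernel_eventuallyEq hK hk hp), leviForm_comp_varX_eq_sum]
  exact contDiffAt_logG _ _ _ hK 2 (by positivity) (by nlinarith [norm_nonneg w])

/-- The quotient of `det g` and the kernel as a function of `X`. -/
def detQuot (N m n : ℕ) (K x : ℝ) : ℝ :=
  (deriv (logG (N + 1) m n K) x + x * deriv (deriv (logG (N + 1) m n K)) x) *
    deriv (logG (N + 1) m n K) x ^ N *
    (((m : ℝ) + n + (N + 1 : ℕ) / K) + x / K * deriv (logG (N + 1) m n K) x) ^ (m * n) /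
      ((K ^ (m * n))⁻¹ * (Real.pi ^ (m * n + (N + 1)))⁻¹ *
        bergmanG (N + 1) m n (bCoeff (N + 1) m n K) x)

/-- By invariance the quotient may be computed at `(√X e₁, 0)`, where the metric is diagonal. -/
theorem det_bergmanMetric (hK : 0 < K) (hk : IsBergmanKernel (domainY (N + 1) m n K) k)
    {p : Idx (N + 1) m n → ℂ} (hp : p ∈ domainY (N + 1) m n K) :
    (bergmanMetric k p).det.re = (k p p).re * detQuot N m n K (varX K p) := by
  obtain ⟨f, g, hf, hfp⟩ := exists_isAdapted_single hK hp
  have hX0 := varX_nonneg hp (K := K)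
  have hX1 := varX_lt_one hK hp
  have hn : ‖((√(varX K p) : ℝ) : ℂ)‖ ^ 2 = varX K p := by
    rw [Complex.norm_real, Real.norm_of_nonneg (Real.sqrt_nonneg _), Real.sq_sqrt hX0]
  have hw : ‖((√(varX K p) : ℝ) : ℂ)‖ < 1 := by
    rw [Complex.norm_real, Real.norm_of_nonneg (Real.sqrt_nonneg _), Real.sqrt_lt' one_pos, one_pow]
    exact hX1
  have hc := mul_pos (kernelConst_pos (N + 1) m n hK) (bergmanG_pos (N + 1) m n hK hX0 hX1)
  have h := det_bergmanMetric_transform (isOpen_domainY hK) hk (fun q hq => (log_kernel hK hk hq).1)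
    (fun q hq => contDiffAt_log_kernel hK hk hq) hf.toIsBiholo hp
  have hmem := single_mem_domainY (m := m) (n := n) hK (0 : Fin (N + 1)) hw
  have hk2 : (k (f p) (f p)).re = (K ^ (m * n))⁻¹ * (Real.pi ^ (m * n + (N + 1)))⁻¹ *
      bergmanG (N + 1) m n (bCoeff (N + 1) m n K) (varX K p) := by
    rw [hfp, hk.diag_eq hK hmem, varX_single, genNorm_single, Real.one_rpow, hn, mul_one,
      Complex.ofReal_re]
  have hd : (bergmanMetric k (f p)).det.re = (k (f p) (f p)).re * detQuot N m n K (varX K p) := by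
    rw [hk2, detQuot, mul_div_cancel₀ _ hc.ne', hfp, bergmanMetric_single hK hk hw,
      Matrix.det_diagonal, hn, Fintype.prod_sum_type, Fin.prod_univ_succ]
    simp only [diagEntry, Sum.elim_inl, Sum.elim_inr, if_true, Fin.succ_ne_zero, if_false, add_zero,
      Finset.prod_const, Finset.card_univ, Fintype.card_fin, Fintype.card_prod]
    norm_cast
  rw [hd, mul_comm, mul_assoc] at h
  have h3 : (k (f p) (f p)).re ≠ 0 := by rw [hk2]; exact hc.ne'
  rw [mul_left_cancel₀ h3 h, mul_comm]

end Cartan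

/-! ### Kähler–Einstein Bergman metrics -/

section Einstein

variable {N m n : ℕ} {K : ℝ} {k : (Idx (N + 1) m n → ℂ) → (Idx (N + 1) m n → ℂ) → ℂ}

theorem deriv_logG (N m n : ℕ) (hK : 0 < K) {x : ℝ} (h0 : 0 ≤ x) (h1 : x < 1) :
    let G := bergmanG N m n (bCoeff N m n K)
    deriv (logG N m n K) x = deriv G x / G x ∧
    deriv (deriv (logG N m n K)) x = (deriv (deriv G) x * G x - deriv G x ^ 2) / G x ^ 2 := by
  intro G
  have hG := bergmanG_pos N m n hK h0 h1
  have hc := kernelConst_pos N m n hK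
  obtain ⟨hG1, hG2⟩ := hasDerivAt_of_contDiffAt_two (contDiffAt_bergmanG N m n (bCoeff N m n K) 2 h1)
  have hev : ∀ᶠ y in 𝓝 x, 0 < G y :=
    (contDiffAt_bergmanG N m n (bCoeff N m n K) 0 h1).continuousAt.eventually (lt_mem_nhds hG)
  have h : deriv (logG N m n K) =ᶠ[𝓝 x] fun y => deriv G y / G y := by
    filter_upwards [hG1, hev] with y hy hy0
    have := ((hy.const_mul ((K ^ (m * n))⁻¹ * (Real.pi ^ (m * n + N))⁻¹)).log
      (mul_pos hc hy0).ne').deriv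
    refine this.trans ?_
    rw [mul_div_mul_left _ _ hc.ne']
  refine ⟨h.self_of_nhds, ?_⟩
  rw [h.deriv_eq, sq (deriv G x)]
  exact (hG2.div hG1.self_of_nhds hG.ne').deriv

theorem contDiffAt_deriv {f : ℝ → ℝ} {l : ℕ} {x : ℝ} (h : ContDiffAt ℝ (l + 1 : ℕ) f x) :
    ContDiffAt ℝ l (deriv f) x :=
  (h.fderiv_right (m := l) (by norm_cast)).clm_apply contDiffAt_const

theorem contDiffAt_detQuot (N m n : ℕ) (hK : 0 < K) {x : ℝ} (h0 : 0 ≤ x) (h1 : x < 1) :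
    ContDiffAt ℝ 2 (detQuot N m n K) x := by
  have h2 : ContDiffAt ℝ (3 : ℕ) (deriv (logG (N + 1) m n K)) x :=
    contDiffAt_deriv (contDiffAt_logG (N + 1) m n hK 4 h0 h1)
  have h3 : ContDiffAt ℝ (2 : ℕ) (deriv (deriv (logG (N + 1) m n K))) x := contDiffAt_deriv h2
  have h2' : ContDiffAt ℝ (2 : ℕ) (deriv (logG (N + 1) m n K)) x := h2.of_le (by norm_cast)
  have hid : ContDiffAt ℝ (2 : ℕ) (fun x : ℝ => x) x := contDiffAt_id
  refine ContDiffAt.div (n := ((2 : ℕ) : WithTop ℕ∞)) (((h2'.add (hid.mul h3)).mul (h2'.pow N)).mul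
    ((contDiffAt_const.add ((hid.div_const K).mul h2')).pow (m * n)))
    (contDiffAt_const.mul (contDiffAt_bergmanG (N + 1) m n _ 2 h1))
    (mul_pos (kernelConst_pos (N + 1) m n hK) (bergmanG_pos (N + 1) m n hK h0 h1)).ne'

/-- The equation says `(x f')' = 0`, and `x f'` vanishes at 0. -/
theorem eq_of_deriv_add_mul_deriv_deriv_eq_zero {f : ℝ → ℝ}
    (hf : ∀ x ∈ Ico (0 : ℝ) 1, ContDiffAt ℝ 2 f x)
    (h : ∀ x ∈ Ico (0 : ℝ) 1, deriv f x + x * deriv (deriv f) x = 0) {x : ℝ} (hx : x ∈ Ico (0 : ℝ) 1) :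
    f x = f 0 := by
  have hsub : ∀ x ∈ Ico (0 : ℝ) 1, ∀ y ∈ Icc 0 x, y ∈ Ico (0 : ℝ) 1 := fun x hx y hy =>
    ⟨hy.1, hy.2.trans_lt hx.2⟩
  have hd : ∀ x ∈ Ico (0 : ℝ) 1, HasDerivAt (fun y => y * deriv f y) 0 x := fun x hx => by
    have h1 := (hasDerivAt_id x).mul (hasDerivAt_of_contDiffAt_two (hf x hx)).2
    rw [one_mul] at h1
    exact (h x hx) ▸ h1
  have hz : ∀ x ∈ Ico (0 : ℝ) 1, deriv f x = 0 := fun x hx => by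
    have h1 := constant_of_has_deriv_right_zero
      (fun y hy => (hd y (hsub x hx y hy)).continuousAt.continuousWithinAt)
      (fun y hy => (hd y (hsub x hx y (Ico_subset_Icc_self hy))).hasDerivWithinAt) x ⟨hx.1, le_rfl⟩
    rcases hx.1.eq_or_lt with h0 | h0
    -- At `x = 0` the vanishing of `x f'` says nothing, but the equation itself gives `f'(0) = 0`.
    · have := h x hx
      rw [← h0] at this ⊢
      rwa [zero_mul, add_zero] at this
    · rw [zero_mul] at h1
      exact (mul_eq_zero.1 h1).resolve_left h0.ne'
  have hd' : ∀ x ∈ Ico (0 : ℝ) 1, HasDerivAt f 0 x := fun x hx => by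
    rw [← hz x hx]
    exact (hasDerivAt_of_contDiffAt_two (hf x hx)).1.self_of_nhds
  exact constant_of_has_deriv_right_zero
    (fun y hy => (hd' y (hsub x hx y hy)).continuousAt.continuousWithinAt)
    (fun y hy => (hd' y (hsub x hx y (Ico_subset_Icc_self hy))).hasDerivWithinAt) x ⟨hx.1, le_rfl⟩

theorem posDef_bergmanMetric_zero (hK : 0 < K)
    (hk : IsBergmanKernel (domainY (N + 1) m n K) k) :
    (bergmanMetric k (Pi.single (Sum.inl 0) 0)).PosDef := by
  have hG := bergmanG_pos (N + 1) m n hK le_rfl zero_lt_one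
  have hG' := deriv_bergmanG_zero_pos (N + 1) m n hK
  rw [bergmanMetric_single hK hk (by simp), Matrix.posDef_diagonal_iff]
  intro i
  rw [norm_zero, zero_pow two_ne_zero, Complex.zero_lt_real]
  rcases i with j | i
  · simp only [diagEntry, Sum.elim_inl, zero_mul, ite_self, add_zero]
    rw [(deriv_logG (N + 1) m n hK le_rfl zero_lt_one).1]
    exact div_pos hG' hG
  · simp only [diagEntry, Sum.elim_inr, zero_div, zero_mul, add_zero]
    positivity

theorem detQuot_const_of_isEinsteinOn (hm : 1 ≤ m) (hn : 1 ≤ n) (hK : 0 < K)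
    (hk : IsBergmanKernel (domainY (N + 1) m n K) k)
    (hE : IsEinsteinOn (domainY (N + 1) m n K) (bergmanMetric k)) {x : ℝ} (hx : x ∈ Ico (0 : ℝ) 1) :
    detQuot N m n K x = detQuot N m n K 0 := by
  obtain ⟨hP, c, hc⟩ := hE
  have hΩ := isOpen_domainY (N := N + 1) (m := m) (n := n) hK
  have hpt : ∀ x ∈ Ico (0 : ℝ) 1, ∃ w : ℂ, ‖w‖ < 1 ∧ ‖w‖ ^ 2 = x := fun x hx =>
    ⟨(√x : ℝ), by
      rw [Complex.norm_real, Real.norm_of_nonneg (Real.sqrt_nonneg _), Real.sqrt_lt' one_pos, one_pow]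
      exact hx.2, by
      rw [Complex.norm_real, Real.norm_of_nonneg (Real.sqrt_nonneg _), Real.sq_sqrt hx.1]⟩
  have hdet : ∀ p ∈ domainY (N + 1) m n K, 0 < detQuot N m n K (varX K p) := fun p hp => by
    have h1 := (Complex.pos_iff.1 (hP p hp).det_pos).1
    rw [det_bergmanMetric hK hk hp] at h1
    exact (pos_iff_pos_of_mul_pos h1).1 (log_kernel hK hk hp).1
  have hpos : ∀ x ∈ Ico (0 : ℝ) 1, 0 < detQuot N m n K x := fun x hx => by
    obtain ⟨w, hw, rfl⟩ := hpt x hx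
    have := hdet _ (single_mem_domainY (m := m) (n := n) hK (0 : Fin (N + 1)) hw)
    rwa [varX_single] at this
  set η : ℝ → ℝ := fun x => Real.log (detQuot N m n K x) with hη
  have hηc : ∀ x ∈ Ico (0 : ℝ) 1, ContDiffAt ℝ 2 η x := fun x hx =>
    (contDiffAt_detQuot N m n hK hx.1 hx.2).log (hpos x hx).ne'
  -- Since `log det g = log k + η(X)`, the Einstein condition compares the Hessian of `η(X)`, with
  -- `lam = 0`, to a multiple of the metric, entry by entry on the diagonal.
  have hentry : ∀ x ∈ Ico (0 : ℝ) 1, ∀ i : Idx (N + 1) m n, diagEntry K η 0 x i =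
      -(1 + c) * diagEntry K (logG (N + 1) m n K) ((m : ℝ) + n + (N + 1 : ℕ) / K) x i := by
    intro x hx i
    obtain ⟨w, hw, rfl⟩ := hpt x hx
    have hp := single_mem_domainY (m := m) (n := n) hK (0 : Fin (N + 1)) hw
    set p : Idx (N + 1) m n → ℂ := Pi.single (Sum.inl 0) w with hpw
    have hXp : varX K p = ‖w‖ ^ 2 := varX_single w
    have he : (fun q => Real.log (bergmanMetric k q).det.re) =ᶠ[𝓝 p]
        fun q => Real.log (k q q).re + (η (varX K q) - 0 * Real.log (genNorm q)) := by
      filter_upwards [hΩ.mem_nhds hp] with q hq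
      rw [det_bergmanMetric hK hk hq, Real.log_mul (log_kernel hK hk hq).1.ne' (hdet q hq).ne', hη,
        zero_mul, sub_zero]
    have h1 := contDiffAt_log_kernel hK hk hp
    have h2 : ContDiffAt ℝ 2 (fun q : Idx (N + 1) m n → ℂ =>
        η (varX K q) - 0 * Real.log (genNorm q)) p :=
      contDiffAt_comp_varX 2 hp.1 (by rw [hXp]; exact hηc _ hx) 0
    have h3 := congrFun (congrFun (hc p hp) i) i
    rw [ricci, Matrix.neg_apply, complexHessian_apply ((h1.add h2).congr_of_eventuallyEq he),
      leviForm_congr he, leviForm_add h1 h2,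
      leviForm_single_of_diag (leviForm_comp_varX_eq_sum (hηc _ hx) 0), if_pos rfl,
      ← complexHessian_apply h1] at h3
    change -(bergmanMetric k p i i + _) = _ at h3
    rw [Matrix.smul_apply, bergmanMetric_single hK hk hw, Matrix.diagonal_apply_eq, smul_eq_mul] at h3
    have h4 : (diagEntry K η 0 (‖w‖ ^ 2) i : ℂ) = ((-(1 + c) * diagEntry K (logG (N + 1) m n K)
        ((m : ℝ) + n + (N + 1 : ℕ) / K) (‖w‖ ^ 2) i : ℝ) : ℂ) := by
      push_cast at h3 ⊢
      linear_combination -h3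
    exact_mod_cast h4
  have hlam : 0 < (m : ℝ) + n + (N + 1 : ℕ) / K := by positivity
  have h0 : (0 : ℝ) ∈ Ico (0 : ℝ) 1 := ⟨le_rfl, one_pos⟩
  -- At `x = 0`, in a `Z` direction, the Hessian of `η(X)` vanishes while the metric has the entry
  -- `m + n + (N+1)/K > 0`.
  have hc1 : 1 + c = 0 := by
    have h1 := hentry 0 h0 (Sum.inr (⟨0, hm⟩, ⟨0, hn⟩))
    simp only [diagEntry, Sum.elim_inr, zero_div, zero_mul, add_zero] at h1
    have h2 := (mul_eq_zero.1 h1.symm).resolve_right hlam.ne'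
    linarith
  have h1 : η x = η 0 := by
    refine eq_of_deriv_add_mul_deriv_deriv_eq_zero hηc (fun x hx => ?_) hx
    have h2 := hentry x hx (Sum.inl 0)
    rw [hc1, neg_zero, zero_mul] at h2
    simpa [diagEntry] using h2
  exact Real.log_injOn_pos (hpos x hx) (hpos 0 h0) h1

theorem eq_one_of_isEinsteinOn (hm : 1 ≤ m) (hn : 1 ≤ n) (hK : 0 < K)
    (hk : IsBergmanKernel (domainY (N + 1) m n K) k)
    (hE : IsEinsteinOn (domainY (N + 1) m n K) (bergmanMetric k)) : K = 1 ∧ (m = 1 ∨ n = 1) := by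
  refine eq_one_of_reducedMongeAmpere (N := N + 1) (Nat.le_add_left 1 N) hm hn hK
    (C := detQuot N m n K 0 * ((K ^ (m * n))⁻¹ * (Real.pi ^ (m * n + (N + 1)))⁻¹)) fun x hx => ?_
  intro G
  have hG : 0 < G x := bergmanG_pos (N + 1) m n hK hx.1.le hx.2
  have hc := kernelConst_pos (N + 1) m n hK
  have h := detQuot_const_of_isEinsteinOn hm hn hK hk hE (Ioo_subset_Ico_self hx)
  obtain ⟨h1, h2⟩ := deriv_logG (N + 1) m n hK hx.1.le hx.2
  rw [detQuot, div_eq_iff (mul_pos hc hG).ne', h1, h2] at h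
  have e1 : x / K * (deriv G x / G x) = (x / K * deriv G x) / G x := by ring
  have e2 : deriv G x / G x + x * ((deriv (deriv G) x * G x - deriv G x ^ 2) / G x ^ 2) =
      (G x * deriv G x + (G x * deriv (deriv G) x - deriv G x ^ 2) * x) / G x ^ 2 := by
    field_simp
  have e3 : ((m : ℝ) + n + (N + 1 : ℕ) / K) + x / K * (deriv G x / G x) =
      (x / K * deriv G x + ((m : ℝ) + n + (N + 1 : ℕ) / K) * G x) / G x := by
    field_simp
    ring
  -- The constant quotient carries the denominator `G^(2 + N + mn)`; clearing it and the kernel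
  -- leaves `G^(N + 1 + mn + 2)` on the right, the power in the reduced equation.
  rw [e2, e3, div_pow, div_pow, div_mul_div_comm, div_mul_div_comm, div_eq_iff (by positivity)] at h
  rw [Nat.add_sub_cancel]
  linear_combination (exp := 1) h

end Einstein
end CartanHartogs
end

/-! ### The kernel formula and the five equivalent conditions -/

theorem mainTheorem4 (N m n : ℕ) (hN : 1 ≤ N) (hm : 1 ≤ m) (hn : 1 ≤ n) (K : ℝ) (hK : 0 < K) :
    (∃ k, CartanHartogs.IsBergmanKernel (CartanHartogs.domainY N m n K) k) ∧
    ∀ k, CartanHartogs.IsBergmanKernel (CartanHartogs.domainY N m n K) k →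
      ∃ b : ℕ → ℝ,
        (∀ p ∈ CartanHartogs.domainY N m n K,
          k p p = (((K ^ (m * n))⁻¹ * (Real.pi ^ (m * n + N))⁻¹ *
            CartanHartogs.bergmanG N m n b (CartanHartogs.varX K p) *
            CartanHartogs.genNorm p ^ (-((m : ℝ) + n + N / K)) : ℝ) : ℂ)) ∧
        List.TFAE [
          ∃ c : ℝ, 0 < c ∧ CartanHartogs.SolvesReducedMongeAmpere N m n K
            (fun X => c * CartanHartogs.bergmanG N m n b X),
          CartanHartogs.IsEinsteinOn (CartanHartogs.domainY N m n K)
            (CartanHartogs.bergmanMetric k),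
          K = 1 ∧ (m = 1 ∨ n = 1),
          CartanHartogs.domainY N m n K = CartanHartogs.unitBall (CartanHartogs.Idx N m n),
          CartanHartogs.IsHomogeneousDomain (CartanHartogs.domainY N m n K)] := by
  obtain ⟨N, rfl⟩ : ∃ l, N = l + 1 := ⟨N - 1, by omega⟩
  refine ⟨CartanHartogs.exists_isBergmanKernel fun w hw => CartanHartogs.exists_isReproAt hK hw,
    fun k hk => ⟨CartanHartogs.bCoeff (N + 1) m n K, fun p hp => hk.diag_eq hK hp, ?_⟩⟩
  -- The implications are `1 ↔ 3` and the cycle `2 → 3 → 4 → 5 → 2`; the arrows into 3 share the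
  -- root-multiplicity argument.
  tfae_have 1 → 3 := fun ⟨c, hc, h⟩ =>
    CartanHartogs.eq_one_of_solvesReducedMongeAmpere hN hm hn hK hc h
  tfae_have 3 → 1 := by
    rintro ⟨rfl, h⟩
    exact CartanHartogs.solvesReducedMongeAmpere_of_ball hN h
  tfae_have 2 → 3 := CartanHartogs.eq_one_of_isEinsteinOn hm hn hK hk
  tfae_have 3 → 4 := by
    rintro ⟨rfl, h⟩
    exact CartanHartogs.domainY_eq_unitBall (N + 1) h
  tfae_have 4 → 5 := fun h => by
    rw [h]
    exact CartanHartogs.isHomogeneousDomain_unitBall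
  tfae_have 5 → 2 := fun h =>
    CartanHartogs.isEinsteinOn_of_isHomogeneousDomain (CartanHartogs.isOpen_domainY hK) hk
      (fun p hp => (CartanHartogs.log_kernel hK hk hp).1)
      (fun p hp => CartanHartogs.contDiffAt_log_kernel hK hk hp) h
      (CartanHartogs.single_mem_domainY hK 0 (by simp))
      (CartanHartogs.posDef_bergmanMetric_zero hK hk)
  tfae_finish
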